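/- Let $k$ be a field; all schemes and morphisms are over $k$. A groupoid (scheme) $\mathcal G$ consists of an object scheme $\mathcal G_0$, a morphism scheme $\mathcal G_1$, source and target $s,t:\mathcal G_1\to\mathcal G_0$, identity $e:\mathcal G_0\to\mathcal G_1$, inversion $i:\mathcal G_1\to\mathcal G_1$ and composition $m:\mathcal G_1\times_{s,\mathcal G_0,t}\mathcal G_1\to\mathcal G_1$, $(g,h)\mapsto g\circ h$, satisfying the groupoid axioms. A morphism $f=(f_0,f_1):\mathcal X\to\mathcal Y$ of groupoids is *fully faithful* if the square formed by $f_1$, $f_0\times f_0$ and the morphisms $(s,t)$ is cartesian; it is *locally essentially surjective* if there is an fpqc covering of $\mathcal Y_0$ over which the morphism $\mathcal X_0\times_{f_0,\mathcal Y_0,s}\mathcal Y_1\to\mathcal Y_0$, $(x,\phi)\mapsto t(\phi)$, has sections. It is an *equivalence* if it is fully faithful and locally essentially surjective. A representation of $\mathcal G$ (equivariant vector bundle on $\mathcal G$) is a pair $(V,\varphi)$ with $V$ a vector bundle (locally free sheaf of finite rank) on $\mathcal G_0$ and $\varphi:s^*V\to t^*V$ an isomorphism with $m^*\varphi=p_1^*\varphi\circ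 p_2^*\varphi$, where $p_1,p_2$ are the projections of $\mathcal G_1\times_{\mathcal G_0}\mathcal G_1$; a morphism $(V,\varphi)\to(V',\varphi')$ is a morphism $a:V\to V'$ with $t^*a\circ\varphi=\varphi'\circ s^*a$. A morphism of groupoids $f$ induces the pullback functor $f^*(V,\varphi)=(f_0^*V,f_1^*\varphi)$ on representations. Let $G=\mathrm{PGL}_2$ act diagonally on $X=\mathbb P^1\times\mathbb P^1$, and let $G\ltimes X$ be the action groupoid (morphisms $G\times X$, source the projection to $X$, target the action, composition the multiplication in $G$). Let $\mathcal N$ be the groupoid given by the group scheme $\mathcal N_1=\operatorname{Spec} k[\gamma,\delta,x,\delta^{-1}]/(\gamma x+\delta-1)$ over $\mathcal N_0=\mathbb A^1=\operatorname{Spec}k[x]$ with group law $(\gamma,\delta,x)(\gamma',\delta',x)=(\gamma+\delta\gamma',\delta\delta',x)$; so $s=t$ is the projection $(\gamma,\delta,x)\mapsto x$. The group $\mathbb G_m$ acts on $\mathcal N$ by $t\cdot x=tx$ on $\mathcal N_0$ and $t\cdot(\gamma,\delta,x)=(t^{-1}\gamma,\delta,tx)$ on $\mathcal N_1$. Let $\mathbb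 G_m\ltimes\mathcal N$ be the semi-direct product groupoid: its objects are $\mathbb A^1$, its morphisms are $\mathbb G_m\times\mathcal N_1$, the source of $(t,n)$ is $s(n)$, its target is $t\cdot t(n)$ (the action of $t\in\mathbb G_m$ on the target of $n$), and $(t,n)\circ(t',n')=(tt',(t'^{-1}\cdot n)\,n')$. Let $\Psi:\mathbb G_m\ltimes\mathcal N\to G\ltimes X$ be the morphism of groupoids given by $$x\mapsto([x:1],[0:1]),\qquad (t,(\gamma,\delta,x))\mapsto\left(\begin{bmatrix}1&0\\ t^{-1}\gamma&t^{-1}\delta\end{bmatrix},\ ([x:1],[0:1])\right)$$ on objects and on morphisms, respectively. Then $\Psi$ is an equivalence of groupoids, and the pullback functor $\Psi^*$ from the category of representations of $G\ltimes X$ (that is, of $G$-equivariant vector bundles on $X$) to the category of representations of $\mathbb G_m\ltimes\mathcal N$ is an equivalence of categories. -/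

import Mathlib

open CategoryTheory Limits MonoidalCategory CartesianMonoidalCategory AlgebraicGeometry Opposite
open scoped MonObj

universe u v

namespace GrpdSch

/-! ### Groupoid objects -/

section General

/-- A groupoid object: objects, morphisms, source, target, identities, inversion and a composition
`m : mor ×_{s, obj, t} mor ⟶ mor`, `(g, h) ↦ g ∘ h`.  The axioms are stated for generalized
elements; `comp g h` below is `m` evaluated at `(g, h)`. -/
structure GroupoidObj (C : Type u) [Category.{v} C] [HasPullbacks C] where
  obj : C
  mor : C
  s : mor ⟶ obj
  t : mor ⟶ obj
  e : obj ⟶ mor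
  i : mor ⟶ mor
  m : pullback s t ⟶ mor
  e_s : e ≫ s = 𝟙 obj
  e_t : e ≫ t = 𝟙 obj
  i_s : i ≫ s = t
  i_t : i ≫ t = s
  m_s : m ≫ s = pullback.snd s t ≫ s
  m_t : m ≫ t = pullback.fst s t ≫ t
  id_comp : ∀ {T : C} (g : T ⟶ mor),
    pullback.lift (g ≫ t ≫ e) g (by simp [e_s]) ≫ m = g
  comp_id : ∀ {T : C} (g : T ⟶ mor),
    pullback.lift g (g ≫ s ≫ e) (by simp [e_t]) ≫ m = g
  inv_comp : ∀ {T : C} (g : T ⟶ mor),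
    pullback.lift (g ≫ i) g (by simp [i_s]) ≫ m = g ≫ s ≫ e
  comp_inv : ∀ {T : C} (g : T ⟶ mor),
    pullback.lift g (g ≫ i) (by simp [i_t]) ≫ m = g ≫ t ≫ e
  assoc : ∀ {T : C} (f g h : T ⟶ mor) (hfg : f ≫ s = g ≫ t) (hgh : g ≫ s = h ≫ t),
    pullback.lift (pullback.lift f g hfg ≫ m) h (by rw [Category.assoc, m_s, pullback.lift_snd_assoc, hgh]) ≫ m =
      pullback.lift f (pullback.lift g h hgh ≫ m) (by rw [Category.assoc, m_t, pullback.lift_fst_assoc, hfg]) ≫ m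

variable {C : Type u} [Category.{v} C] [HasPullbacks C]

/-- Composition `g ∘ h` of two composable generalized elements. -/
noncomputable def GroupoidObj.comp (𝒢 : GroupoidObj C) {T : C} (g h : T ⟶ 𝒢.mor)
    (w : g ≫ 𝒢.s = h ≫ 𝒢.t) : T ⟶ 𝒢.mor :=
  pullback.lift g h w ≫ 𝒢.m

/-- Constructor of groupoid objects from a natural composition law on generalized elements. -/
noncomputable def GroupoidObj.ofPoints (obj mor : C) (s t : mor ⟶ obj) (e : obj ⟶ mor)
    (i : mor ⟶ mor)
    (c : ∀ {T : C} (g h : T ⟶ mor), g ≫ s = h ≫ t → (T ⟶ mor))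
    (c_nat : ∀ {T T' : C} (f : T' ⟶ T) (g h : T ⟶ mor) (w : g ≫ s = h ≫ t),
      f ≫ c g h w = c (f ≫ g) (f ≫ h) (by simp [w]))
    (e_s : e ≫ s = 𝟙 obj) (e_t : e ≫ t = 𝟙 obj) (i_s : i ≫ s = t) (i_t : i ≫ t = s)
    (c_s : ∀ {T : C} (g h : T ⟶ mor) (w : g ≫ s = h ≫ t), c g h w ≫ s = h ≫ s)
    (c_t : ∀ {T : C} (g h : T ⟶ mor) (w : g ≫ s = h ≫ t), c g h w ≫ t = g ≫ t)
    (id_c : ∀ {T : C} (g : T ⟶ mor), c (g ≫ t ≫ e) g (by simp [e_s]) = g)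
    (c_id : ∀ {T : C} (g : T ⟶ mor), c g (g ≫ s ≫ e) (by simp [e_t]) = g)
    (inv_c : ∀ {T : C} (g : T ⟶ mor), c (g ≫ i) g (by simp [i_s]) = g ≫ s ≫ e)
    (c_inv : ∀ {T : C} (g : T ⟶ mor), c g (g ≫ i) (by simp [i_t]) = g ≫ t ≫ e)
    (assoc : ∀ {T : C} (f g h : T ⟶ mor) (hfg : f ≫ s = g ≫ t) (hgh : g ≫ s = h ≫ t),
      c (c f g hfg) h (by simp [c_s, hgh]) = c f (c g h hgh) (by simp [c_t, hfg])) :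
    GroupoidObj C where
  obj := obj
  mor := mor
  s := s
  t := t
  e := e
  i := i
  m := c (pullback.fst s t) (pullback.snd s t) pullback.condition
  e_s := e_s
  e_t := e_t
  i_s := i_s
  i_t := i_t
  m_s := c_s _ _ _
  m_t := c_t _ _ _
  id_comp g := by simpa [c_nat, pullback.lift_fst, pullback.lift_snd] using id_c g
  comp_id g := by simpa [c_nat, pullback.lift_fst, pullback.lift_snd] using c_id g
  inv_comp g := by simpa [c_nat, pullback.lift_fst, pullback.lift_snd] using inv_c g
  comp_inv g := by simpa [c_nat, pullback.lift_fst, pullback.lift_snd] using c_inv g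
  assoc f g h hfg hgh := by simpa [c_nat, pullback.lift_fst, pullback.lift_snd] using assoc f g h hfg hgh

theorem GroupoidObj.comp_nat (𝒢 : GroupoidObj C) {T T' : C} (f : T' ⟶ T) (g h : T ⟶ 𝒢.mor)
    (w : g ≫ 𝒢.s = h ≫ 𝒢.t) :
    f ≫ 𝒢.comp g h w = 𝒢.comp (f ≫ g) (f ≫ h) (by simp [w]) := by
  rw [GroupoidObj.comp, GroupoidObj.comp, ← Category.assoc]
  congr 1
  ext <;> simp [pullback.lift_fst, pullback.lift_snd]

theorem GroupoidObj.comp_s (𝒢 : GroupoidObj C) {T : C} (g h : T ⟶ 𝒢.mor)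
    (w : g ≫ 𝒢.s = h ≫ 𝒢.t) : 𝒢.comp g h w ≫ 𝒢.s = h ≫ 𝒢.s := by
  rw [GroupoidObj.comp, Category.assoc, 𝒢.m_s, pullback.lift_snd_assoc]

theorem GroupoidObj.comp_t (𝒢 : GroupoidObj C) {T : C} (g h : T ⟶ 𝒢.mor)
    (w : g ≫ 𝒢.s = h ≫ 𝒢.t) : 𝒢.comp g h w ≫ 𝒢.t = g ≫ 𝒢.t := by
  rw [GroupoidObj.comp, Category.assoc, 𝒢.m_t, pullback.lift_fst_assoc]

theorem GroupoidObj.comp_congr (𝒢 : GroupoidObj C) {T : C} {g g' h h' : T ⟶ 𝒢.mor}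
    (w : g ≫ 𝒢.s = h ≫ 𝒢.t) (hg : g = g') (hh : h = h') :
    𝒢.comp g h w = 𝒢.comp g' h' (by rw [← hg, ← hh, w]) := by
  subst hg hh; rfl

/-- A morphism of groupoid objects. -/
structure GroupoidHom (𝒳 𝒴 : GroupoidObj C) where
  f₀ : 𝒳.obj ⟶ 𝒴.obj
  f₁ : 𝒳.mor ⟶ 𝒴.mor
  w_s : f₁ ≫ 𝒴.s = 𝒳.s ≫ f₀
  w_t : f₁ ≫ 𝒴.t = 𝒳.t ≫ f₀
  w_e : 𝒳.e ≫ f₁ = f₀ ≫ 𝒴.e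
  w_m : 𝒳.m ≫ f₁ = pullback.map 𝒳.s 𝒳.t 𝒴.s 𝒴.t f₁ f₁ f₀ w_s.symm w_t.symm ≫ 𝒴.m

variable [CartesianMonoidalCategory C]

/-- `f` is fully faithful if the square formed by `f₁`, `f₀ × f₀` and the maps `(s, t)` is
cartesian. -/
def GroupoidHom.FullyFaithful {𝒳 𝒴 : GroupoidObj C} (f : GroupoidHom 𝒳 𝒴) : Prop :=
  IsPullback f.f₁ (lift 𝒳.s 𝒳.t) (lift 𝒴.s 𝒴.t) (f.f₀ ⊗ₘ f.f₀)

/-- The morphism `f₀' : 𝒳₀ ×_{f₀, 𝒴₀, s} 𝒴₁ ⟶ 𝒴₀`, `(x, φ : f₀ x → y) ↦ y`. -/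
noncomputable def GroupoidHom.essMap {𝒳 𝒴 : GroupoidObj C} (f : GroupoidHom 𝒳 𝒴) :
    pullback f.f₀ 𝒴.s ⟶ 𝒴.obj :=
  pullback.snd f.f₀ 𝒴.s ≫ 𝒴.t

variable (G : C) [GrpObj G]

/-- The action groupoid `G ⋉ X` of a (left) action of a group object `G` on `X`. -/
noncomputable def actionGroupoid (X : C) [ModObj G X] : GroupoidObj C :=
  GroupoidObj.ofPoints X (G ⊗ X) (snd G X) (fst G X • snd G X) (lift 1 (𝟙 X))
    (lift (fst G X)⁻¹ (fst G X • snd G X))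
    (fun g h _ => lift ((g ≫ fst G X) * (h ≫ fst G X)) (h ≫ snd G X))
    (by intros; simp [MonObj.comp_mul])
    (by simp)
    (by simp [ModObj.comp_smul])
    (by simp)
    (by simp [ModObj.comp_smul])
    (by intros; simp)
    (by intro T g h w
        simp only [ModObj.comp_smul, lift_fst, lift_snd, mul_smul] at w ⊢
        rw [w])
    (by intro T g
        ext <;> simp)
    (by intro T g
        ext <;> simp)
    (by intro T g
        ext <;> simp [ModObj.comp_smul, GrpObj.comp_inv])
    (by intro T g
        ext <;> simp [ModObj.comp_smul, GrpObj.comp_inv])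
    (by intro T f g h hfg hgh
        simp [_root_.mul_assoc])

/-- An action of a group object `G` on a groupoid object `𝒳`, that is, actions on objects and on
morphisms for which all structure morphisms are equivariant. -/
structure IsEquivariant (𝒳 : GroupoidObj C) [ModObj G 𝒳.obj] [ModObj G 𝒳.mor] : Prop where
  s_smul : ∀ {T : C} (a : T ⟶ G) (g : T ⟶ 𝒳.mor), (a • g) ≫ 𝒳.s = a • (g ≫ 𝒳.s)
  t_smul : ∀ {T : C} (a : T ⟶ G) (g : T ⟶ 𝒳.mor), (a • g) ≫ 𝒳.t = a • (g ≫ 𝒳.t)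
  e_smul : ∀ {T : C} (a : T ⟶ G) (x : T ⟶ 𝒳.obj), (a • x) ≫ 𝒳.e = a • (x ≫ 𝒳.e)
  i_smul : ∀ {T : C} (a : T ⟶ G) (g : T ⟶ 𝒳.mor), (a • g) ≫ 𝒳.i = a • (g ≫ 𝒳.i)
  comp_smul : ∀ {T : C} (a : T ⟶ G) (g h : T ⟶ 𝒳.mor) (w : g ≫ 𝒳.s = h ≫ 𝒳.t),
    a • 𝒳.comp g h w = 𝒳.comp (a • g) (a • h) (by rw [s_smul, t_smul, w])

theorem semidirect_aux (𝒳 : GroupoidObj C) [ModObj G 𝒳.obj] [ModObj G 𝒳.mor]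
    (H : IsEquivariant G 𝒳) {T : C} {g h : T ⟶ G ⊗ 𝒳.mor}
    (w : g ≫ snd G 𝒳.mor ≫ 𝒳.s = h ≫ (fst G 𝒳.mor • snd G 𝒳.mor) ≫ 𝒳.t) :
    (h ≫ fst G 𝒳.mor)⁻¹ • (g ≫ snd G 𝒳.mor) ≫ 𝒳.s = (h ≫ snd G 𝒳.mor) ≫ 𝒳.t := by
  simp only [← Category.assoc, ModObj.comp_smul, H.t_smul] at w ⊢
  rw [w, ← mul_smul, inv_mul_cancel, one_smul]

/-- The semi-direct product groupoid `G ⋉ 𝒳`: a morphism is a pair `(g, x)`, its source is `s x`,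
its target is `t (g • x)`, and `(g, x) ∘ (h, y) = (g h, (h⁻¹ • x) ∘ y)`. -/
noncomputable def semidirectGroupoid (𝒳 : GroupoidObj C) [ModObj G 𝒳.obj] [ModObj G 𝒳.mor]
    (H : IsEquivariant G 𝒳) : GroupoidObj C :=
  GroupoidObj.ofPoints 𝒳.obj (G ⊗ 𝒳.mor) (snd G 𝒳.mor ≫ 𝒳.s)
    ((fst G 𝒳.mor • snd G 𝒳.mor) ≫ 𝒳.t) (lift 1 𝒳.e)
    (lift (fst G 𝒳.mor)⁻¹ ((fst G 𝒳.mor • snd G 𝒳.mor) ≫ 𝒳.i))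
    (fun g h w => lift ((g ≫ fst G 𝒳.mor) * (h ≫ fst G 𝒳.mor))
      (𝒳.comp ((h ≫ fst G 𝒳.mor)⁻¹ • (g ≫ snd G 𝒳.mor)) (h ≫ snd G 𝒳.mor) (by
        rw [H.s_smul, semidirect_aux G 𝒳 H w])))
    (by intro T T' f g h w
        ext
        · simp [MonObj.comp_mul]
        · simp only [lift_snd, Category.assoc, GroupoidObj.comp_nat, comp_lift]
          exact 𝒳.comp_congr _ (by simp [ModObj.comp_smul, GrpObj.comp_inv]) (by simp))
    (by simp [𝒳.e_s])
    (by simp [← Category.assoc, ModObj.comp_smul, 𝒳.e_t])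
    (by rw [lift_snd_assoc, Category.assoc, 𝒳.i_s])
    (by simp only [← Category.assoc, ModObj.comp_smul, lift_fst, lift_snd]
        rw [← H.i_smul, ← mul_smul, inv_mul_cancel, one_smul, Category.assoc, 𝒳.i_t])
    (by intro T g h w
        rw [lift_snd_assoc, 𝒳.comp_s, Category.assoc])
    (by intro T g h w
        simp only [← Category.assoc, ModObj.comp_smul, lift_fst, lift_snd]
        rw [H.t_smul, 𝒳.comp_t, H.t_smul, H.t_smul, ← mul_smul, mul_assoc, mul_inv_cancel,
          mul_one])
    (by intro T g
        ext
        · simp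
        · rw [lift_snd]
          refine (𝒳.comp_congr _ ?_ rfl).trans (𝒳.id_comp (g ≫ snd G 𝒳.mor))
          simp only [Category.assoc, lift_snd]
          simp only [← Category.assoc, ModObj.comp_smul, H.t_smul, H.e_smul]
          rw [← mul_smul, inv_mul_cancel, one_smul])
    (by intro T g
        ext
        · simp
        · rw [lift_snd]
          refine (𝒳.comp_congr _ ?_ ?_).trans (𝒳.comp_id (g ≫ snd G 𝒳.mor))
          · simp
          · simp)
    (by intro T g
        ext
        · simp [GrpObj.comp_inv]
        · rw [lift_snd]
          refine (𝒳.comp_congr _ ?_ ?_).trans (𝒳.inv_comp (g ≫ snd G 𝒳.mor)) |>.trans (by simp)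
          · simp only [Category.assoc, lift_snd]
            simp only [← Category.assoc, ModObj.comp_smul, H.i_smul]
            rw [← mul_smul, inv_mul_cancel, one_smul]
          · rfl)
    (by intro T g
        ext
        · simp [GrpObj.comp_inv]
        · rw [lift_snd]
          refine (𝒳.comp_congr _ ?_ ?_).trans
            (𝒳.comp_inv ((g ≫ fst G 𝒳.mor) • (g ≫ snd G 𝒳.mor))) |>.trans ?_
          · simp [GrpObj.comp_inv]
          · simp [← Category.assoc, ModObj.comp_smul]
          · simp [← Category.assoc, ModObj.comp_smul])
    (by intro T f g h hfg hgh
        ext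
        · simp [_root_.mul_assoc]
        · have w₁ : (((g ≫ fst G 𝒳.mor) * (h ≫ fst G 𝒳.mor))⁻¹ • (f ≫ snd G 𝒳.mor)) ≫ 𝒳.s =
              ((h ≫ fst G 𝒳.mor)⁻¹ • (g ≫ snd G 𝒳.mor)) ≫ 𝒳.t := by
            rw [mul_inv_rev, mul_smul, H.s_smul, H.s_smul, H.t_smul, semidirect_aux G 𝒳 H hfg]
          have w₂ : ((h ≫ fst G 𝒳.mor)⁻¹ • (g ≫ snd G 𝒳.mor)) ≫ 𝒳.s =
              (h ≫ snd G 𝒳.mor) ≫ 𝒳.t := by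
            rw [H.s_smul, semidirect_aux G 𝒳 H hgh]
          simp only [lift_snd, lift_fst, H.comp_smul]
          refine Eq.trans (𝒳.comp_congr _ (𝒳.comp_congr _ ?_ rfl) rfl) (𝒳.assoc _ _ _ w₁ w₂)
          rw [mul_inv_rev, mul_smul])

end General

/-! ### Vector bundles and equivariant vector bundles -/

/-- A vector bundle: a sheaf of modules which is locally free of finite rank. -/
def IsVectorBundle {X : Scheme.{u}} (M : X.Modules) : Prop :=
  ∀ x : X, ∃ U : X.Opens, x ∈ U ∧ ∃ n : ℕ,
    Nonempty (M.restrict U.ι ≅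
      (SheafOfModules.free (R := U.toScheme.ringCatSheaf) (ULift.{u} (Fin n)) : U.toScheme.Modules))

theorem IsVectorBundle.pullback {X Y : Scheme.{u}} (f : X ⟶ Y) {M : Y.Modules}
    (hM : IsVectorBundle M) : IsVectorBundle ((Scheme.Modules.pullback f).obj M) := by
  intro x
  obtain ⟨U, hU, n, ⟨e⟩⟩ := hM (f x)
  refine ⟨f ⁻¹ᵁ U, hU, n, ⟨?_⟩⟩
  have w : (f ⁻¹ᵁ U).ι ≫ f = (f ∣_ U) ≫ U.ι := by simp
  let e₁ := (Scheme.Modules.restrictFunctorIsoPullback (f ⁻¹ᵁ U).ι).app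
    ((Scheme.Modules.pullback f).obj M)
  let e₂ := (Scheme.Modules.pullbackComp (f ⁻¹ᵁ U).ι f).app M
  let e₃ := (Scheme.Modules.pullbackCongr w).app M
  let e₄ := (Scheme.Modules.pullbackComp (f ∣_ U) U.ι).app M
  let e₅ := (Scheme.Modules.pullback (f ∣_ U)).mapIso
    ((Scheme.Modules.restrictFunctorIsoPullback U.ι).app M)
  let e₆ := (Scheme.Modules.pullback (f ∣_ U)).mapIso e
  have : (TopologicalSpace.Opens.map (f ∣_ U).base).Final := by
    constructor
    intro V
    have : Nonempty (StructuredArrow V (TopologicalSpace.Opens.map (f ∣_ U).base)) :=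
      ⟨StructuredArrow.mk (Y := ⊤) (homOfLE le_top)⟩
    refine zigzag_isConnected fun A B => ?_
    let T : StructuredArrow V (TopologicalSpace.Opens.map (f ∣_ U).base) :=
      StructuredArrow.mk (Y := ⊤) (homOfLE le_top)
    exact (Zigzag.of_hom (StructuredArrow.homMk (homOfLE le_top) : A ⟶ T)).trans
      (Zigzag.of_inv (StructuredArrow.homMk (homOfLE le_top) : B ⟶ T))
  have : (SheafOfModules.pushforward.{u} (f ∣_ U).toRingCatSheafHom).IsRightAdjoint :=
    inferInstanceAs (Scheme.Modules.pushforward (f ∣_ U)).IsRightAdjoint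
  let e₇ := SheafOfModules.pullbackObjFreeIso (f ∣_ U).toRingCatSheafHom (ULift.{u} (Fin n))
  exact e₁ ≪≫ e₂ ≪≫ e₃ ≪≫ e₄.symm ≪≫ e₅.symm ≪≫ e₆ ≪≫ e₇

section Equivariant

/-- The value at an object of an isomorphism from a functor to a composite functor. -/
def isoCompApp {A B D : Type*} [Category* A] [Category* B] [Category* D] {F : A ⥤ B} {G : B ⥤ D}
    {H : A ⥤ D} (e : F ⋙ G ≅ H) (M : A) : H.obj M ≅ G.obj (F.obj M) :=
  (e.app M).symm

theorem isoCompApp_naturality {A B D : Type*} [Category* A] [Category* B] [Category* D] {F : A ⥤ B}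
    {G : B ⥤ D} {H : A ⥤ D} (e : F ⋙ G ≅ H) {M N : A} (a : M ⟶ N) :
    H.map a ≫ (isoCompApp e N).hom = (isoCompApp e M).hom ≫ G.map (F.map a) :=
  e.inv.naturality a

theorem isoCompApp_assoc {A B D E : Type*} [Category* A] [Category* B] [Category* D] [Category* E]
    {f : A ⥤ B} {g : B ⥤ D} {h : D ⥤ E} {gf : A ⥤ D} {hg : B ⥤ E} {hgf hgf' : A ⥤ E}
    (e₁ : f ⋙ g ≅ gf) (e₂ : g ⋙ h ≅ hg) (e₃ : f ⋙ hg ≅ hgf) (e₄ : gf ⋙ h ≅ hgf')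
    (w : hgf' = hgf)
    (H : e₄.inv ≫ Functor.whiskerRight e₁.inv h ≫ (Functor.associator _ _ _).hom ≫
      Functor.whiskerLeft _ e₂.hom ≫ e₃.hom = eqToHom w) (M : A) :
    (isoCompApp e₃ M).hom ≫ (isoCompApp e₂ (f.obj M)).hom =
      (isoCompApp (e₄ ≪≫ eqToIso w) M).hom ≫ h.map ((isoCompApp e₁ M).hom) := by
  subst w
  have H' := congr_app H M
  simp only [NatTrans.comp_app, Functor.whiskerRight_app, Functor.whiskerLeft_app,
    Functor.associator_hom_app, eqToHom_refl, NatTrans.id_app] at H'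
  simp only [isoCompApp, Iso.symm_hom, Iso.app_inv, eqToIso_refl, Iso.trans_refl]
  rw [← cancel_mono (e₂.hom.app _), ← cancel_mono (e₃.hom.app M)]
  have h₁ : e₂.inv.app (f.obj M) ≫ e₂.hom.app (f.obj M) = 𝟙 _ := Iso.inv_hom_id_app _ _
  have h₂ : e₃.inv.app M ≫ e₃.hom.app M = 𝟙 _ := Iso.inv_hom_id_app _ _
  simp only [Category.assoc]
  rw [reassoc_of% h₁]
  simpa [h₂] using H'.symm

/-- The canonical isomorphism `(g ≫ f)^* M ≅ g^* f^* M`, where `g ≫ f` is allowed to be replaced by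
a morphism equal to it. -/
noncomputable def compIso {Z Y X : Scheme.{u}} {g : Z ⟶ Y} {f : Y ⟶ X} {h : Z ⟶ X}
    (w : g ≫ f = h) (M : X.Modules) :
    (Scheme.Modules.pullback h).obj M ≅
      (Scheme.Modules.pullback g).obj ((Scheme.Modules.pullback f).obj M) :=
  isoCompApp (Scheme.Modules.pullbackComp g f ≪≫ Scheme.Modules.pullbackCongr w) M

theorem compIso_naturality {Z Y X : Scheme.{u}} {g : Z ⟶ Y} {f : Y ⟶ X} {h : Z ⟶ X}
    (w : g ≫ f = h) {M N : X.Modules} (a : M ⟶ N) :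
    (Scheme.Modules.pullback h).map a ≫ (compIso w N).hom =
      (compIso w M).hom ≫ (Scheme.Modules.pullback g).map ((Scheme.Modules.pullback f).map a) :=
  isoCompApp_naturality _ a

theorem compIso_inv_naturality {Z Y X : Scheme.{u}} {g : Z ⟶ Y} {f : Y ⟶ X} {h : Z ⟶ X}
    (w : g ≫ f = h) {M N : X.Modules} (a : M ⟶ N) :
    (Scheme.Modules.pullback g).map ((Scheme.Modules.pullback f).map a) ≫ (compIso w N).inv =
      (compIso w M).inv ≫ (Scheme.Modules.pullback h).map a := by
  rw [Iso.comp_inv_eq, Category.assoc, compIso_naturality, Iso.inv_hom_id_assoc]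

theorem compIso_assoc {Z Y X S : Scheme.{u}} {h : Z ⟶ Y} {g : Y ⟶ X} {f : X ⟶ S} {gf : Y ⟶ S}
    {hg : Z ⟶ X} {hgf : Z ⟶ S} (w₁ : g ≫ f = gf) (w₂ : h ≫ g = hg) (w₃ : hg ≫ f = hgf)
    (w₄ : h ≫ gf = hgf) (M : S.Modules) :
    (compIso w₃ M).hom ≫ (compIso w₂ ((Scheme.Modules.pullback f).obj M)).hom =
      (compIso w₄ M).hom ≫ (Scheme.Modules.pullback h).map (compIso w₁ M).hom := by
  subst w₁ w₂ w₃
  simp only [compIso, Scheme.Modules.pullbackCongr, eqToIso_refl, Iso.trans_refl]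
  exact isoCompApp_assoc _ _ _ _ (by rw [w₄]) (Scheme.Modules.pseudofunctor_associativity h g f) M

theorem compIso_assoc_inv {Z Y X S : Scheme.{u}} {h : Z ⟶ Y} {g : Y ⟶ X} {f : X ⟶ S} {gf : Y ⟶ S}
    {hg : Z ⟶ X} {hgf : Z ⟶ S} (w₁ : g ≫ f = gf) (w₂ : h ≫ g = hg) (w₃ : hg ≫ f = hgf)
    (w₄ : h ≫ gf = hgf) (M : S.Modules) :
    (compIso w₂ ((Scheme.Modules.pullback f).obj M)).inv ≫ (compIso w₃ M).inv =
      (Scheme.Modules.pullback h).map (compIso w₁ M).inv ≫ (compIso w₄ M).inv := by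
  have H : compIso w₃ M ≪≫ compIso w₂ ((Scheme.Modules.pullback f).obj M) =
      compIso w₄ M ≪≫ (Scheme.Modules.pullback h).mapIso (compIso w₁ M) :=
    Iso.ext (compIso_assoc w₁ w₂ w₃ w₄ M)
  exact congr_arg Iso.inv H

theorem baseChange_unComp_aux {A B : Type*} [Category* A] [Category* B] (G : A ⥤ B) {p q p' q' : A}
    {a b a' b' : B} (ψ : p ⟶ q) (ia : p ≅ p') (ib : q ≅ q') (ca : a ≅ G.obj p) (cb : b ≅ G.obj q)
    (hs : a' ≅ G.obj p') (ht : b' ≅ G.obj q') (wa : a ≅ a') (wb : b ≅ b')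
    (e₁ : wa.hom ≫ hs.hom = ca.hom ≫ G.map ia.hom) (e₂ : wb.hom ≫ ht.hom = cb.hom ≫ G.map ib.hom) :
    hs.hom ≫ G.map (ia.inv ≫ ψ ≫ ib.hom) ≫ ht.inv =
      wa.inv ≫ (ca.hom ≫ G.map ψ ≫ cb.inv) ≫ wb.hom := by
  rw [← cancel_epi wa.hom, ← cancel_mono ht.hom]
  simp only [Category.assoc, Iso.hom_inv_id_assoc, Iso.inv_hom_id, Category.comp_id, e₂,
    reassoc_of% e₁, Iso.inv_hom_id_assoc, Functor.map_comp]
  simp [← Functor.map_comp]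

/-- A base-change `g^* φ : (g ≫ s)^* V ⟶ (g ≫ t)^* W` of `φ : s^* V ⟶ t^* W`, where the composites
are allowed to be replaced by morphisms equal to them (and `g^* s^* V` is identified with
`(g ≫ s)^* V` by the canonical isomorphism). -/
noncomputable def baseChange {X Y Z T : Scheme.{u}} {V : X.Modules} {W : Y.Modules}
    {s : Z ⟶ X} {t : Z ⟶ Y}
    (φ : (Scheme.Modules.pullback s).obj V ⟶ (Scheme.Modules.pullback t).obj W)
    (g : T ⟶ Z) (gs : T ⟶ X) (gt : T ⟶ Y) (hs : g ≫ s = gs) (ht : g ≫ t = gt) :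
    (Scheme.Modules.pullback gs).obj V ⟶ (Scheme.Modules.pullback gt).obj W :=
  (compIso hs V).hom ≫ (Scheme.Modules.pullback g).map φ ≫ (compIso ht W).inv

variable {S : Scheme.{u}}

/-- The cocycle condition `m^* φ = p₁^* φ ∘ p₂^* φ` for a morphism `φ : s^* V ⟶ t^* V`. -/
def IsCocycle (𝒢 : GroupoidObj (Over S)) {V : 𝒢.obj.left.Modules}
    (φ : (Scheme.Modules.pullback 𝒢.s.left).obj V ⟶ (Scheme.Modules.pullback 𝒢.t.left).obj V) :
    Prop :=
  baseChange φ 𝒢.m.left ((pullback.snd 𝒢.s 𝒢.t).left ≫ 𝒢.s.left)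
      ((pullback.fst 𝒢.s 𝒢.t).left ≫ 𝒢.t.left)
      (by rw [← Over.comp_left, 𝒢.m_s, Over.comp_left])
      (by rw [← Over.comp_left, 𝒢.m_t, Over.comp_left]) =
    baseChange φ (pullback.snd 𝒢.s 𝒢.t).left ((pullback.snd 𝒢.s 𝒢.t).left ≫ 𝒢.s.left)
        ((pullback.fst 𝒢.s 𝒢.t).left ≫ 𝒢.s.left) rfl
        (by rw [← Over.comp_left, ← pullback.condition, Over.comp_left]) ≫
      baseChange φ (pullback.fst 𝒢.s 𝒢.t).left ((pullback.fst 𝒢.s 𝒢.t).left ≫ 𝒢.s.left)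
        ((pullback.fst 𝒢.s 𝒢.t).left ≫ 𝒢.t.left) rfl rfl

/-- An equivariant vector bundle (or representation) on a groupoid scheme `𝒢`: a vector bundle
`V` on `𝒢₀` with an isomorphism `φ : s^* V ⟶ t^* V` satisfying the cocycle condition. -/
structure EquivariantVB (𝒢 : GroupoidObj (Over S)) where
  V : 𝒢.obj.left.Modules
  isVectorBundle : IsVectorBundle V
  φ : (Scheme.Modules.pullback 𝒢.s.left).obj V ⟶ (Scheme.Modules.pullback 𝒢.t.left).obj V
  isIso : IsIso φ
  cocycle : IsCocycle 𝒢 φ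

namespace EquivariantVB

variable {𝒢 : GroupoidObj (Over S)}

/-- A morphism of equivariant vector bundles: a morphism `f` of the underlying vector bundles with
`t^* f ∘ φ = φ' ∘ s^* f`. -/
@[ext]
structure Hom (A B : EquivariantVB 𝒢) where
  f : A.V ⟶ B.V
  comm : A.φ ≫ (Scheme.Modules.pullback 𝒢.t.left).map f =
    (Scheme.Modules.pullback 𝒢.s.left).map f ≫ B.φ

instance : Category (EquivariantVB 𝒢) where
  Hom A B := Hom A B
  id A := ⟨𝟙 A.V, by simp⟩
  comp {A B D} a b := ⟨a.f ≫ b.f, by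
    rw [Functor.map_comp, Functor.map_comp, ← Category.assoc, a.comm, Category.assoc, b.comm,
      Category.assoc]⟩

@[ext]
theorem hom_ext {A B : EquivariantVB 𝒢} (a b : A ⟶ B) (h : a.f = b.f) : a = b := Hom.ext h

@[simp] theorem id_f (A : EquivariantVB 𝒢) : Hom.f (𝟙 A) = 𝟙 A.V := rfl

@[simp] theorem comp_f {A B D : EquivariantVB 𝒢} (a : A ⟶ B) (b : B ⟶ D) :
    Hom.f (a ≫ b) = Hom.f a ≫ Hom.f b := rfl

end EquivariantVB

variable {𝒳 𝒴 : GroupoidObj (Over S)} (f : GroupoidHom 𝒳 𝒴)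

theorem GroupoidHom.w_s_left : f.f₁.left ≫ 𝒴.s.left = 𝒳.s.left ≫ f.f₀.left := by
  rw [← Over.comp_left, f.w_s, Over.comp_left]

theorem GroupoidHom.w_t_left : f.f₁.left ≫ 𝒴.t.left = 𝒳.t.left ≫ f.f₀.left := by
  rw [← Over.comp_left, f.w_t, Over.comp_left]

theorem isIso_baseChange {X Y Z T : Scheme.{u}} {V : X.Modules} {W : Y.Modules}
    {s : Z ⟶ X} {t : Z ⟶ Y}
    (φ : (Scheme.Modules.pullback s).obj V ⟶ (Scheme.Modules.pullback t).obj W) [IsIso φ]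
    (g : T ⟶ Z) (gs : T ⟶ X) (gt : T ⟶ Y) (hs : g ≫ s = gs) (ht : g ≫ t = gt) :
    IsIso (baseChange φ g gs gt hs ht) := by
  unfold baseChange
  infer_instance

theorem baseChange_baseChange {X Y Z T T' : Scheme.{u}} {V : X.Modules} {W : Y.Modules}
    {s : Z ⟶ X} {t : Z ⟶ Y}
    (φ : (Scheme.Modules.pullback s).obj V ⟶ (Scheme.Modules.pullback t).obj W)
    (g : T ⟶ Z) (gs : T ⟶ X) (gt : T ⟶ Y) (hs : g ≫ s = gs) (ht : g ≫ t = gt)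
    (h : T' ⟶ T) (hgs : T' ⟶ X) (hgt : T' ⟶ Y) (hs' : h ≫ gs = hgs) (ht' : h ≫ gt = hgt)
    (hg : T' ⟶ Z) (w : h ≫ g = hg) :
    baseChange (baseChange φ g gs gt hs ht) h hgs hgt hs' ht' =
      baseChange φ hg hgs hgt (by simp [← w, hs, hs']) (by simp [← w, ht, ht']) := by
  have e₁ := compIso_assoc hs w (by simp [← w, hs, hs']) hs' V
  have e₂ := compIso_assoc_inv ht w (by simp [← w, ht, ht']) ht' W
  unfold baseChange
  rw [Functor.map_comp, Functor.map_comp, Category.assoc, Category.assoc, ← e₂, ← reassoc_of% e₁]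
  have e₃ := compIso_naturality w φ
  have e₄ : (compIso w ((Scheme.Modules.pullback t).obj W)).hom ≫ (compIso w _).inv = 𝟙 _ :=
    Iso.hom_inv_id _
  rw [← reassoc_of% e₃, reassoc_of% e₄]

theorem baseChange_comp {X Y X' Z T : Scheme.{u}} {V : X.Modules} {W : Y.Modules} {U : X'.Modules}
    {s : Z ⟶ X} {t : Z ⟶ Y} {r : Z ⟶ X'}
    (φ : (Scheme.Modules.pullback s).obj V ⟶ (Scheme.Modules.pullback t).obj W)
    (ψ : (Scheme.Modules.pullback t).obj W ⟶ (Scheme.Modules.pullback r).obj U)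
    (g : T ⟶ Z) (gs : T ⟶ X) (gt : T ⟶ Y) (gr : T ⟶ X') (hs : g ≫ s = gs) (ht : g ≫ t = gt)
    (hr : g ≫ r = gr) :
    baseChange (φ ≫ ψ) g gs gr hs hr = baseChange φ g gs gt hs ht ≫ baseChange ψ g gt gr ht hr := by
  have e : (compIso ht W).inv ≫ (compIso ht W).hom = 𝟙 _ := Iso.inv_hom_id _
  unfold baseChange
  rw [Functor.map_comp, Category.assoc, Category.assoc, Category.assoc, reassoc_of% e]

theorem baseChange_naturality {X Y Z T : Scheme.{u}} {V V' : X.Modules} {W W' : Y.Modules}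
    {s : Z ⟶ X} {t : Z ⟶ Y}
    (φ : (Scheme.Modules.pullback s).obj V ⟶ (Scheme.Modules.pullback t).obj W)
    (φ' : (Scheme.Modules.pullback s).obj V' ⟶ (Scheme.Modules.pullback t).obj W')
    (a : V ⟶ V') (b : W ⟶ W')
    (H : φ ≫ (Scheme.Modules.pullback t).map b = (Scheme.Modules.pullback s).map a ≫ φ')
    (g : T ⟶ Z) (gs : T ⟶ X) (gt : T ⟶ Y) (hs : g ≫ s = gs) (ht : g ≫ t = gt) :
    baseChange φ g gs gt hs ht ≫ (Scheme.Modules.pullback gt).map b =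
      (Scheme.Modules.pullback gs).map a ≫ baseChange φ' g gs gt hs ht := by
  have e₁ := compIso_naturality hs a
  have e₂ := compIso_inv_naturality ht b
  have e₃ := congr_arg (Scheme.Modules.pullback g).map H
  simp only [Functor.map_comp] at e₃
  unfold baseChange
  rw [Category.assoc, Category.assoc, ← e₂, reassoc_of% e₃, reassoc_of% e₁]

/-- Given `ψ : (s ≫ f)^* V ⟶ (t ≫ f')^* W`, the morphism `s^* f^* V ⟶ t^* f'^* W` corresponding to it
under the canonical isomorphisms. -/
noncomputable def unComp {Z X X' Y Y' : Scheme.{u}} {V : X.Modules} {W : X'.Modules} {s : Z ⟶ Y}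
    {f : Y ⟶ X} {t : Z ⟶ Y'} {f' : Y' ⟶ X'} {a : Z ⟶ X} {b : Z ⟶ X'} (ha : s ≫ f = a)
    (hb : t ≫ f' = b)
    (ψ : (Scheme.Modules.pullback a).obj V ⟶ (Scheme.Modules.pullback b).obj W) :
    (Scheme.Modules.pullback s).obj ((Scheme.Modules.pullback f).obj V) ⟶
      (Scheme.Modules.pullback t).obj ((Scheme.Modules.pullback f').obj W) :=
  (compIso ha V).inv ≫ ψ ≫ (compIso hb W).hom

theorem unComp_comp {Z X X' X'' Y Y' Y'' : Scheme.{u}} {V : X.Modules} {W : X'.Modules}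
    {U : X''.Modules} {s : Z ⟶ Y} {f : Y ⟶ X} {t : Z ⟶ Y'} {f' : Y' ⟶ X'} {r : Z ⟶ Y''}
    {f'' : Y'' ⟶ X''} {a : Z ⟶ X} {b : Z ⟶ X'} {c : Z ⟶ X''} (ha : s ≫ f = a) (hb : t ≫ f' = b)
    (hc : r ≫ f'' = c)
    (ψ : (Scheme.Modules.pullback a).obj V ⟶ (Scheme.Modules.pullback b).obj W)
    (χ : (Scheme.Modules.pullback b).obj W ⟶ (Scheme.Modules.pullback c).obj U) :
    unComp ha hc (ψ ≫ χ) = unComp ha hb ψ ≫ unComp hb hc χ := by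
  have e : (compIso hb W).hom ≫ (compIso hb W).inv = 𝟙 _ := Iso.hom_inv_id _
  unfold unComp
  rw [Category.assoc, Category.assoc, Category.assoc, reassoc_of% e]

theorem baseChange_unComp {Z T X X' Y Y' : Scheme.{u}} {V : X.Modules} {W : X'.Modules} {s : Z ⟶ Y}
    {f : Y ⟶ X} {t : Z ⟶ Y'} {f' : Y' ⟶ X'} {a : Z ⟶ X} {b : Z ⟶ X'} (ha : s ≫ f = a)
    (hb : t ≫ f' = b)
    (ψ : (Scheme.Modules.pullback a).obj V ⟶ (Scheme.Modules.pullback b).obj W)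
    (g : T ⟶ Z) (gs : T ⟶ Y) (gt : T ⟶ Y') (hs : g ≫ s = gs) (ht : g ≫ t = gt)
    (ga : T ⟶ X) (gb : T ⟶ X') (ha' : g ≫ a = ga) (hb' : g ≫ b = gb) :
    baseChange (unComp ha hb ψ) g gs gt hs ht =
      unComp (by rw [← hs, Category.assoc, ha, ha']) (by rw [← ht, Category.assoc, hb, hb'])
        (baseChange ψ g ga gb ha' hb') := by
  have w₁ : gs ≫ f = ga := by rw [← hs, Category.assoc, ha, ha']
  have w₂ : gt ≫ f' = gb := by rw [← ht, Category.assoc, hb, hb']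
  exact baseChange_unComp_aux _ ψ (compIso ha V) (compIso hb W) (compIso ha' V) (compIso hb' W)
    (compIso hs _) (compIso ht _) (compIso w₁ V) (compIso w₂ W) (compIso_assoc ha hs w₁ ha' V)
    (compIso_assoc hb ht w₂ hb' W)

theorem isIso_unComp {Z X X' Y Y' : Scheme.{u}} {V : X.Modules} {W : X'.Modules} {s : Z ⟶ Y}
    {f : Y ⟶ X} {t : Z ⟶ Y'} {f' : Y' ⟶ X'} {a : Z ⟶ X} {b : Z ⟶ X'} (ha : s ≫ f = a)
    (hb : t ≫ f' = b)
    (ψ : (Scheme.Modules.pullback a).obj V ⟶ (Scheme.Modules.pullback b).obj W) [IsIso ψ] :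
    IsIso (unComp ha hb ψ) := by
  unfold unComp
  infer_instance

theorem unComp_naturality {Z X X' Y Y' : Scheme.{u}} {V V' : X.Modules} {W W' : X'.Modules}
    {s : Z ⟶ Y} {f : Y ⟶ X} {t : Z ⟶ Y'} {f' : Y' ⟶ X'} {a : Z ⟶ X} {b : Z ⟶ X'} (ha : s ≫ f = a)
    (hb : t ≫ f' = b)
    (ψ : (Scheme.Modules.pullback a).obj V ⟶ (Scheme.Modules.pullback b).obj W)
    (ψ' : (Scheme.Modules.pullback a).obj V' ⟶ (Scheme.Modules.pullback b).obj W')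
    (p : V ⟶ V') (q : W ⟶ W')
    (H : ψ ≫ (Scheme.Modules.pullback b).map q = (Scheme.Modules.pullback a).map p ≫ ψ') :
    unComp ha hb ψ ≫ (Scheme.Modules.pullback t).map ((Scheme.Modules.pullback f').map q) =
      (Scheme.Modules.pullback s).map ((Scheme.Modules.pullback f).map p) ≫ unComp ha hb ψ' := by
  have e₁ := compIso_inv_naturality ha p
  have e₂ := compIso_naturality hb q
  unfold unComp
  rw [Category.assoc, Category.assoc, ← e₂, reassoc_of% e₁, reassoc_of% H]

theorem baseChange_congr {X Y Z T : Scheme.{u}} {V : X.Modules} {W : Y.Modules}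
    {s : Z ⟶ X} {t : Z ⟶ Y}
    (φ : (Scheme.Modules.pullback s).obj V ⟶ (Scheme.Modules.pullback t).obj W)
    {g g' : T ⟶ Z} (h : g = g') (gs : T ⟶ X) (gt : T ⟶ Y) (hs : g ≫ s = gs) (ht : g ≫ t = gt) :
    baseChange φ g gs gt hs ht = baseChange φ g' gs gt (by rw [← h, hs]) (by rw [← h, ht]) := by
  subst h; rfl

theorem cocycle_pullback_aux {X₀ X₁ X₂ Y₀ Y₁ Y₂ : Scheme.{u}} {s t : X₁ ⟶ X₀} {s' t' : Y₁ ⟶ Y₀}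
    {n : X₂ ⟶ X₁} {n' : Y₂ ⟶ Y₁} {f₀ : X₀ ⟶ Y₀} {f₁ : X₁ ⟶ Y₁} {f₂ : X₂ ⟶ Y₂}
    {sf tf : X₁ ⟶ Y₀} (hsf : s ≫ f₀ = sf) (htf : t ≫ f₀ = tf)
    {x y : X₂ ⟶ X₀} {x' y' : Y₂ ⟶ Y₀} (nx : n ≫ s = x) (ny : n ≫ t = y) (nx' : n' ≫ s' = x')
    (ny' : n' ≫ t' = y') (ws : f₁ ≫ s' = sf) (wt : f₁ ≫ t' = tf) (wn : f₂ ≫ n' = n ≫ f₁)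
    {xf yf : X₂ ⟶ Y₀} (hx : x ≫ f₀ = xf) (hy : y ≫ f₀ = yf) (hx' : f₂ ≫ x' = xf)
    (hy' : f₂ ≫ y' = yf)
    {V : Y₀.Modules} (φ : (Scheme.Modules.pullback s').obj V ⟶ (Scheme.Modules.pullback t').obj V) :
    baseChange (unComp hsf htf (baseChange φ f₁ sf tf ws wt)) n x y nx ny =
      unComp hx hy (baseChange (baseChange φ n' x' y' nx' ny') f₂ xf yf hx' hy') := by
  have e₁ : n ≫ sf = xf := by rw [← hsf, ← Category.assoc, nx, hx]
  have e₂ : n ≫ tf = yf := by rw [← htf, ← Category.assoc, ny, hy]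
  have h₁ := baseChange_unComp hsf htf (baseChange φ f₁ sf tf ws wt) n x y nx ny xf yf e₁ e₂
  have h₂ := baseChange_baseChange φ f₁ sf tf ws wt n xf yf e₁ e₂ _ rfl
  have h₃ := baseChange_baseChange φ n' x' y' nx' ny' f₂ xf yf hx' hy' _ wn
  exact h₁.trans (congr_arg _ (h₂.trans h₃.symm))

theorem cocycle_pullback {X₀ X₁ X₂ Y₀ Y₁ Y₂ : Scheme.{u}} {s t : X₁ ⟶ X₀} {s' t' : Y₁ ⟶ Y₀}
    {p q m : X₂ ⟶ X₁} {p' q' m' : Y₂ ⟶ Y₁} (f₀ : X₀ ⟶ Y₀) (f₁ : X₁ ⟶ Y₁) (f₂ : X₂ ⟶ Y₂)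
    {a b c : X₂ ⟶ X₀} {a' b' c' : Y₂ ⟶ Y₀}
    (ma : m ≫ s = a) (mc : m ≫ t = c) (qa : q ≫ s = a) (qb : q ≫ t = b) (pb : p ≫ s = b)
    (pc : p ≫ t = c)
    (ma' : m' ≫ s' = a') (mc' : m' ≫ t' = c') (qa' : q' ≫ s' = a') (qb' : q' ≫ t' = b')
    (pb' : p' ≫ s' = b') (pc' : p' ≫ t' = c')
    (ws : f₁ ≫ s' = s ≫ f₀) (wt : f₁ ≫ t' = t ≫ f₀) (wm : m ≫ f₁ = f₂ ≫ m')
    (wp : p ≫ f₁ = f₂ ≫ p') (wq : q ≫ f₁ = f₂ ≫ q')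
    {V : Y₀.Modules} (φ : (Scheme.Modules.pullback s').obj V ⟶ (Scheme.Modules.pullback t').obj V)
    (H : baseChange φ m' a' c' ma' mc' =
      baseChange φ q' a' b' qa' qb' ≫ baseChange φ p' b' c' pb' pc') :
    baseChange (unComp rfl rfl (baseChange φ f₁ (s ≫ f₀) (t ≫ f₀) ws wt)) m a c ma mc =
      baseChange (unComp rfl rfl (baseChange φ f₁ (s ≫ f₀) (t ≫ f₀) ws wt)) q a b qa qb ≫
      baseChange (unComp rfl rfl (baseChange φ f₁ (s ≫ f₀) (t ≫ f₀) ws wt)) p b c pb pc := by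
  have ha : f₂ ≫ a' = a ≫ f₀ := by
    rw [← qa', ← Category.assoc, ← wq, Category.assoc, ws, ← Category.assoc, qa]
  have hb : f₂ ≫ b' = b ≫ f₀ := by
    rw [← pb', ← Category.assoc, ← wp, Category.assoc, ws, ← Category.assoc, pb]
  have hc : f₂ ≫ c' = c ≫ f₀ := by
    rw [← pc', ← Category.assoc, ← wp, Category.assoc, wt, ← Category.assoc, pc]
  have hm := cocycle_pullback_aux (f₀ := f₀) rfl rfl ma mc ma' mc' ws wt wm.symm rfl rfl ha hc φ
  have hp := cocycle_pullback_aux (f₀ := f₀) rfl rfl pb pc pb' pc' ws wt wp.symm rfl rfl hb hc φ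
  have hq := cocycle_pullback_aux (f₀ := f₀) rfl rfl qa qb qa' qb' ws wt wq.symm rfl rfl ha hb φ
  have h₁ := congr_arg (fun ψ => baseChange ψ f₂ (a ≫ f₀) (c ≫ f₀) ha hc) H
  have h₂ := baseChange_comp (baseChange φ q' a' b' qa' qb') (baseChange φ p' b' c' pb' pc')
    f₂ (a ≫ f₀) (b ≫ f₀) (c ≫ f₀) ha hb hc
  have h₃ := unComp_comp (f := f₀) (f' := f₀) (f'' := f₀) rfl rfl rfl
    (baseChange (baseChange φ q' a' b' qa' qb') f₂ (a ≫ f₀) (b ≫ f₀) ha hb)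
    (baseChange (baseChange φ p' b' c' pb' pc') f₂ (b ≫ f₀) (c ≫ f₀) hb hc)
  exact hm.trans ((congr_arg _ (h₁.trans h₂)).trans (h₃.trans (congr_arg₂ _ hq.symm hp.symm)))

/-- The isomorphism `f₁^* φ`, viewed as a morphism `s^* f₀^* V ⟶ t^* f₀^* V`. -/
noncomputable def pullbackφ {V : 𝒴.obj.left.Modules}
    (φ : (Scheme.Modules.pullback 𝒴.s.left).obj V ⟶ (Scheme.Modules.pullback 𝒴.t.left).obj V) :
    (Scheme.Modules.pullback 𝒳.s.left).obj ((Scheme.Modules.pullback f.f₀.left).obj V) ⟶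
      (Scheme.Modules.pullback 𝒳.t.left).obj ((Scheme.Modules.pullback f.f₀.left).obj V) :=
  unComp rfl rfl (baseChange φ f.f₁.left (𝒳.s.left ≫ f.f₀.left) (𝒳.t.left ≫ f.f₀.left)
    f.w_s_left f.w_t_left)

theorem isIso_pullbackφ {V : 𝒴.obj.left.Modules}
    (φ : (Scheme.Modules.pullback 𝒴.s.left).obj V ⟶ (Scheme.Modules.pullback 𝒴.t.left).obj V)
    (hφ : IsIso φ) : IsIso (pullbackφ f φ) := by
  have := isIso_baseChange φ f.f₁.left (𝒳.s.left ≫ f.f₀.left) (𝒳.t.left ≫ f.f₀.left)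
    f.w_s_left f.w_t_left
  exact isIso_unComp rfl rfl _

theorem isCocycle_pullbackφ {V : 𝒴.obj.left.Modules}
    (φ : (Scheme.Modules.pullback 𝒴.s.left).obj V ⟶ (Scheme.Modules.pullback 𝒴.t.left).obj V)
    (hφ : IsCocycle 𝒴 φ) : IsCocycle 𝒳 (pullbackφ f φ) :=
  cocycle_pullback f.f₀.left f.f₁.left
    (pullback.map 𝒳.s 𝒳.t 𝒴.s 𝒴.t f.f₁ f.f₁ f.f₀ f.w_s.symm f.w_t.symm).left _ _ _ _ _ _
    _ _ _ _ _ _ _ _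
    (by rw [← Over.comp_left, f.w_m, Over.comp_left])
    (by rw [← Over.comp_left, ← Over.comp_left, pullback.lift_fst])
    (by rw [← Over.comp_left, ← Over.comp_left, pullback.lift_snd]) φ hφ

/-- The pullback `(f₀^* V, f₁^* φ)` of an equivariant vector bundle `(V, φ)`. -/
noncomputable def pullbackObj (A : EquivariantVB 𝒴) : EquivariantVB 𝒳 where
  V := (Scheme.Modules.pullback f.f₀.left).obj A.V
  isVectorBundle := A.isVectorBundle.pullback f.f₀.left
  φ := pullbackφ f A.φ
  isIso := isIso_pullbackφ f A.φ A.isIso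
  cocycle := isCocycle_pullbackφ f A.φ A.cocycle

/-- The pullback functor `f^*` on equivariant vector bundles. -/
noncomputable def pullbackVB : EquivariantVB 𝒴 ⥤ EquivariantVB 𝒳 where
  obj A := pullbackObj f A
  map a := ⟨(Scheme.Modules.pullback f.f₀.left).map a.f,
    unComp_naturality _ _ _ _ _ _ (baseChange_naturality _ _ _ _ a.comm _ _ _ _ _)⟩
  map_id A := EquivariantVB.hom_ext _ _ (CategoryTheory.Functor.map_id _ _)
  map_comp a b := EquivariantVB.hom_ext _ _ (CategoryTheory.Functor.map_comp _ _ _)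

end Equivariant

section Equivalence

variable {S : Scheme.{u}} {𝒳 𝒴 : GroupoidObj (Over S)}

/-- `f` is locally essentially surjective in the fpqc topology if there is an fpqc covering of `𝒴₀`
over which the morphism `𝒳₀ ×_{f₀, 𝒴₀, s} 𝒴₁ ⟶ 𝒴₀`, `(x, φ : f₀ x → y) ↦ y`, has sections. -/
def GroupoidHom.LocallyEssSurj (f : GroupoidHom 𝒳 𝒴) : Prop :=
  ∃ R : Presieve 𝒴.obj.left, R ∈ Scheme.fpqcPrecoverage 𝒴.obj.left ∧
    ∀ (U : Scheme.{u}) (g : U ⟶ 𝒴.obj.left), R g →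
      ∃ σ : U ⟶ (pullback f.f₀ 𝒴.s).left, σ ≫ f.essMap.left = g

/-- An (fpqc-)equivalence of groupoid schemes: a fully faithful morphism which is locally essentially
surjective in the fpqc topology. -/
def GroupoidHom.IsFpqcEquivalence (f : GroupoidHom 𝒳 𝒴) : Prop :=
  f.FullyFaithful ∧ f.LocallyEssSurj

end Equivalence

section Points

variable {C : Type u} [Category.{v} C] [CartesianMonoidalCategory C]

/-- A group object from structure morphisms satisfying the axioms on generalized elements. -/
@[reducible] def grpObjOfPoints (G : C) (one : 𝟙_ C ⟶ G) (mul : G ⊗ G ⟶ G) (inv : G ⟶ G)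
    (one_mul : ∀ {T : C} (a : T ⟶ G), lift (toUnit T ≫ one) a ≫ mul = a)
    (mul_one : ∀ {T : C} (a : T ⟶ G), lift a (toUnit T ≫ one) ≫ mul = a)
    (mul_assoc : ∀ {T : C} (a b c : T ⟶ G),
      lift (lift a b ≫ mul) c ≫ mul = lift a (lift b c ≫ mul) ≫ mul)
    (inv_mul : ∀ {T : C} (a : T ⟶ G), lift (a ≫ inv) a ≫ mul = toUnit T ≫ one)
    (mul_inv : ∀ {T : C} (a : T ⟶ G), lift a (a ≫ inv) ≫ mul = toUnit T ≫ one) : GrpObj G where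
  one := one
  mul := mul
  inv := inv
  one_mul := by
    have e : one ▷ G = lift (toUnit _ ≫ one) (snd _ _) := by ext <;> simp [toUnit_unique (fst _ _) (toUnit _)]
    rw [e, one_mul, leftUnitor_hom]
  mul_one := by
    have e : G ◁ one = lift (fst _ _) (toUnit _ ≫ one) := by ext <;> simp [toUnit_unique (snd _ _) (toUnit _)]
    rw [e, mul_one, rightUnitor_hom]
  mul_assoc := by
    have e : mul ▷ G = lift (lift (fst _ _ ≫ fst _ _) (fst _ _ ≫ snd _ _) ≫ mul) (snd _ _) := by
      ext
      · simp only [whiskerRight_fst, lift_fst]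
        congr 1
        ext <;> simp
      · simp
    rw [e, mul_assoc, ← Category.assoc]
    congr 1
    ext
    · simp
    · simp only [lift_snd, Category.assoc, whiskerLeft_snd]
      rw [← Category.assoc]
      congr 1
      ext <;> simp
  left_inv := by simpa using inv_mul (𝟙 G)
  right_inv := by simpa using mul_inv (𝟙 G)

/-- An action of a group object from an action morphism satisfying the axioms on generalized
elements. -/
@[reducible] def modObjOfPoints (G : C) [GrpObj G] (X : C) (smul : G ⊗ X ⟶ X)
    (one_smul : ∀ {T : C} (x : T ⟶ X), lift (1 : T ⟶ G) x ≫ smul = x)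
    (mul_smul : ∀ {T : C} (a b : T ⟶ G) (x : T ⟶ X),
      lift (a * b) x ≫ smul = lift a (lift b x ≫ smul) ≫ smul) : ModObj G X where
  smul := smul
  one_smul := by
    change η[G] ▷ X ≫ smul = (λ_ X).hom
    have e : η[G] ▷ X = lift 1 (snd _ _) := by
      ext
      · simp [toUnit_unique (fst _ _) (toUnit _), Hom.one_def]
      · simp
    rw [e, one_smul, leftUnitor_hom]
  mul_smul := by
    change μ[G] ▷ X ≫ smul = (α_ G G X).hom ≫ G ◁ smul ≫ smul
    have e : μ[G] ▷ X = lift ((fst _ _ ≫ fst _ _) * (fst _ _ ≫ snd _ _)) (snd _ _) := by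
      ext
      · simp only [whiskerRight_fst, lift_fst, Hom.mul_def]
        congr 1
        ext <;> simp
      · simp
    rw [e, mul_smul, ← Category.assoc]
    congr 1
    ext
    · simp
    · simp only [lift_snd, Category.assoc, whiskerLeft_snd]
      rw [← Category.assoc]
      congr 1
      ext <;> simp

theorem smul_eq_lift (G : C) [GrpObj G] (X : C) (smul : G ⊗ X ⟶ X) (h₁) (h₂) {T : C} (a : T ⟶ G)
    (x : T ⟶ X) : letI := modObjOfPoints G X smul h₁ h₂; a • x = lift a x ≫ smul := rfl

end Points

section Glue

variable {S : Scheme.{u}}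

/-- An open subscheme of a scheme over `S`. -/
noncomputable abbrev openOver (T : Over S) (V : T.left.Opens) : Over S := Over.mk (V.ι ≫ T.hom)

/-- The inclusion of an open subscheme of a scheme over `S`. -/
noncomputable abbrev openι (T : Over S) (V : T.left.Opens) : openOver T V ⟶ T := Over.homMk V.ι

theorem openι_hom_ext {T W : Over S} (V : W.left.Opens) {z z' : T ⟶ openOver W V}
    (h : z ≫ openι W V = z' ≫ openι W V) : z = z' := by
  ext1
  have h' : z.left ≫ V.ι = z'.left ≫ V.ι := congr_arg CommaMorphism.left h
  exact (cancel_mono _).mp h'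

theorem openι_lift {T W : Over S} (V : W.left.Opens) (z : T ⟶ W) (h : z.left ⁻¹ᵁ V = ⊤) :
    ∃ y : T ⟶ openOver W V, y ≫ openι W V = z := by
  have hr : Set.range z.left ⊆ Set.range V.ι := by
    rintro _ ⟨x, rfl⟩
    have hx : x ∈ z.left ⁻¹ᵁ V := by rw [h]; trivial
    have : z.left x ∈ V.ι.opensRange := by
      rw [Scheme.Opens.opensRange_ι]
      exact hx
    exact this
  have hw : IsOpenImmersion.lift V.ι z.left hr ≫ V.ι = z.left :=
    IsOpenImmersion.lift_fac V.ι z.left hr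
  refine ⟨Over.homMk (IsOpenImmersion.lift V.ι z.left hr) ?_, ?_⟩
  · have h₂ := Over.w z
    rw [← hw, Category.assoc] at h₂
    exact h₂
  · ext1
    exact hw

theorem over_hom_ext_of_open {T W : Over S} (m m' : T ⟶ W)
    (H : ∀ x : T.left, ∃ V : T.left.Opens, x ∈ V ∧ openι T V ≫ m = openι T V ≫ m') : m = m' := by
  choose V hV h using H
  ext1
  refine Scheme.Cover.hom_ext (T.left.openCoverOfIsOpenCover V ?_) _ _ fun x => ?_
  · rw [TopologicalSpace.IsOpenCover, eq_top_iff]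
    exact fun x _ => TopologicalSpace.Opens.mem_iSup.mpr ⟨x, hV x⟩
  · exact congr_arg CommaMorphism.left (h x)

theorem existsUnique_glue {T W : Over S} (R : ∀ {T' : Over S}, (T' ⟶ T) → (T' ⟶ W) → Prop)
    (nat : ∀ {T' T'' : Over S} (g : T'' ⟶ T') (f : T' ⟶ T) (z : T' ⟶ W),
      R f z → R (g ≫ f) (g ≫ z))
    (func : ∀ {T' : Over S} (f : T' ⟶ T) (z z' : T' ⟶ W), R f z → R f z' → z = z')
    (loc : ∀ x : T.left, ∃ V : T.left.Opens, x ∈ V ∧ ∃ z, R (openι T V) z) :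
    ∃! m : T ⟶ W, ∀ {T' : Over S} (f : T' ⟶ T) (z : T' ⟶ W), R f z → f ≫ m = z := by
  choose V hV z hz using loc
  have hcov : TopologicalSpace.IsOpenCover V := by
    rw [TopologicalSpace.IsOpenCover, eq_top_iff]
    exact fun x _ => TopologicalSpace.Opens.mem_iSup.mpr ⟨x, hV x⟩
  have compat : ∀ x y, pullback.fst (V x).ι (V y).ι ≫ (z x).left =
      pullback.snd (V x).ι (V y).ι ≫ (z y).left := by
    intro x y
    let P : Over S := Over.mk (pullback.fst (V x).ι (V y).ι ≫ (V x).ι ≫ T.hom)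
    let p : P ⟶ openOver T (V x) := Over.homMk (pullback.fst (V x).ι (V y).ι)
    let q : P ⟶ openOver T (V y) := Over.homMk (pullback.snd (V x).ι (V y).ι)
      (by simp [P, ← pullback.condition_assoc])
    have e : p ≫ openι T (V x) = q ≫ openι T (V y) := by
      ext1
      exact pullback.condition
    have h := func (p ≫ openι T (V x)) (p ≫ z x) (q ≫ z y) (nat _ _ _ (hz x))
      (e ▸ nat _ _ _ (hz y))
    exact congr_arg CommaMorphism.left h
  let 𝒰 := T.left.openCoverOfIsOpenCover V hcov
  let m₀ : T.left ⟶ W.left := 𝒰.glueMorphisms (fun x => (z x).left) compat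
  have hm₀ : ∀ x, (V x).ι ≫ m₀ = (z x).left := fun x =>
    𝒰.ι_glueMorphisms (fun x => (z x).left) compat x
  have hw : m₀ ≫ W.hom = T.hom := by
    refine Scheme.Cover.hom_ext 𝒰 _ _ fun x => ?_
    change (V x).ι ≫ m₀ ≫ W.hom = (V x).ι ≫ T.hom
    rw [reassoc_of% (hm₀ x), Over.w (z x)]
    rfl
  let m : T ⟶ W := Over.homMk m₀ hw
  have hm : ∀ x, openι T (V x) ≫ m = z x := fun x => by
    ext1
    exact hm₀ x
  refine ⟨m, ?_, ?_⟩
  · intro T' f z' h'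
    refine over_hom_ext_of_open _ _ fun y => ⟨f.left ⁻¹ᵁ V (f.left y), hV _, ?_⟩
    let U := f.left ⁻¹ᵁ V (f.left y)
    let g : openOver T' U ⟶ openOver T (V (f.left y)) := Over.homMk (f.left ∣_ V (f.left y))
      (by simp [U])
    have e : g ≫ openι T (V (f.left y)) = openι T' U ≫ f := by
      ext1
      simp [g, U]
    have h₁ : R (openι T' U ≫ f) (g ≫ z _) := e ▸ nat g _ _ (hz (f.left y))
    have h₂ := func _ _ _ (nat (openι T' U) _ _ h') h₁
    rw [← Category.assoc, ← e, Category.assoc, hm, h₂]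
  · intro m' h'
    refine over_hom_ext_of_open _ _ fun y => ⟨V y, hV y, ?_⟩
    rw [h' _ _ (hz y), hm]

/-- A way to describe morphisms to `Z` locally: a presheaf `U` (functoriality is not needed) with a
natural map `pt` from `U` to the functor of points of `Z` which is locally surjective. -/
structure Pres (Z : Over S) where
  U : Over S → Type u
  res : ∀ {T T' : Over S}, (T' ⟶ T) → U T → U T'
  pt : ∀ {T : Over S}, U T → (T ⟶ Z)
  nat : ∀ {T T' : Over S} (g : T' ⟶ T) (u : U T), g ≫ pt u = pt (res g u)
  loc : ∀ {T : Over S} (z : T ⟶ Z) (x : T.left), ∃ V : T.left.Opens, x ∈ V ∧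
    ∃ u : U (openOver T V), openι T V ≫ z = pt u

theorem Pres.ext {Z : Over S} (Q : Pres Z) {T W : Over S} (z : T ⟶ Z) (m m' : T ⟶ W)
    (H : ∀ {T' : Over S} (g : T' ⟶ T) (u : Q.U T'), g ≫ z = Q.pt u → g ≫ m = g ≫ m') : m = m' :=
  over_hom_ext_of_open m m' fun x => by
    obtain ⟨V, hV, u, hu⟩ := Q.loc z x
    exact ⟨V, hV, H _ u hu⟩

/-- The product of two presentations. -/
noncomputable def Pres.prod {Z Z' : Over S} (Q : Pres Z) (Q' : Pres Z') : Pres (Z ⊗ Z') where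
  U T := Q.U T × Q'.U T
  res g u := (Q.res g u.1, Q'.res g u.2)
  pt u := lift (Q.pt u.1) (Q'.pt u.2)
  nat g u := by rw [comp_lift, Q.nat, Q'.nat]
  loc {T} z x := by
    obtain ⟨V, hV, u, hu⟩ := Q.loc (z ≫ fst _ _) x
    obtain ⟨V', hV', u', hu'⟩ := Q'.loc (z ≫ snd _ _) x
    let p : openOver T (V ⊓ V') ⟶ openOver T V := Over.homMk (T.left.homOfLE inf_le_left)
    let q : openOver T (V ⊓ V') ⟶ openOver T V' := Over.homMk (T.left.homOfLE inf_le_right)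
    have ep : p ≫ openι T V = openι T (V ⊓ V') := by ext1; simp [p]
    have eq : q ≫ openι T V' = openι T (V ⊓ V') := by ext1; simp [q]
    refine ⟨V ⊓ V', ⟨hV, hV'⟩, (Q.res p u, Q'.res q u'), ?_⟩
    apply CartesianMonoidalCategory.hom_ext
    · rw [lift_fst, ← Q.nat, ← hu, ← ep]; simp
    · rw [lift_snd, ← Q'.nat, ← hu', ← eq]; simp

theorem Pres.exists_desc {Z W : Over S} (Q : Pres Z) (F : ∀ {T : Over S}, Q.U T → (T ⟶ W))
    (nat : ∀ {T T' : Over S} (g : T' ⟶ T) (u : Q.U T), g ≫ F u = F (Q.res g u))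
    (compat : ∀ {T : Over S} (u u' : Q.U T), Q.pt u = Q.pt u' → F u = F u') :
    ∃ m : Z ⟶ W, ∀ {T : Over S} (u : Q.U T), Q.pt u ≫ m = F u := by
  obtain ⟨m, hm, -⟩ := existsUnique_glue (T := Z) (W := W)
    (fun f z => ∃ u, f = Q.pt u ∧ z = F u)
    (by rintro T' T'' g f z ⟨u, rfl, rfl⟩
        exact ⟨Q.res g u, Q.nat g u, nat g u⟩)
    (by rintro T' f z z' ⟨u, rfl, rfl⟩ ⟨u', h, rfl⟩
        exact compat u u' h)
    (by intro x
        obtain ⟨V, hV, u, hu⟩ := Q.loc (𝟙 Z) x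
        exact ⟨V, hV, F u, u, by simpa using hu, rfl⟩)
  exact ⟨m, fun u => hm _ _ ⟨u, rfl, rfl⟩⟩

end Glue

section Functions

variable {k : Type u} [CommRing k]

/-- The ring of global functions on a `k`-scheme. -/
noncomputable abbrev O (T : Over (Spec (CommRingCat.of k))) : Type u := Γ(T.left, ⊤)

/-- The structure map of the `k`-algebra of global functions. -/
noncomputable def str (T : Over (Spec (CommRingCat.of k))) : k →+* O T :=
  ((Scheme.ΓSpecIso (CommRingCat.of k)).inv ≫ T.hom.appTop).hom

/-- Pullback of functions. -/
noncomputable def res {T T' : Over (Spec (CommRingCat.of k))} (g : T' ⟶ T) : O T →+* O T' :=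
  g.left.appTop.hom

theorem res_id (T : Over (Spec (CommRingCat.of k))) (a : O T) : res (𝟙 T) a = a := by
  simp [res]

theorem res_comp {T T' T'' : Over (Spec (CommRingCat.of k))} (g : T' ⟶ T) (h : T'' ⟶ T') (a : O T) :
    res (h ≫ g) a = res h (res g a) := by
  simp only [res, Over.comp_left, Scheme.Hom.comp_appTop]
  rfl

theorem res_comp' {T T' T'' : Over (Spec (CommRingCat.of k))} (g : T' ⟶ T) (h : T'' ⟶ T') :
    res (h ≫ g) = (res h).comp (res g) :=
  RingHom.ext (res_comp g h)

theorem res_str {T T' : Over (Spec (CommRingCat.of k))} (g : T' ⟶ T) (c : k) :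
    res g (str T c) = str T' c := by
  have := Over.w g
  simp only [str, res, ← this, Scheme.Hom.comp_appTop]
  rfl

theorem res_comp_str {T T' : Over (Spec (CommRingCat.of k))} (g : T' ⟶ T) :
    (res g).comp (str T) = str T' :=
  RingHom.ext (res_str g)

theorem isUnit_of_basicOpen {T : Over (Spec (CommRingCat.of k))} (a : O T)
    (h : T.left.basicOpen a = ⊤) : IsUnit a := by
  refine RingedSpace.isUnit_of_isUnit_germ
    T.left.toLocallyRingedSpace.toRingedSpace ⊤ a fun x hx => ?_
  exact (Scheme.mem_basicOpen T.left a x hx).mp (h.symm ▸ hx)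

theorem isUnit_res_openι {T : Over (Spec (CommRingCat.of k))} (V : T.left.Opens) (a : O T)
    (h : V ≤ T.left.basicOpen a) : IsUnit (res (openι T V) a) := by
  apply isUnit_of_basicOpen
  have := Scheme.preimage_basicOpen_top V.ι a
  refine Eq.trans this.symm ?_
  rw [eq_top_iff]
  exact fun x _ => h x.2

/-- The morphism `T ⟶ Spec A` given by a ring homomorphism `A → O T`. -/
noncomputable def specMk {T : Over (Spec (CommRingCat.of k))} {A : Type u} [CommRing A] (φ : A →+* O T) :
    T.left ⟶ Spec (CommRingCat.of A) :=
  T.left.toSpecΓ ≫ Spec.map (CommRingCat.ofHom φ)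

theorem specMk_str {T : Over (Spec (CommRingCat.of k))} : specMk (str T) = T.hom := by
  rw [specMk, str]
  change _ ≫ Spec.map ((Scheme.ΓSpecIso (CommRingCat.of k)).inv ≫ T.hom.appTop) = _
  rw [Spec.map_comp, ← Scheme.toSpecΓ_naturality_assoc, toSpecΓ_SpecMap_ΓSpecIso_inv,
    Category.comp_id]

theorem comp_specMk {T T' : Over (Spec (CommRingCat.of k))} (g : T' ⟶ T) {A : Type u} [CommRing A]
    (φ : A →+* O T) : g.left ≫ specMk φ = specMk ((res g).comp φ) := by
  rw [specMk, specMk, Scheme.toSpecΓ_naturality_assoc, ← Spec.map_comp]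
  rfl

theorem specMk_map {T : Over (Spec (CommRingCat.of k))} {A B : Type u} [CommRing A] [CommRing B]
    (φ : A →+* O T) (ψ : B →+* A) :
    specMk φ ≫ Spec.map (CommRingCat.ofHom ψ) = specMk (φ.comp ψ) := by
  rw [specMk, specMk, Category.assoc, ← Spec.map_comp]
  rfl

/-- The ring homomorphism `A → O T` given by a morphism `T ⟶ Spec A`. -/
noncomputable def specHom {T : Over (Spec (CommRingCat.of k))} {A : Type u} [CommRing A]
    (z : T.left ⟶ Spec (CommRingCat.of A)) : A →+* O T :=
  ((Scheme.ΓSpecIso (CommRingCat.of A)).inv ≫ z.appTop).hom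

theorem specHom_specMk {T : Over (Spec (CommRingCat.of k))} {A : Type u} [CommRing A]
    (φ : A →+* O T) : specHom (specMk φ) = φ := by
  have h : (Scheme.ΓSpecIso (CommRingCat.of A)).inv ≫ (specMk φ).appTop = CommRingCat.ofHom φ := by
    rw [specMk, Scheme.Hom.comp_appTop, Scheme.toSpecΓ_appTop, Scheme.ΓSpecIso_naturality,
      Iso.inv_hom_id_assoc]
  rw [specHom, h]
  rfl

theorem specMk_specHom {T : Over (Spec (CommRingCat.of k))} {A : Type u} [CommRing A]
    (z : T.left ⟶ Spec (CommRingCat.of A)) : specMk (specHom z) = z := by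
  rw [specMk, specHom]
  change _ ≫ Spec.map ((Scheme.ΓSpecIso (CommRingCat.of A)).inv ≫ z.appTop) = _
  rw [Spec.map_comp, ← Scheme.toSpecΓ_naturality_assoc, toSpecΓ_SpecMap_ΓSpecIso_inv,
    Category.comp_id]

theorem specMk_preimage {T : Over (Spec (CommRingCat.of k))} {A : Type u} [CommRing A]
    (φ : A →+* O T) (a : A) : specMk φ ⁻¹ᵁ PrimeSpectrum.basicOpen a = T.left.basicOpen (φ a) := by
  exact Scheme.toSpecΓ_preimage_basicOpen T.left (φ a)

theorem function_ext {T : Over (Spec (CommRingCat.of k))} (a b : O T)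
    (H : ∀ x : T.left, ∃ V : T.left.Opens, x ∈ V ∧ res (openι T V) a = res (openι T V) b) :
    a = b := by
  let φ (c : O T) : Polynomial k →+* O T := Polynomial.eval₂RingHom (str T) c
  have key : specMk (φ a) = specMk (φ b) := by
    choose V hV h using H
    refine Scheme.Cover.hom_ext (T.left.openCoverOfIsOpenCover V ?_) _ _ fun x => ?_
    · rw [TopologicalSpace.IsOpenCover, eq_top_iff]
      exact fun x _ => TopologicalSpace.Opens.mem_iSup.mpr ⟨x, hV x⟩
    · change (openι T (V x)).left ≫ _ = (openι T (V x)).left ≫ _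
      rw [comp_specMk, comp_specMk]
      congr 1
      apply Polynomial.ringHom_ext
      · intro c; simp [φ]
      · simpa [φ] using h x
  have := congr_arg (fun z => specHom z Polynomial.X) key
  simpa [specHom_specMk, φ] using this

end Functions

section ProjAlgebra

open HomogeneousLocalization

variable {k : Type u} [CommRing k] {I : Type} {R : Type u} [CommRing R]

/-- The polynomial ring with its standard grading. -/
abbrev 𝒮 (k : Type u) [CommRing k] (I : Type) : ℕ → Submodule k (MvPolynomial I k) :=
  MvPolynomial.homogeneousSubmodule I k

noncomputable instance (k : Type u) [CommRing k] (I : Type) : GradedAlgebra (𝒮 k I) :=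
  MvPolynomial.gradedAlgebra

/-- Evaluation of polynomials. -/
noncomputable def ev (s : k →+* R) (u : I → R) : MvPolynomial I k →+* R := MvPolynomial.eval₂Hom s u

theorem ev_X (s : k →+* R) (u : I → R) (i : I) : ev s u (MvPolynomial.X i) = u i := by
  simp [ev]

theorem map_ev {R' : Type u} [CommRing R'] (g : R →+* R') (s : k →+* R) (u : I → R)
    (a : MvPolynomial I k) : g (ev s u a) = ev (g.comp s) (fun i => g (u i)) a := by
  simp only [ev, MvPolynomial.coe_eval₂Hom]
  exact MvPolynomial.eval₂_comp_left g s u a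

theorem ev_smul (s : k →+* R) (u : I → R) (c : R) {n : ℕ} {a : MvPolynomial I k}
    (ha : a ∈ 𝒮 k I n) : ev s (fun i => c * u i) a = c ^ n * ev s u a := by
  simp only [ev, MvPolynomial.coe_eval₂Hom, MvPolynomial.eval₂_eq, Finset.mul_sum]
  refine Finset.sum_congr rfl fun d hd => ?_
  have hd' : ∑ i ∈ d.support, d i = n := by
    have h := ha (MvPolynomial.mem_support_iff.mp hd)
    rwa [Pi.one_def, ← Finsupp.degree_eq_weight_one, Finsupp.degree_apply] at h
  simp only [mul_pow, Finset.prod_mul_distrib, Finset.prod_pow_eq_pow_sum, hd']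
  ring

/-- The value of a homogeneous fraction of degree zero at a tuple of elements of `R`. -/
noncomputable def awayHom (s : k →+* R) (u : I → R) (f : MvPolynomial I k) (hf : IsUnit (ev s u f)) :
    Away (𝒮 k I) f →+* R :=
  (IsLocalization.Away.lift (S := Localization.Away f) f hf).comp
    (algebraMap (Away (𝒮 k I) f) (Localization.Away f))

theorem awayHom_mk (s : k →+* R) (u : I → R) {f : MvPolynomial I k} (hf : IsUnit (ev s u f)) {d : ℕ}
    (hd : f ∈ 𝒮 k I d) (n : ℕ) (a : MvPolynomial I k) (ha : a ∈ 𝒮 k I (n • d)) :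
    awayHom s u f hf (Away.mk (𝒮 k I) hd n a ha) * ev s u f ^ n = ev s u a := by
  rw [awayHom, RingHom.comp_apply, HomogeneousLocalization.algebraMap_apply, Away.val_mk]
  have e₁ : ev s u f ^ n = IsLocalization.Away.lift (S := Localization.Away f) f hf
      (algebraMap _ _ (f ^ n)) := by
    rw [IsLocalization.Away.lift_eq, map_pow]
  have e₂ : Localization.mk a (⟨f ^ n, n, rfl⟩ : Submonoid.powers f) *
      algebraMap _ (Localization.Away f) (f ^ n) = algebraMap _ _ a := by
    rw [Localization.mk_eq_mk']
    exact IsLocalization.mk'_spec (Localization.Away f) a (⟨f ^ n, n, rfl⟩ : Submonoid.powers f)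
  rw [e₁, ← map_mul, e₂, IsLocalization.Away.lift_eq]

theorem away_hom_ext {f : MvPolynomial I k} {d : ℕ} (hd : f ∈ 𝒮 k I d)
    (φ ψ : Away (𝒮 k I) f →+* R)
    (H : ∀ n a ha, φ (Away.mk (𝒮 k I) hd n a ha) = ψ (Away.mk (𝒮 k I) hd n a ha)) : φ = ψ := by
  ext x
  obtain ⟨n, a, ha, rfl⟩ := Away.mk_surjective (𝒮 k I) hd x
  exact H n a ha

theorem awayHom_smul (s : k →+* R) (u : I → R) (c : R) {f : MvPolynomial I k} {d : ℕ}
    (hd : f ∈ 𝒮 k I d)  (hf : IsUnit (ev s u f)) (hf' : IsUnit (ev s (fun i => c * u i) f)) :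
    awayHom s (fun i => c * u i) f hf' = awayHom s u f hf := by
  refine away_hom_ext hd _ _ fun n a ha => ?_
  have h₁ := awayHom_mk s u hf hd n a ha
  have h₂ := awayHom_mk s (fun i => c * u i) hf' hd n a ha
  rw [ev_smul _ _ _ ha, ← h₁] at h₂
  apply (hf'.pow n).mul_left_injective
  change _ * _ = _ * _
  rw [h₂, ev_smul _ _ _ hd, mul_pow, ← pow_mul, smul_eq_mul, mul_comm d n]
  ring

theorem awayHom_awayMap (s : k →+* R) (u : I → R) {f g x : MvPolynomial I k} {d e : ℕ}
    (hd : f ∈ 𝒮 k I d) (he : g ∈ 𝒮 k I e) (hx : x = f * g) (hf : IsUnit (ev s u f))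
    (hx' : IsUnit (ev s u x)) :
    (awayHom s u x hx').comp (awayMap (𝒮 k I) he hx) = awayHom s u f hf := by
  refine away_hom_ext hd _ _ fun n a ha => ?_
  rw [RingHom.comp_apply, awayMap_mk]
  have h₁ := awayHom_mk s u hf hd n a ha
  have h₂ := awayHom_mk s u hx' (hx ▸ SetLike.mul_mem_graded hd he) n (a * g ^ n) (by
    rw [smul_add]
    exact SetLike.mul_mem_graded ha (SetLike.pow_mem_graded n he))
  apply (hx'.pow n).mul_left_injective
  change _ * _ = _ * _
  rw [h₂, map_mul, ← h₁, hx, map_mul, map_pow]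
  ring

theorem map_awayHom {R' : Type u} [CommRing R'] (g : R →+* R') (s : k →+* R) (u : I → R)
    {f : MvPolynomial I k} {d : ℕ} (hd : f ∈ 𝒮 k I d) (hf : IsUnit (ev s u f))
    (hf' : IsUnit (ev (g.comp s) (fun i => g (u i)) f)) :
    g.comp (awayHom s u f hf) = awayHom (g.comp s) (fun i => g (u i)) f hf' := by
  refine away_hom_ext hd _ _ fun n a ha => ?_
  have h₁ := congr_arg g (awayHom_mk s u hf hd n a ha)
  have h₂ := awayHom_mk _ _ hf' hd n a ha
  rw [map_mul, map_pow, map_ev, map_ev, ← h₂] at h₁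
  exact (hf'.pow n).mul_left_injective h₁

theorem awayHom_fromZero (s : k →+* R) (u : I → R) {f : MvPolynomial I k}
    (hf : IsUnit (ev s u f)) :
    ((awayHom s u f hf).comp (fromZeroRingHom (𝒮 k I) (Submonoid.powers f))).comp
      (algebraMap k (𝒮 k I 0)) = s := by
  ext c
  have : (algebraMap (Away (𝒮 k I) f) (Localization.Away f))
      (fromZeroRingHom (𝒮 k I) (Submonoid.powers f) (algebraMap k (𝒮 k I 0) c)) =
      algebraMap _ _ (MvPolynomial.C c) := Localization.mk_one_eq_algebraMap _
  rw [RingHom.comp_apply, RingHom.comp_apply, awayHom, RingHom.comp_apply, this,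
    IsLocalization.Away.lift_eq]
  simp [ev]

theorem X_mem (k : Type u) [CommRing k] {I : Type} (i : I) : MvPolynomial.X i ∈ 𝒮 k I 1 :=
  MvPolynomial.isHomogeneous_X k i

/-- The fraction `X j / X i`. -/
noncomputable def frac (k : Type u) [CommRing k] {I : Type} (i j : I) : Away (𝒮 k I) (MvPolynomial.X i) :=
  Away.mk (𝒮 k I) (X_mem k i) 1 (MvPolynomial.X j)
    (by simpa using X_mem k j)

theorem awayHom_frac (s : k →+* R) (u : I → R) (i j : I)
    (hf : IsUnit (ev s u (MvPolynomial.X i))) : awayHom s u _ hf (frac k i j) * u i = u j := by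
  have := awayHom_mk s u hf (X_mem k i) 1 (MvPolynomial.X j)
    (by simpa using X_mem k j)
  rw [pow_one, ev_X, ev_X] at this
  exact this

theorem frac_self (i : I) : frac k i i = 1 := by
  apply HomogeneousLocalization.val_injective
  rw [frac, Away.val_mk, HomogeneousLocalization.val_one]
  simp only [pow_one]
  exact Localization.mk_self (⟨MvPolynomial.X i, _⟩ : Submonoid.powers (MvPolynomial.X (R := k) i))

theorem hom_eq_awayHom (i : I) (φ : Away (𝒮 k I) (MvPolynomial.X i) →+* R) (s : k →+* R)
    (hs : (φ.comp (fromZeroRingHom (𝒮 k I) (Submonoid.powers (MvPolynomial.X i)))).comp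
      (algebraMap k (𝒮 k I 0)) = s)
    (hf : IsUnit (ev s (fun j => φ (frac k i j)) (MvPolynomial.X i))) :
    φ = awayHom s (fun j => φ (frac k i j)) (MvPolynomial.X i) hf := by
  have hone : ev s (fun j => φ (frac k i j)) (MvPolynomial.X i) = 1 := by
    rw [ev_X, frac_self, map_one]
  refine away_hom_ext (X_mem k i) _ _ fun n a ha => ?_
  have h := awayHom_mk s (fun j => φ (frac k i j)) hf (X_mem k i) n a ha
  rw [hone, one_pow, mul_one] at h
  rw [h]
  let z : k →+* Away (𝒮 k I) (MvPolynomial.X i) :=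
    (fromZeroRingHom (𝒮 k I) (Submonoid.powers (MvPolynomial.X i))).comp (algebraMap k (𝒮 k I 0))
  have e₁ : ev s (fun j => φ (frac k i j)) a = φ (ev z (frac k i) a) := by
    rw [map_ev, ← hs]
    rfl
  rw [e₁]
  congr 1
  apply HomogeneousLocalization.val_injective
  let L := Localization.Away (MvPolynomial.X (R := k) i)
  let al : MvPolynomial I k →+* L := algebraMap _ L
  let c : L := IsLocalization.Away.invSelf (MvPolynomial.X (R := k) i)
  have hc : al (MvPolynomial.X i) * c = 1 := IsLocalization.Away.mul_invSelf _
  have hmk : ∀ (n : ℕ) (a : MvPolynomial I k),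
      (Localization.mk a (⟨MvPolynomial.X i ^ n, n, rfl⟩ : Submonoid.powers _) : L) =
        c ^ n * al a := by
    intro n a
    have h₁ : (Localization.mk a (⟨MvPolynomial.X i ^ n, n, rfl⟩ : Submonoid.powers _) : L) *
        al (MvPolynomial.X i ^ n) = al a := by
      rw [Localization.mk_eq_mk']
      exact IsLocalization.mk'_spec L a
        (⟨MvPolynomial.X i ^ n, n, rfl⟩ : Submonoid.powers (MvPolynomial.X (R := k) i))
    rw [← h₁, map_pow, mul_left_comm, ← mul_pow, mul_comm c, hc, one_pow, mul_one]
  let b : Away (𝒮 k I) (MvPolynomial.X i) →+* L := algebraMap _ L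
  have e₂ : (ev z (frac k i) a).val = ev (b.comp z) (fun j => b (frac k i j)) a :=
    map_ev b z (frac k i) a
  have e₃ : (fun j => b (frac k i j)) = fun j => c * al (MvPolynomial.X j) := by
    funext j
    have := hmk 1 (MvPolynomial.X j)
    refine Eq.trans ?_ (this.trans (by rw [pow_one]))
    exact Away.val_mk (𝒮 k I) 1 (X_mem k i) (MvPolynomial.X j) (by simpa using X_mem k j)
  have ha' : a ∈ 𝒮 k I n := by simpa using ha
  have e₄ : b.comp z = al.comp MvPolynomial.C := by
    ext x
    exact Localization.mk_one_eq_algebraMap _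
  rw [e₂, e₃, ev_smul _ _ _ ha', Away.val_mk, hmk, e₄]
  congr 1
  rw [← map_ev]
  congr 1
  simp [ev]

end ProjAlgebra

section ProjPoints

open HomogeneousLocalization

/-- A family of elements generating the unit ideal. -/
def Unimodular {I : Type} [Fintype I] {R : Type u} [CommRing R] (u : I → R) : Prop :=
  ∃ c : I → R, ∑ i, c i * u i = 1

theorem Unimodular.map {I : Type} [Fintype I] {R R' : Type u} [CommRing R] [CommRing R']
    {u : I → R} (hu : Unimodular u) (g : R →+* R') : Unimodular (fun i => g (u i)) := by
  obtain ⟨c, hc⟩ := hu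
  exact ⟨fun i => g (c i), by simpa using congr_arg g hc⟩

variable {k : Type u} [CommRing k] {I : Type}

/-- The projective space `Proj k[X_i : i ∈ I]` over `k`. -/
noncomputable def Pr (k : Type u) [CommRing k] (I : Type) : Over (Spec (CommRingCat.of k)) :=
  Over.mk (Proj.toSpecZero (𝒮 k I) ≫ Spec.map (CommRingCat.ofHom (algebraMap k (𝒮 k I 0))))

theorem chart_w {T : Over (Spec (CommRingCat.of k))} (u : I → O T) (f : MvPolynomial I k)
    {d : ℕ} (hd : f ∈ 𝒮 k I d) (hpos : 0 < d) (hf : IsUnit (ev (str T) u f)) :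
    (specMk (awayHom (str T) u f hf) ≫ Proj.awayι (𝒮 k I) f hd hpos) ≫
      Proj.toSpecZero (𝒮 k I) ≫ Spec.map (CommRingCat.ofHom (algebraMap k (𝒮 k I 0))) = T.hom := by
  rw [Category.assoc, Proj.awayι_toSpecZero_assoc, ← Category.assoc]
  have h : specMk (awayHom (str T) u f hf) ≫
      Spec.map (CommRingCat.ofHom (fromZeroRingHom (𝒮 k I) (Submonoid.powers f))) = _ :=
    specMk_map _ _
  rw [h, specMk_map, awayHom_fromZero, specMk_str]

/-- The morphism to projective space given by a tuple of functions for which the value of the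
homogeneous polynomial `f` is invertible. -/
noncomputable def chart {T : Over (Spec (CommRingCat.of k))} (u : I → O T) (f : MvPolynomial I k)
    {d : ℕ} (hd : f ∈ 𝒮 k I d) (hpos : 0 < d) (hf : IsUnit (ev (str T) u f)) : T ⟶ Pr k I :=
  Over.homMk (specMk (awayHom (str T) u f hf) ≫ Proj.awayι (𝒮 k I) f hd hpos) (chart_w u f hd hpos hf)

theorem chart_left {T : Over (Spec (CommRingCat.of k))} (u : I → O T) (f : MvPolynomial I k)
    {d : ℕ} (hd : f ∈ 𝒮 k I d) (hpos : 0 < d) (hf : IsUnit (ev (str T) u f)) :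
    (chart u f hd hpos hf).left =
      specMk (awayHom (str T) u f hf) ≫ Proj.awayι (𝒮 k I) f hd hpos := rfl

theorem isUnit_ev_res {T T' : Over (Spec (CommRingCat.of k))} (g : T' ⟶ T) {u : I → O T}
    {f : MvPolynomial I k} (hf : IsUnit (ev (str T) u f)) :
    IsUnit (ev (str T') (fun i => res g (u i)) f) := by
  rw [← res_comp_str g, ← map_ev]
  exact hf.map _

theorem chart_congr {T : Over (Spec (CommRingCat.of k))} (u u' : I → O T) (h : u = u')
    (f : MvPolynomial I k) {d : ℕ} (hd : f ∈ 𝒮 k I d) (hpos : 0 < d)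
    (hf : IsUnit (ev (str T) u f)) :
    chart u f hd hpos hf = chart u' f hd hpos (h ▸ hf) := by
  subst h; rfl

theorem chart_nat {T T' : Over (Spec (CommRingCat.of k))} (g : T' ⟶ T) (u : I → O T)
    (f : MvPolynomial I k) {d : ℕ} (hd : f ∈ 𝒮 k I d) (hpos : 0 < d)
    (hf : IsUnit (ev (str T) u f)) :
    g ≫ chart u f hd hpos hf =
      chart (fun i => res g (u i)) f hd hpos (isUnit_ev_res g hf) := by
  ext1
  have h₀ : (res g).comp (awayHom (str T) u f hf) = awayHom (str T') _ f (isUnit_ev_res g hf) := by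
    have h := isUnit_ev_res g hf
    rw [← res_comp_str g] at h
    rw [map_awayHom (res g) (str T) u hd hf h]
    congr 1
    exact res_comp_str g
  have h₁ : g.left ≫ specMk (awayHom (str T) u f hf) ≫ Proj.awayι (𝒮 k I) f hd hpos =
      specMk (awayHom (str T') _ f (isUnit_ev_res g hf)) ≫ Proj.awayι (𝒮 k I) f hd hpos := by
    rw [← Category.assoc, comp_specMk, h₀]
  exact h₁

theorem chart_mul {T : Over (Spec (CommRingCat.of k))} (u : I → O T)
    {f g x : MvPolynomial I k} {d e : ℕ} (hd : f ∈ 𝒮 k I d) (hpos : 0 < d)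
    (hf : IsUnit (ev (str T) u f)) (he : g ∈ 𝒮 k I e) (hx : x = f * g) (hc : x ∈ 𝒮 k I (d + e))
    (hcpos : 0 < d + e) (hx' : IsUnit (ev (str T) u x)) :
    chart u x hc hcpos hx' = chart u f hd hpos hf := by
  ext1
  have h : specMk (awayHom (str T) u x hx') ≫
      Spec.map (CommRingCat.ofHom (awayMap (𝒮 k I) he hx)) = _ := specMk_map _ _
  rw [chart_left, chart_left, ← awayHom_awayMap (str T) u hd he hx hf hx', ← h,
    Category.assoc]
  have h' : Spec.map (CommRingCat.ofHom (awayMap (𝒮 k I) he hx)) ≫ Proj.awayι (𝒮 k I) f hd hpos =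
    _ := Proj.SpecMap_awayMap_awayι (𝒮 k I) hd hpos he hx
  rw [h']

theorem chart_indep {T : Over (Spec (CommRingCat.of k))} (u : I → O T)
    {f g : MvPolynomial I k} {d e : ℕ} (hd : f ∈ 𝒮 k I d) (hpos : 0 < d)
    (hf : IsUnit (ev (str T) u f)) (he : g ∈ 𝒮 k I e) (hepos : 0 < e)
    (hg : IsUnit (ev (str T) u g)) :
    chart u f hd hpos hf = chart u g he hepos hg := by
  have hx : IsUnit (ev (str T) u (f * g)) := by
    rw [map_mul]
    exact hf.mul hg
  have hm : f * g ∈ 𝒮 k I (d + e) := SetLike.mul_mem_graded hd he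
  have hm' : f * g ∈ 𝒮 k I (e + d) := by rwa [add_comm]
  rw [← chart_mul u hd hpos hf he rfl hm (by omega) hx,
    ← chart_mul u he hepos hg hd (mul_comm f g) hm' (by omega) hx]
  rfl

theorem chart_preimage {T : Over (Spec (CommRingCat.of k))} (u : I → O T)
    {f g : MvPolynomial I k} {d e : ℕ} (hd : f ∈ 𝒮 k I d) (hpos : 0 < d)
    (hf : IsUnit (ev (str T) u f)) (he : g ∈ 𝒮 k I e) (hepos : 0 < e) :
    (chart u f hd hpos hf).left ⁻¹ᵁ Proj.basicOpen (𝒮 k I) g =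
      T.left.basicOpen (ev (str T) u g) := by
  have h₁ := awayHom_mk (str T) u hf hd e (g ^ d) (by
    rw [smul_eq_mul, mul_comm]; exact SetLike.pow_mem_graded d he)
  have h₂ : (chart u f hd hpos hf).left ⁻¹ᵁ Proj.basicOpen (𝒮 k I) g =
      specMk (awayHom (str T) u f hf) ⁻¹ᵁ
        (Proj.awayι (𝒮 k I) f hd hpos ⁻¹ᵁ Proj.basicOpen (𝒮 k I) g) := rfl
  rw [h₂, Proj.awayι_preimage_basicOpen (𝒮 k I) hd hpos he hepos, specMk_preimage]
  have h₃ := congr_arg T.left.basicOpen h₁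
  rw [Scheme.basicOpen_mul, Scheme.basicOpen_of_isUnit _ (hf.pow e), map_pow,
    Scheme.basicOpen_pow _ _ hpos, inf_top_eq] at h₃
  exact h₃

theorem chart_smul {T : Over (Spec (CommRingCat.of k))} (u u' : I → O T) (c : O T)
    (h : ∀ i, u' i = c * u i) {f : MvPolynomial I k} {d : ℕ} (hd : f ∈ 𝒮 k I d) (hpos : 0 < d)
    (hf : IsUnit (ev (str T) u f)) (hf' : IsUnit (ev (str T) u' f)) :
    chart u f hd hpos hf = chart u' f hd hpos hf' := by
  obtain rfl : u' = fun i => c * u i := funext h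
  ext1
  rw [chart_left, chart_left, awayHom_smul (str T) u c hd hf hf']

theorem iSup_basicOpen_X : ⨆ i : I, Proj.basicOpen (𝒮 k I) (MvPolynomial.X i) = ⊤ := by
  refine Proj.iSup_basicOpen_eq_top' (𝒮 k I) _ (fun i => ⟨1, X_mem k i⟩) ?_
  rw [eq_top_iff]
  intro p _
  induction p using MvPolynomial.induction_on with
  | C a => exact Subalgebra.algebraMap_mem (Algebra.adjoin (𝒮 k I 0) _) (algebraMap k (𝒮 k I 0) a)
  | add p q hp hq => exact Subalgebra.add_mem _ (hp trivial) (hq trivial)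
  | mul_X p i hp => exact Subalgebra.mul_mem _ (hp trivial) (Algebra.subset_adjoin ⟨i, rfl⟩)

variable [Fintype I]

theorem Unimodular.exists_open {T : Over (Spec (CommRingCat.of k))} {u : I → O T}
    (hu : Unimodular u) (x : T.left) :
    ∃ V : T.left.Opens, x ∈ V ∧ ∃ i, IsUnit (res (openι T V) (u i)) := by
  suffices h : ∃ i, x ∈ T.left.basicOpen (u i) by
    obtain ⟨i, hi⟩ := h
    exact ⟨_, hi, i, isUnit_res_openι _ _ le_rfl⟩
  by_contra! h
  obtain ⟨c, hc⟩ := hu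
  have hx : ∀ i, T.left.presheaf.germ ⊤ x trivial (u i) ∈ IsLocalRing.maximalIdeal _ := by
    intro i
    rw [IsLocalRing.mem_maximalIdeal, mem_nonunits_iff]
    exact fun hi => h i ((Scheme.mem_basicOpen T.left (u i) x trivial).mpr hi)
  have h₁ := congr_arg (T.left.presheaf.germ ⊤ x trivial) hc
  rw [map_sum, map_one] at h₁
  have h₂ : (1 : T.left.presheaf.stalk x) ∈ IsLocalRing.maximalIdeal _ := by
    rw [← h₁]
    refine Ideal.sum_mem _ fun i _ => ?_
    rw [map_mul]
    exact Ideal.mul_mem_left _ _ (hx i)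
  exact (IsLocalRing.maximalIdeal.isMaximal _).ne_top ((Ideal.eq_top_iff_one _).mpr h₂)

theorem pt_exists {T : Over (Spec (CommRingCat.of k))} {u : I → O T} (hu : Unimodular u) :
    ∃ m : T ⟶ Pr k I, ∀ {T' : Over (Spec (CommRingCat.of k))} (g : T' ⟶ T) (f : MvPolynomial I k)
      {d : ℕ} (hd : f ∈ 𝒮 k I d) (hpos : 0 < d)
      (hf : IsUnit (ev (str T') (fun i => res g (u i)) f)),
      g ≫ m = chart (fun i => res g (u i)) f hd hpos hf := by
  obtain ⟨m, hm, -⟩ := existsUnique_glue (T := T) (W := Pr k I)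
    (fun {T'} g z => ∃ (f : MvPolynomial I k) (d : ℕ) (hd : f ∈ 𝒮 k I d) (hpos : 0 < d)
      (hf : IsUnit (ev (str T') (fun i => res g (u i)) f)),
      z = chart (fun i => res g (u i)) f hd hpos hf)
    (by
      rintro T' T'' g f z ⟨a, d, hd, hpos, hf, rfl⟩
      have e : (fun i => res g (res f (u i))) = fun i => res (g ≫ f) (u i) :=
        funext fun i => (res_comp f g (u i)).symm
      have h := isUnit_ev_res g hf
      rw [e] at h
      refine ⟨a, d, hd, hpos, h, ?_⟩
      rw [chart_nat, chart_congr _ _ e])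
    (by
      rintro T' g z z' ⟨a, d, hd, hpos, hf, rfl⟩ ⟨a', d', hd', hpos', hf', rfl⟩
      exact chart_indep _ _ _ _ _ _ _)
    (by
      intro x
      obtain ⟨V, hV, i, hi⟩ := hu.exists_open x
      refine ⟨V, hV, _, MvPolynomial.X i, 1, X_mem k i, one_pos, by rwa [ev_X], rfl⟩)
  exact ⟨m, fun g f d hd hpos hf => hm g _ ⟨f, d, hd, hpos, hf, rfl⟩⟩

/-- The point `[u]` of projective space with homogeneous coordinates `u`: on the open subscheme where
`u i` is invertible it is the composite of `T ⟶ Spec k[X_j / X_i]`, `X_j / X_i ↦ u j / u i`, with the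
inclusion of this standard affine chart. -/
noncomputable def pt {T : Over (Spec (CommRingCat.of k))} (u : I → O T) (hu : Unimodular u) :
    T ⟶ Pr k I :=
  (pt_exists hu).choose

theorem comp_pt {T : Over (Spec (CommRingCat.of k))} {u : I → O T} (hu : Unimodular u)
    {T' : Over (Spec (CommRingCat.of k))} (g : T' ⟶ T) (f : MvPolynomial I k)
    {d : ℕ} (hd : f ∈ 𝒮 k I d) (hpos : 0 < d)
    (hf : IsUnit (ev (str T') (fun i => res g (u i)) f)) :
    g ≫ pt u hu = chart (fun i => res g (u i)) f hd hpos hf :=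
  (pt_exists hu).choose_spec g f hd hpos hf

theorem pt_eq_chart {T : Over (Spec (CommRingCat.of k))} {u : I → O T} (hu : Unimodular u)
    (f : MvPolynomial I k) {d : ℕ} (hd : f ∈ 𝒮 k I d) (hpos : 0 < d)
    (hf : IsUnit (ev (str T) u f)) : pt u hu = chart u f hd hpos hf := by
  have e : u = fun i => res (𝟙 T) (u i) := funext fun i => (res_id T _).symm
  have h := comp_pt hu (𝟙 T) f hd hpos (e ▸ hf)
  rw [Category.id_comp] at h
  rw [h, chart_congr _ _ e.symm]

theorem pt_nat {T T' : Over (Spec (CommRingCat.of k))} (g : T' ⟶ T) {u : I → O T}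
    (hu : Unimodular u) : g ≫ pt u hu = pt (fun i => res g (u i)) (hu.map (res g)) := by
  refine over_hom_ext_of_open _ _ fun x => ?_
  obtain ⟨V, hV, i, hi⟩ := (hu.map (res g)).exists_open x
  refine ⟨V, hV, ?_⟩
  have e : (fun i => res (openι T' V ≫ g) (u i)) = fun i => res (openι T' V) (res g (u i)) :=
    funext fun i => res_comp g (openι T' V) (u i)
  rw [← Category.assoc, comp_pt hu _ (MvPolynomial.X i) (X_mem k i) one_pos (by
      rw [e, ev_X]; exact hi), comp_pt _ _ (MvPolynomial.X i) (X_mem k i) one_pos (by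
      rw [ev_X]; exact hi), chart_congr _ _ e]

theorem pt_congr {T : Over (Spec (CommRingCat.of k))} {u u' : I → O T} (h : u = u')
    (hu : Unimodular u) : pt u hu = pt u' (h ▸ hu) := by
  subst h; rfl

theorem pt_eq_of_cross {T : Over (Spec (CommRingCat.of k))} {u u' : I → O T} (hu : Unimodular u)
    (hu' : Unimodular u') (h : ∀ i j, u i * u' j = u j * u' i) : pt u hu = pt u' hu' := by
  refine over_hom_ext_of_open _ _ fun x => ?_
  obtain ⟨V, hV, i, hi⟩ := hu.exists_open x
  refine ⟨V, hV, ?_⟩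
  let g := openι T V
  obtain ⟨w, hw⟩ := hi
  have hc : ∀ j, res g (u' j) = (↑w⁻¹ * res g (u' i)) * res g (u j) := by
    intro j
    have h₁ := congr_arg (res g) (h i j)
    rw [map_mul, map_mul, ← hw] at h₁
    rw [mul_assoc, mul_comm (res g (u' i)), ← h₁, ← mul_assoc, Units.inv_mul, one_mul]
  have hunit : IsUnit (↑w⁻¹ * res g (u' i)) := by
    obtain ⟨c, hc'⟩ := hu'.map (res g)
    refine IsUnit.of_mul_eq_one (∑ j, c j * res g (u j)) ?_
    rw [← hc', Finset.mul_sum]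
    refine Finset.sum_congr rfl fun j _ => ?_
    beta_reduce
    rw [hc j]
    ring
  have hi' : IsUnit (res g (u' i)) := by
    have := (w.isUnit).mul hunit
    rwa [← mul_assoc, Units.mul_inv, one_mul] at this
  rw [comp_pt hu g (MvPolynomial.X i) (X_mem k i) one_pos (by rw [ev_X]; exact ⟨w, hw⟩),
    comp_pt hu' g (MvPolynomial.X i) (X_mem k i) one_pos (by rw [ev_X]; exact hi')]
  exact chart_smul _ _ _ hc _ _ _ _

theorem pt_preimage {T : Over (Spec (CommRingCat.of k))} {u : I → O T} (hu : Unimodular u)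
    {g : MvPolynomial I k} {e : ℕ} (he : g ∈ 𝒮 k I e) (hepos : 0 < e) :
    (pt u hu).left ⁻¹ᵁ Proj.basicOpen (𝒮 k I) g = T.left.basicOpen (ev (str T) u g) := by
  ext x
  obtain ⟨V, hV, i, hi⟩ := hu.exists_open x
  have hi' : IsUnit (ev (str (openOver T V)) (fun i => res (openι T V) (u i)) (MvPolynomial.X i)) := by
    rw [ev_X]; exact hi
  have h₁ := chart_preimage (fun i => res (openι T V) (u i)) (X_mem k i) one_pos hi' he hepos
  rw [← comp_pt hu (openι T V) _ (X_mem k i) one_pos hi', ← res_comp_str (openι T V), ← map_ev] at h₁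
  have h₂ : (openι T V).left ⁻¹ᵁ T.left.basicOpen (ev (str T) u g) = _ :=
    Scheme.preimage_basicOpen_top V.ι (ev (str T) u g)
  have h₃ := h₁.trans h₂.symm
  exact (SetLike.ext_iff.mp h₃ ⟨x, hV⟩ :)

theorem cross_of_pt_eq {T : Over (Spec (CommRingCat.of k))} {u u' : I → O T} (hu : Unimodular u)
    (hu' : Unimodular u') (h : pt u hu = pt u' hu') (i j : I) : u i * u' j = u j * u' i := by
  refine function_ext _ _ fun x => ?_
  obtain ⟨V, hV, l, hl⟩ := hu.exists_open x
  refine ⟨V, hV, ?_⟩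
  let g := openι T V
  have hl₁ : IsUnit (ev (str (openOver T V)) (fun i => res g (u i)) (MvPolynomial.X l)) := by
    rw [ev_X]; exact hl
  have hl₂ : IsUnit (ev (str (openOver T V)) (fun i => res g (u' i)) (MvPolynomial.X l)) := by
    have h₁ := pt_preimage (hu.map (res g)) (X_mem k l) one_pos
    have h₂ := pt_preimage (hu'.map (res g)) (X_mem k l) one_pos
    rw [← pt_nat g hu', ← h, pt_nat g hu, h₁, Scheme.basicOpen_of_isUnit _ hl₁] at h₂
    exact isUnit_of_basicOpen _ h₂.symm
  have hch := comp_pt hu g _ (X_mem k l) one_pos hl₁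
  rw [h, comp_pt hu' g _ (X_mem k l) one_pos hl₂] at hch
  have h₃ : specMk (awayHom _ _ _ hl₂) ≫ Proj.awayι (𝒮 k I) _ (X_mem k l) one_pos =
      specMk (awayHom _ _ _ hl₁) ≫ Proj.awayι (𝒮 k I) _ (X_mem k l) one_pos :=
    congr_arg CommaMorphism.left hch
  have h₄ := (cancel_mono _).mp h₃
  have h₅ := congr_arg (fun z => specHom z) h₄
  simp only [specHom_specMk] at h₅
  have a₁ := fun j => awayHom_frac _ _ l j hl₁
  have a₂ := fun j => awayHom_frac _ _ l j hl₂
  simp only [h₅] at a₂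
  rw [map_mul, map_mul, ← a₁ i, ← a₁ j, ← a₂ i, ← a₂ j]
  ring

theorem pr_loc {T : Over (Spec (CommRingCat.of k))} (z : T ⟶ Pr k I) (x : T.left) :
    ∃ V : T.left.Opens, x ∈ V ∧ ∃ (u : I → O (openOver T V)) (hu : Unimodular u),
      openι T V ≫ z = pt u hu := by
  classical
  have hx : z.left x ∈ ⨆ i : I, Proj.basicOpen (𝒮 k I) (MvPolynomial.X i) := by
    rw [iSup_basicOpen_X]; trivial
  obtain ⟨i, hi⟩ := TopologicalSpace.Opens.mem_iSup.mp hx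
  let V : T.left.Opens := z.left ⁻¹ᵁ Proj.basicOpen (𝒮 k I) (MvPolynomial.X i)
  let z' : (openOver T V).left ⟶ Proj (𝒮 k I) := V.ι ≫ z.left
  let a := Proj.awayι (𝒮 k I) _ (X_mem k i) one_pos
  have hr : Set.range z' ⊆ Set.range a := by
    have : a.opensRange = _ := Proj.opensRange_awayι (𝒮 k I) _ (X_mem k i) one_pos
    rintro _ ⟨y, rfl⟩
    have hy : z' y ∈ a.opensRange := by
      rw [this]
      exact y.2
    exact hy
  let y : (openOver T V).left ⟶ Spec (CommRingCat.of (Away (𝒮 k I) (MvPolynomial.X i))) :=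
    IsOpenImmersion.lift a z' hr
  have hy : y ≫ a = z' := IsOpenImmersion.lift_fac a z' hr
  let φ := specHom y
  have hφ : specMk φ = y := specMk_specHom y
  let u : I → O (openOver T V) := fun j => φ (frac k i j)
  have hui : u i = 1 := by simp [u, frac_self]
  have hf : IsUnit (ev (str (openOver T V)) u (MvPolynomial.X i)) := by
    rw [ev_X, hui]; exact isUnit_one
  have hs : (φ.comp (fromZeroRingHom (𝒮 k I) (Submonoid.powers (MvPolynomial.X i)))).comp
      (algebraMap k (𝒮 k I 0)) = str (openOver T V) := by
    have h₁ : (openOver T V).hom = specMk ((φ.comp (fromZeroRingHom (𝒮 k I)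
        (Submonoid.powers (MvPolynomial.X i)))).comp (algebraMap k (𝒮 k I 0))) := by
      have h₂ : z' ≫ Proj.toSpecZero (𝒮 k I) ≫
          Spec.map (CommRingCat.ofHom (algebraMap k (𝒮 k I 0))) = (openOver T V).hom := by
        exact Over.w (openι T V ≫ z)
      have h₃ : y ≫ Spec.map (CommRingCat.ofHom (fromZeroRingHom (𝒮 k I)
          (Submonoid.powers (MvPolynomial.X i)))) = specMk (φ.comp (fromZeroRingHom (𝒮 k I)
            (Submonoid.powers (MvPolynomial.X i)))) := by
        rw [← hφ]
        exact specMk_map _ _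
      rw [← h₂, ← hy, Category.assoc, Proj.awayι_toSpecZero_assoc, ← Category.assoc, h₃, specMk_map]
    rw [← specMk_str] at h₁
    have := congr_arg (fun z => specHom z) h₁
    simpa only [specHom_specMk] using this.symm
  have hu : Unimodular u := ⟨fun j => if j = i then 1 else 0, by simp [hui]⟩
  refine ⟨V, hi, u, hu, ?_⟩
  rw [pt_eq_chart hu _ (X_mem k i) one_pos hf]
  ext1
  rw [chart_left, ← hom_eq_awayHom i φ _ hs hf]
  change z' = _
  rw [← hy, hφ]

/-- Homogeneous coordinates on projective space. -/
noncomputable def prPres (k : Type u) [CommRing k] (I : Type) [Fintype I] : Pres (Pr k I) where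
  U T := {u : I → O T // Unimodular u}
  res g u := ⟨fun i => res g (u.1 i), u.2.map (res g)⟩
  pt u := pt u.1 u.2
  nat g u := pt_nat g u.2
  loc z x := by
    obtain ⟨V, hV, u, hu, e⟩ := pr_loc z x
    exact ⟨V, hV, ⟨u, hu⟩, e⟩

end ProjPoints

section PGL

open Matrix

variable {k : Type u} [CommRing k]

/-- The determinant as a homogeneous polynomial in the entries of a `2 × 2` matrix. -/
noncomputable def detP (k : Type u) [CommRing k] : MvPolynomial (Fin 2 × Fin 2) k :=
  MvPolynomial.X (0, 0) * MvPolynomial.X (1, 1) - MvPolynomial.X (0, 1) * MvPolynomial.X (1, 0)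

theorem detP_mem : detP k ∈ 𝒮 k (Fin 2 × Fin 2) 2 :=
  Submodule.sub_mem _ (SetLike.mul_mem_graded (X_mem k _) (X_mem k _))
    (SetLike.mul_mem_graded (X_mem k _) (X_mem k _))

/-- The scheme `PGL₂`: the open subscheme of the projective space of `2 × 2` matrices on which the
determinant does not vanish. -/
noncomputable def PGL2 (k : Type u) [CommRing k] : Over (Spec (CommRingCat.of k)) :=
  openOver (Pr k (Fin 2 × Fin 2)) (Proj.basicOpen (𝒮 k (Fin 2 × Fin 2)) (detP k))

/-- The inclusion of `PGL₂` in the projective space of matrices. -/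
noncomputable def pglι (k : Type u) [CommRing k] : PGL2 k ⟶ Pr k (Fin 2 × Fin 2) :=
  openι (Pr k (Fin 2 × Fin 2)) (Proj.basicOpen (𝒮 k (Fin 2 × Fin 2)) (detP k))

theorem pgl_hom_ext {T : Over (Spec (CommRingCat.of k))} {z z' : T ⟶ PGL2 k}
    (h : z ≫ pglι k = z' ≫ pglι k) : z = z' :=
  openι_hom_ext _ h

/-- The entries of a matrix. -/
def entries {R : Type u} (a : Matrix (Fin 2) (Fin 2) R) : Fin 2 × Fin 2 → R := fun p => a p.1 p.2

theorem ev_detP {R : Type u} [CommRing R] (s : k →+* R) (a : Matrix (Fin 2) (Fin 2) R) :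
    ev s (entries a) (detP k) = a.det := by
  rw [detP, map_sub, map_mul, map_mul, ev_X, ev_X, ev_X, ev_X, Matrix.det_fin_two]
  rfl

theorem unimodular_entries {R : Type u} [CommRing R] {a : Matrix (Fin 2) (Fin 2) R}
    (h : IsUnit a.det) : Unimodular (entries a) := by
  obtain ⟨c, hc⟩ := h.exists_left_inv
  refine ⟨entries !![c * a 1 1, - (c * a 1 0); 0, 0], ?_⟩
  rw [Matrix.det_fin_two] at hc
  rw [Fintype.sum_prod_type]
  simp only [Fin.sum_univ_two, entries]
  simp
  linear_combination hc

theorem pgl_exists {T : Over (Spec (CommRingCat.of k))} (a : Matrix (Fin 2) (Fin 2) (O T))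
    (h : IsUnit a.det) :
    ∃ z : T ⟶ PGL2 k, z ≫ pglι k = pt (entries a) (unimodular_entries h) := by
  have h₁ := pt_preimage (unimodular_entries h) (detP_mem (k := k)) two_pos
  rw [ev_detP, Scheme.basicOpen_of_isUnit _ h] at h₁
  exact openι_lift (W := Pr k (Fin 2 × Fin 2)) _ _ h₁

/-- The point of `PGL₂` given by an invertible matrix: its composite with the inclusion of `PGL₂` in
the projective space of matrices is the point with homogeneous coordinates the entries of `a`. -/
noncomputable def pgl {T : Over (Spec (CommRingCat.of k))} (a : Matrix (Fin 2) (Fin 2) (O T))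
    (h : IsUnit a.det) : T ⟶ PGL2 k :=
  (pgl_exists a h).choose

theorem pgl_ι {T : Over (Spec (CommRingCat.of k))} (a : Matrix (Fin 2) (Fin 2) (O T))
    (h : IsUnit a.det) : pgl a h ≫ pglι k = pt (entries a) (unimodular_entries h) :=
  (pgl_exists a h).choose_spec

theorem isUnit_det_map {R R' : Type u} [CommRing R] [CommRing R'] (g : R →+* R')
    {a : Matrix (Fin 2) (Fin 2) R} (h : IsUnit a.det) : IsUnit (a.map g).det := by
  have : (a.map g).det = g a.det := (RingHom.map_det g a).symm
  rw [this]
  exact h.map g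

theorem pgl_nat {T T' : Over (Spec (CommRingCat.of k))} (g : T' ⟶ T)
    (a : Matrix (Fin 2) (Fin 2) (O T)) (h : IsUnit a.det) :
    g ≫ pgl a h = pgl (a.map (res g)) (isUnit_det_map (res g) h) := by
  apply pgl_hom_ext
  rw [Category.assoc, pgl_ι, pgl_ι, pt_nat]
  rfl

theorem pgl_congr {T : Over (Spec (CommRingCat.of k))} {a a' : Matrix (Fin 2) (Fin 2) (O T)}
    (h : IsUnit a.det) (e : a = a') : pgl a h = pgl a' (e ▸ h) := by
  subst e; rfl

theorem pgl_eq_of_cross {T : Over (Spec (CommRingCat.of k))} {a a' : Matrix (Fin 2) (Fin 2) (O T)}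
    (h : IsUnit a.det) (h' : IsUnit a'.det)
    (H : ∀ i j l m, a i j * a' l m = a l m * a' i j) : pgl a h = pgl a' h' := by
  apply pgl_hom_ext
  rw [pgl_ι, pgl_ι]
  exact pt_eq_of_cross _ _ fun p q => H _ _ _ _

theorem cross_of_pgl_eq {T : Over (Spec (CommRingCat.of k))} {a a' : Matrix (Fin 2) (Fin 2) (O T)}
    {h : IsUnit a.det} {h' : IsUnit a'.det} (e : pgl a h = pgl a' h') (i j l m : Fin 2) :
    a i j * a' l m = a l m * a' i j := by
  have := congr_arg (· ≫ pglι k) e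
  simp only [pgl_ι] at this
  exact cross_of_pt_eq _ _ this (i, j) (l, m)

/-- Invertible matrices as coordinates on `PGL₂`. -/
noncomputable def pglPres (k : Type u) [CommRing k] : Pres (PGL2 k) where
  U T := {a : Matrix (Fin 2) (Fin 2) (O T) // IsUnit a.det}
  res g a := ⟨a.1.map (res g), isUnit_det_map (res g) a.2⟩
  pt a := pgl a.1 a.2
  nat g a := pgl_nat g a.1 a.2
  loc {T} z x := by
    obtain ⟨V, hV, u, hu, e⟩ := pr_loc (z ≫ pglι k) x
    let a : Matrix (Fin 2) (Fin 2) (O (openOver T V)) := fun i j => u (i, j)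
    have hua : u = entries a := rfl
    have ha : IsUnit a.det := by
      rw [← ev_detP (str (openOver T V)), ← hua]
      apply isUnit_of_basicOpen
      rw [← pt_preimage hu detP_mem two_pos, ← e, eq_top_iff]
      intro y _
      exact ((V.ι ≫ z.left) y).2
    refine ⟨V, hV, ⟨a, ha⟩, ?_⟩
    apply pgl_hom_ext
    rw [Category.assoc, e, pgl_ι]
    rfl

end PGL

section PGLAction

open Matrix

variable {k : Type u} [CommRing k]

theorem cross_mul {R : Type u} [CommRing R] {a a' b b' : Matrix (Fin 2) (Fin 2) R}
    (ha : ∀ i j l m, a i j * a' l m = a l m * a' i j)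
    (hb : ∀ i j l m, b i j * b' l m = b l m * b' i j) (i j l m : Fin 2) :
    (a * b) i j * (a' * b') l m = (a * b) l m * (a' * b') i j := by
  simp only [Matrix.mul_apply, Finset.sum_mul_sum]
  rw [Finset.sum_comm]
  refine Finset.sum_congr rfl fun r _ => Finset.sum_congr rfl fun s _ => ?_
  linear_combination b s j * b' r m * ha i s l r + a l r * a' i s * hb s j r m

theorem cross_adjugate {R : Type u} [CommRing R] {a a' : Matrix (Fin 2) (Fin 2) R}
    (ha : ∀ i j l m, a i j * a' l m = a l m * a' i j) (i j l m : Fin 2) :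
    a.adjugate i j * a'.adjugate l m = a.adjugate l m * a'.adjugate i j := by
  have h : ∀ b : Matrix (Fin 2) (Fin 2) R, ∀ i j,
      b.adjugate i j = (if i = j then 1 else -1) * b (j + 1) (i + 1) := by
    intro b i j
    rw [Matrix.adjugate_fin_two]
    fin_cases i <;> fin_cases j <;> simp
  rw [h, h, h, h]
  linear_combination (if i = j then 1 else -1) * (if l = m then 1 else -1) *
    ha (j + 1) (i + 1) (m + 1) (l + 1)

theorem cross_mulVec {R : Type u} [CommRing R] {a a' : Matrix (Fin 2) (Fin 2) R}
    {u u' : Fin 2 → R} (ha : ∀ i j l m, a i j * a' l m = a l m * a' i j)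
    (hu : ∀ i j, u i * u' j = u j * u' i) (i j : Fin 2) :
    (a *ᵥ u) i * (a' *ᵥ u') j = (a *ᵥ u) j * (a' *ᵥ u') i := by
  simp only [Matrix.mulVec, dotProduct, Finset.sum_mul_sum]
  rw [Finset.sum_comm]
  refine Finset.sum_congr rfl fun r _ => Finset.sum_congr rfl fun s _ => ?_
  linear_combination u s * u' r * ha i s j r + a j r * a' i s * hu s r

theorem isUnit_det_mul {R : Type u} [CommRing R] {a b : Matrix (Fin 2) (Fin 2) R}
    (ha : IsUnit a.det) (hb : IsUnit b.det) : IsUnit (a * b).det := by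
  rw [Matrix.det_mul]
  exact ha.mul hb

theorem isUnit_det_one {R : Type u} [CommRing R] :
    IsUnit (1 : Matrix (Fin 2) (Fin 2) R).det := by
  rw [Matrix.det_one]
  exact isUnit_one

theorem isUnit_det_adjugate {R : Type u} [CommRing R] {a : Matrix (Fin 2) (Fin 2) R}
    (ha : IsUnit a.det) : IsUnit a.adjugate.det := by
  rw [Matrix.det_adjugate]
  exact ha.pow _

theorem unimodular_mulVec {R : Type u} [CommRing R] {a : Matrix (Fin 2) (Fin 2) R}
    (ha : IsUnit a.det) {u : Fin 2 → R} (hu : Unimodular u) : Unimodular (a *ᵥ u) := by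
  obtain ⟨c, hc⟩ := hu
  refine ⟨c ᵥ* a⁻¹, ?_⟩
  change (c ᵥ* a⁻¹) ⬝ᵥ (a *ᵥ u) = 1
  rw [Matrix.dotProduct_mulVec, Matrix.vecMul_vecMul, Matrix.nonsing_inv_mul a ha,
    Matrix.vecMul_one]
  exact hc

theorem pglMul_exists (k : Type u) [CommRing k] :
    ∃ m : PGL2 k ⊗ PGL2 k ⟶ PGL2 k, ∀ {T : Over (Spec (CommRingCat.of k))}
      (a b : Matrix (Fin 2) (Fin 2) (O T)) (ha : IsUnit a.det) (hb : IsUnit b.det),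
      lift (pgl a ha) (pgl b hb) ≫ m = pgl (a * b) (isUnit_det_mul ha hb) := by
  obtain ⟨m, hm⟩ := ((pglPres k).prod (pglPres k)).exists_desc (W := PGL2 k)
    (fun u => pgl (u.1.1 * u.2.1) (isUnit_det_mul u.1.2 u.2.2))
    (fun g u => (pgl_nat g _ _).trans (pgl_congr _ Matrix.map_mul))
    (fun {T} u u' h => pgl_eq_of_cross _ _ (cross_mul
      (cross_of_pgl_eq (h := u.1.2) (h' := u'.1.2)
        (by have := congr_arg (· ≫ fst _ _) h; simpa [Pres.prod, pglPres] using this))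
      (cross_of_pgl_eq (h := u.2.2) (h' := u'.2.2)
        (by have := congr_arg (· ≫ snd _ _) h; simpa [Pres.prod, pglPres] using this))))
  exact ⟨m, fun a b ha hb => hm (⟨a, ha⟩, ⟨b, hb⟩)⟩

/-- Multiplication `([a], [b]) ↦ [a b]` of `PGL₂`. -/
noncomputable def pglMul (k : Type u) [CommRing k] : PGL2 k ⊗ PGL2 k ⟶ PGL2 k :=
  (pglMul_exists k).choose

theorem lift_pglMul {T : Over (Spec (CommRingCat.of k))}
    (a b : Matrix (Fin 2) (Fin 2) (O T)) (ha : IsUnit a.det) (hb : IsUnit b.det) :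
    lift (pgl a ha) (pgl b hb) ≫ pglMul k = pgl (a * b) (isUnit_det_mul ha hb) :=
  (pglMul_exists k).choose_spec a b ha hb

theorem pglInv_exists (k : Type u) [CommRing k] :
    ∃ m : PGL2 k ⟶ PGL2 k, ∀ {T : Over (Spec (CommRingCat.of k))}
      (a : Matrix (Fin 2) (Fin 2) (O T)) (ha : IsUnit a.det),
      pgl a ha ≫ m = pgl a.adjugate (isUnit_det_adjugate ha) := by
  obtain ⟨m, hm⟩ := (pglPres k).exists_desc (W := PGL2 k)
    (fun u => pgl u.1.adjugate (isUnit_det_adjugate u.2))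
    (fun g u => (pgl_nat g _ _).trans (pgl_congr _ (RingHom.map_adjugate (res g) u.1)))
    (fun u u' h => pgl_eq_of_cross _ _ (cross_adjugate (cross_of_pgl_eq (h := u.2) (h' := u'.2) h)))
  exact ⟨m, fun a ha => hm ⟨a, ha⟩⟩

/-- Inversion `[a] ↦ [a]⁻¹ = [adj a]` of `PGL₂`. -/
noncomputable def pglInv (k : Type u) [CommRing k] : PGL2 k ⟶ PGL2 k :=
  (pglInv_exists k).choose

theorem pgl_pglInv {T : Over (Spec (CommRingCat.of k))}
    (a : Matrix (Fin 2) (Fin 2) (O T)) (ha : IsUnit a.det) :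
    pgl a ha ≫ pglInv k = pgl a.adjugate (isUnit_det_adjugate ha) :=
  (pglInv_exists k).choose_spec a ha

/-- The neutral element of `PGL₂`. -/
noncomputable def pglOne (k : Type u) [CommRing k] : 𝟙_ (Over (Spec (CommRingCat.of k))) ⟶ PGL2 k :=
  pgl 1 isUnit_det_one

theorem toUnit_pglOne (T : Over (Spec (CommRingCat.of k))) :
    toUnit T ≫ pglOne k = pgl 1 isUnit_det_one :=
  (pgl_nat _ _ _).trans (pgl_congr _ (Matrix.map_one _ (map_zero _) (map_one _)))

theorem pgl_adjugate_mul {T : Over (Spec (CommRingCat.of k))}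
    (a : Matrix (Fin 2) (Fin 2) (O T)) (h) : pgl (a.adjugate * a) h = pgl 1 isUnit_det_one := by
  apply pgl_eq_of_cross
  intro i j l m
  rw [Matrix.adjugate_mul]
  simp only [Matrix.smul_apply, smul_eq_mul]
  ring

theorem pgl_mul_adjugate {T : Over (Spec (CommRingCat.of k))}
    (a : Matrix (Fin 2) (Fin 2) (O T)) (h) : pgl (a * a.adjugate) h = pgl 1 isUnit_det_one := by
  apply pgl_eq_of_cross
  intro i j l m
  rw [Matrix.mul_adjugate]
  simp only [Matrix.smul_apply, smul_eq_mul]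
  ring

theorem pglMul_assoc {T : Over (Spec (CommRingCat.of k))} (a b c : T ⟶ PGL2 k) :
    lift (lift a b ≫ pglMul k) c ≫ pglMul k = lift a (lift b c ≫ pglMul k) ≫ pglMul k := by
  have key : ∀ {T : Over (Spec (CommRingCat.of k))} (a b c : Matrix (Fin 2) (Fin 2) (O T))
      (ha : IsUnit a.det) (hb : IsUnit b.det) (hc : IsUnit c.det),
      lift (lift (pgl a ha) (pgl b hb) ≫ pglMul k) (pgl c hc) ≫ pglMul k =
        lift (pgl a ha) (lift (pgl b hb) (pgl c hc) ≫ pglMul k) ≫ pglMul k := by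
    intro T a b c ha hb hc
    rw [lift_pglMul, lift_pglMul, lift_pglMul, lift_pglMul]
    exact pgl_congr _ (Matrix.mul_assoc _ _ _)
  refine (pglPres k).ext a _ _ fun g u hu => ?_
  refine (pglPres k).ext (g ≫ b) _ _ fun g' v hv => ?_
  refine (pglPres k).ext (g' ≫ g ≫ c) _ _ fun g'' w hw => ?_
  have hu' : g'' ≫ g' ≫ g ≫ a = pgl ((u.1.map (res g')).map (res g''))
      (isUnit_det_map (res g'') (isUnit_det_map (res g') u.2)) := by
    have h : g ≫ a = pgl u.1 u.2 := hu
    rw [h, pgl_nat, pgl_nat]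
  have hv' : g'' ≫ g' ≫ g ≫ b = pgl (v.1.map (res g'')) (isUnit_det_map (res g'') v.2) := by
    have h : g' ≫ g ≫ b = pgl v.1 v.2 := hv
    rw [h, pgl_nat]
  have hw' : g'' ≫ g' ≫ g ≫ c = pgl w.1 w.2 := hw
  simp only [comp_lift_assoc]
  rw [hu', hv', hw']
  exact key _ _ _ _ _ _

/-- The group scheme `PGL₂`. -/
noncomputable instance pglGrp (k : Type u) [CommRing k] : GrpObj (PGL2 k) :=
  grpObjOfPoints (PGL2 k) (pglOne k) (pglMul k) (pglInv k)
    (by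
      intro T a
      refine (pglPres k).ext a _ _ fun g u hu => ?_
      have hu' : g ≫ a = pgl u.1 u.2 := hu
      rw [comp_lift_assoc, hu', ← Category.assoc, toUnit_unique (g ≫ toUnit _) (toUnit _),
        toUnit_pglOne, lift_pglMul]
      exact pgl_congr _ (one_mul _))
    (by
      intro T a
      refine (pglPres k).ext a _ _ fun g u hu => ?_
      have hu' : g ≫ a = pgl u.1 u.2 := hu
      rw [comp_lift_assoc, hu', ← Category.assoc, toUnit_unique (g ≫ toUnit _) (toUnit _),
        toUnit_pglOne, lift_pglMul]
      exact pgl_congr _ (mul_one _))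
    (by
      intro T a b c
      exact pglMul_assoc a b c)
    (by
      intro T a
      refine (pglPres k).ext a _ _ fun g u hu => ?_
      have hu' : g ≫ a = pgl u.1 u.2 := hu
      rw [comp_lift_assoc, ← Category.assoc, hu', ← Category.assoc,
        toUnit_unique (g ≫ toUnit _) (toUnit _), toUnit_pglOne, pgl_pglInv, lift_pglMul]
      exact pgl_adjugate_mul _ _)
    (by
      intro T a
      refine (pglPres k).ext a _ _ fun g u hu => ?_
      have hu' : g ≫ a = pgl u.1 u.2 := hu
      rw [comp_lift_assoc, ← Category.assoc, hu', ← Category.assoc,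
        toUnit_unique (g ≫ toUnit _) (toUnit _), toUnit_pglOne, pgl_pglInv, lift_pglMul]
      exact pgl_mul_adjugate _ _)

theorem pgl_mul_pgl {T : Over (Spec (CommRingCat.of k))}
    (a b : Matrix (Fin 2) (Fin 2) (O T)) (ha : IsUnit a.det) (hb : IsUnit b.det) :
    pgl a ha * pgl b hb = pgl (a * b) (isUnit_det_mul ha hb) :=
  lift_pglMul a b ha hb

theorem one_eq_pgl {T : Over (Spec (CommRingCat.of k))} :
    (1 : T ⟶ PGL2 k) = pgl 1 isUnit_det_one :=
  toUnit_pglOne T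

/-- The projective line. -/
noncomputable abbrev P1 (k : Type u) [CommRing k] : Over (Spec (CommRingCat.of k)) := Pr k (Fin 2)

theorem pglSmul_exists (k : Type u) [CommRing k] :
    ∃ m : PGL2 k ⊗ P1 k ⟶ P1 k, ∀ {T : Over (Spec (CommRingCat.of k))}
      (a : Matrix (Fin 2) (Fin 2) (O T)) (ha : IsUnit a.det) (u : Fin 2 → O T) (hu : Unimodular u),
      lift (pgl a ha) (pt u hu) ≫ m = pt (a *ᵥ u) (unimodular_mulVec ha hu) := by
  obtain ⟨m, hm⟩ := ((pglPres k).prod (prPres k (Fin 2))).exists_desc (W := P1 k)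
    (fun u => pt (u.1.1 *ᵥ u.2.1) (unimodular_mulVec u.1.2 u.2.2))
    (fun g u => (pt_nat g _).trans (pt_congr (funext fun i => RingHom.map_mulVec (res g) u.1.1 u.2.1 i) _))
    (fun {T} u u' h => pt_eq_of_cross _ _ (cross_mulVec
      (cross_of_pgl_eq (h := u.1.2) (h' := u'.1.2)
        (by have := congr_arg (· ≫ fst _ _) h; simpa [Pres.prod, pglPres] using this))
      (cross_of_pt_eq u.2.2 u'.2.2
        (by have := congr_arg (· ≫ snd _ _) h; simpa [Pres.prod, prPres] using this))))
  exact ⟨m, fun a ha u hu => hm (⟨a, ha⟩, ⟨u, hu⟩)⟩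

/-- The action `([a], [u]) ↦ [a u]` of `PGL₂` on the projective line. -/
noncomputable def pglSmul (k : Type u) [CommRing k] : PGL2 k ⊗ P1 k ⟶ P1 k :=
  (pglSmul_exists k).choose

theorem lift_pglSmul {T : Over (Spec (CommRingCat.of k))}
    (a : Matrix (Fin 2) (Fin 2) (O T)) (ha : IsUnit a.det) (u : Fin 2 → O T) (hu : Unimodular u) :
    lift (pgl a ha) (pt u hu) ≫ pglSmul k = pt (a *ᵥ u) (unimodular_mulVec ha hu) :=
  (pglSmul_exists k).choose_spec a ha u hu

theorem pglSmul_assoc {T : Over (Spec (CommRingCat.of k))} (a b : T ⟶ PGL2 k) (x : T ⟶ P1 k) :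
    lift (a * b) x ≫ pglSmul k = lift a (lift b x ≫ pglSmul k) ≫ pglSmul k := by
  have key : ∀ {T : Over (Spec (CommRingCat.of k))} (a b : Matrix (Fin 2) (Fin 2) (O T))
      (ha : IsUnit a.det) (hb : IsUnit b.det) (u : Fin 2 → O T) (hu : Unimodular u),
      lift (pgl a ha * pgl b hb) (pt u hu) ≫ pglSmul k =
        lift (pgl a ha) (lift (pgl b hb) (pt u hu) ≫ pglSmul k) ≫ pglSmul k := by
    intro T a b ha hb u hu
    rw [pgl_mul_pgl, lift_pglSmul, lift_pglSmul, lift_pglSmul]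
    exact pt_congr (Matrix.mulVec_mulVec _ _ _).symm _
  refine (pglPres k).ext a _ _ fun g u hu => ?_
  refine (pglPres k).ext (g ≫ b) _ _ fun g' v hv => ?_
  refine (prPres k (Fin 2)).ext (g' ≫ g ≫ x) _ _ fun g'' w hw => ?_
  have hu' : g'' ≫ g' ≫ g ≫ a = pgl ((u.1.map (res g')).map (res g''))
      (isUnit_det_map (res g'') (isUnit_det_map (res g') u.2)) := by
    have h : g ≫ a = pgl u.1 u.2 := hu
    rw [h, pgl_nat, pgl_nat]
  have hv' : g'' ≫ g' ≫ g ≫ b = pgl (v.1.map (res g'')) (isUnit_det_map (res g'') v.2) := by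
    have h : g' ≫ g ≫ b = pgl v.1 v.2 := hv
    rw [h, pgl_nat]
  have hw' : g'' ≫ g' ≫ g ≫ x = pt w.1 w.2 := hw
  simp only [comp_lift_assoc, MonObj.comp_mul]
  rw [hu', hv', hw']
  exact key _ _ _ _ _ _

noncomputable instance pglMod (k : Type u) [CommRing k] : ModObj (PGL2 k) (P1 k) :=
  modObjOfPoints (PGL2 k) (P1 k) (pglSmul k)
    (by
      intro T x
      refine (prPres k (Fin 2)).ext x _ _ fun g u hu => ?_
      have hu' : g ≫ x = pt u.1 u.2 := hu
      rw [comp_lift_assoc, hu', one_eq_pgl, pgl_nat,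
        pgl_congr _ (Matrix.map_one _ (map_zero (res g)) (map_one (res g))), lift_pglSmul]
      exact pt_congr (Matrix.one_mulVec _) _)
    (by
      intro T a b x
      exact pglSmul_assoc a b x)

theorem pgl_smul_pt {T : Over (Spec (CommRingCat.of k))}
    (a : Matrix (Fin 2) (Fin 2) (O T)) (ha : IsUnit a.det) (u : Fin 2 → O T) (hu : Unimodular u) :
    pgl a ha • pt u hu = pt (a *ᵥ u) (unimodular_mulVec ha hu) :=
  lift_pglSmul a ha u hu

end PGLAction

section Diagonal

variable {C : Type u} [Category.{v} C] [CartesianMonoidalCategory C]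

/-- The diagonal action of `G` on a product. -/
@[reducible] noncomputable def diagMod (G : C) [GrpObj G] (X Y : C) [ModObj G X] [ModObj G Y] :
    ModObj G (X ⊗ Y) :=
  modObjOfPoints G (X ⊗ Y)
    (lift (fst G (X ⊗ Y) • (snd G (X ⊗ Y) ≫ fst X Y)) (fst G (X ⊗ Y) • (snd G (X ⊗ Y) ≫ snd X Y)))
    (by intro T x
        ext <;> simp [ModObj.comp_smul])
    (by intro T a b x
        ext <;> simp [ModObj.comp_smul, mul_smul])

theorem diag_smul_lift (G : C) [GrpObj G] (X Y : C) [ModObj G X] [ModObj G Y] {T : C} (a : T ⟶ G)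
    (x : T ⟶ X) (y : T ⟶ Y) : let _ := diagMod G X Y; a • lift x y = lift (a • x) (a • y) := by
  let _ := diagMod G X Y
  change lift a (lift x y) ≫ lift _ _ = _
  ext <;> simp [ModObj.comp_smul]

end Diagonal

section Target

noncomputable instance pglDiag (k : Type u) [CommRing k] : ModObj (PGL2 k) (P1 k ⊗ P1 k) :=
  diagMod (PGL2 k) (P1 k) (P1 k)

/-- The action groupoid of the diagonal action of `PGL₂` on `ℙ¹ × ℙ¹`. -/
noncomputable def pglGroupoid (k : Type u) [CommRing k] :
    GroupoidObj (Over (Spec (CommRingCat.of k))) :=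
  actionGroupoid (PGL2 k) (P1 k ⊗ P1 k)

end Target

section Affine

variable {k : Type u} [CommRing k]

/-- The spectrum of a `k`-algebra as a scheme over `k`. -/
noncomputable def Aff (k : Type u) [CommRing k] (A : Type u) [CommRing A] [Algebra k A] :
    Over (Spec (CommRingCat.of k)) :=
  Over.mk (Spec.map (CommRingCat.ofHom (algebraMap k A)))

variable {A : Type u} [CommRing A] [Algebra k A] {T T' : Over (Spec (CommRingCat.of k))}

/-- The morphism `T ⟶ Spec A` over `k` given by a homomorphism of `k`-algebras `A → O T`. -/
noncomputable def affMk (φ : A →+* O T) (h : φ.comp (algebraMap k A) = str T) : T ⟶ Aff k A :=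
  Over.homMk (specMk φ) ((specMk_map φ (algebraMap k A)).trans (h ▸ specMk_str))

/-- The homomorphism `A → O T` given by a morphism `T ⟶ Spec A`. -/
noncomputable def affHom (z : T ⟶ Aff k A) : A →+* O T := specHom z.left

theorem affHom_affMk (φ : A →+* O T) (h : φ.comp (algebraMap k A) = str T) :
    affHom (affMk φ h) = φ :=
  specHom_specMk φ

theorem affHom_injective {z z' : T ⟶ Aff k A} (h : affHom z = affHom z') : z = z' := by
  ext1
  have h₁ : specMk (affHom z) = z.left := specMk_specHom _
  have h₂ : specMk (affHom z') = z'.left := specMk_specHom _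
  rw [← h₁, ← h₂, h]

theorem affHom_comp (g : T' ⟶ T) (z : T ⟶ Aff k A) : affHom (g ≫ z) = (res g).comp (affHom z) := by
  have h₁ : specMk (affHom z) = z.left := specMk_specHom _
  have h₂ : affHom (g ≫ z) = specHom (g.left ≫ z.left) := rfl
  rw [h₂, ← h₁, comp_specMk, specHom_specMk]

theorem affHom_algebraMap (z : T ⟶ Aff k A) : (affHom z).comp (algebraMap k A) = str T := by
  have h₁ : specMk (affHom z) = z.left := specMk_specHom _
  have h₂ : specMk ((affHom z).comp (algebraMap k A)) = specMk (str T) := by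
    rw [← specMk_map, h₁, specMk_str]
    exact Over.w z
  simpa only [specHom_specMk] using congr_arg (fun z => specHom z) h₂

/-- The affine line `Spec k[x]`. -/
noncomputable def A1 (k : Type u) [CommRing k] : Over (Spec (CommRingCat.of k)) :=
  Aff k (Polynomial k)

/-- The point of the affine line with coordinate `x`. -/
noncomputable def A1.mk (x : O T) : T ⟶ A1 k :=
  affMk (Polynomial.eval₂RingHom (str T) x) (by ext c; simp)

/-- The coordinate of a point of the affine line. -/
noncomputable def A1.x (z : T ⟶ A1 k) : O T := affHom (A := Polynomial k) z Polynomial.X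

theorem A1.x_mk (x : O T) : A1.x (A1.mk x) = x := by
  rw [A1.x, A1.mk, affHom_affMk]
  simp

theorem A1.x_comp (g : T' ⟶ T) (z : T ⟶ A1 k) : A1.x (g ≫ z) = res g (A1.x z) := by
  exact RingHom.congr_fun (affHom_comp (A := Polynomial k) g z) _

theorem A1.ext {z z' : T ⟶ A1 k} (h : A1.x z = A1.x z') : z = z' := by
  apply affHom_injective (A := Polynomial k)
  apply Polynomial.ringHom_ext
  · intro c
    have h₁ := RingHom.congr_fun (affHom_algebraMap (A := Polynomial k) z) c
    have h₂ := RingHom.congr_fun (affHom_algebraMap (A := Polynomial k) z') c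
    exact h₁.trans h₂.symm
  · exact h

/-- The multiplicative group `Spec k[t, t⁻¹]`. -/
noncomputable def Gm (k : Type u) [CommRing k] : Over (Spec (CommRingCat.of k)) :=
  Aff k (LaurentPolynomial k)

/-- The point of the multiplicative group with coordinate `t`. -/
noncomputable def Gm.mk (t : (O T)ˣ) : T ⟶ Gm k :=
  affMk (LaurentPolynomial.eval₂ (str T) t) (by
    ext c
    exact LaurentPolynomial.eval₂_C (str T) t c)

/-- The invertible function `t` on `Spec k[t, t⁻¹]`. -/
noncomputable def laurentT (k : Type u) [CommRing k] : (LaurentPolynomial k)ˣ where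
  val := LaurentPolynomial.T 1
  inv := LaurentPolynomial.T (-1)
  val_inv := by rw [← LaurentPolynomial.T_add]; simp
  inv_val := by rw [← LaurentPolynomial.T_add]; simp

/-- The coordinate of a point of the multiplicative group. -/
noncomputable def Gm.t (z : T ⟶ Gm k) : (O T)ˣ :=
  Units.map (affHom (A := LaurentPolynomial k) z : LaurentPolynomial k →* O T) (laurentT k)

theorem Gm.t_mk (t : (O T)ˣ) : Gm.t (Gm.mk t) = t := by
  apply Units.ext
  rw [Gm.t, Gm.mk]
  simp only [Units.coe_map, MonoidHom.coe_coe]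
  have := affHom_affMk (LaurentPolynomial.eval₂ (str T) t) (by
    ext c
    exact LaurentPolynomial.eval₂_C (str T) t c)
  refine (RingHom.congr_fun this _).trans ?_
  exact (LaurentPolynomial.eval₂_T (str T) t 1).trans (by simp)

theorem Gm.t_comp (g : T' ⟶ T) (z : T ⟶ Gm k) :
    Gm.t (g ≫ z) = Units.map (res g : O T →* O T') (Gm.t z) := by
  apply Units.ext
  exact RingHom.congr_fun (affHom_comp (A := LaurentPolynomial k) g z) _

theorem laurent_hom_ext {R : Type u} [CommRing R] (φ ψ : LaurentPolynomial k →+* R)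
    (hC : ∀ c, φ (LaurentPolynomial.C c) = ψ (LaurentPolynomial.C c))
    (hT : φ (LaurentPolynomial.T 1) = ψ (LaurentPolynomial.T 1))
    (hT' : φ (LaurentPolynomial.T (-1)) = ψ (LaurentPolynomial.T (-1))) : φ = ψ := by
  refine RingHom.ext fun p => ?_
  induction p using LaurentPolynomial.induction_on with
  | h_C a => exact hC a
  | h_add hp hq => rw [map_add, map_add, hp, hq]
  | h_C_mul_T n a hp =>
    rw [LaurentPolynomial.T_add, ← mul_assoc, map_mul φ, map_mul ψ, hp, hT]
  | h_C_mul_T_Z n a hp =>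
    rw [sub_eq_add_neg, LaurentPolynomial.T_add, ← mul_assoc, map_mul φ, map_mul ψ, hp, hT']

theorem Gm.ext {z z' : T ⟶ Gm k} (h : Gm.t z = Gm.t z') : z = z' := by
  apply affHom_injective (A := LaurentPolynomial k)
  have hC : ∀ c, affHom (A := LaurentPolynomial k) z (LaurentPolynomial.C c) =
      affHom (A := LaurentPolynomial k) z' (LaurentPolynomial.C c) := by
    intro c
    have h₁ := RingHom.congr_fun (affHom_algebraMap (A := LaurentPolynomial k) z) c
    have h₂ := RingHom.congr_fun (affHom_algebraMap (A := LaurentPolynomial k) z') c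
    exact h₁.trans h₂.symm
  have hT : affHom (A := LaurentPolynomial k) z (LaurentPolynomial.T 1) =
      affHom (A := LaurentPolynomial k) z' (LaurentPolynomial.T 1) := congr_arg Units.val h
  have hT' : affHom (A := LaurentPolynomial k) z (LaurentPolynomial.T (-1)) =
      affHom (A := LaurentPolynomial k) z' (LaurentPolynomial.T (-1)) :=
    congr_arg (fun u : (O T)ˣ => (u⁻¹).val) h
  exact laurent_hom_ext _ _ hC hT hT'

/-- The ideal of `k[γ, δ, x, ε]` generated by `γ x + δ - 1` and `δ ε - 1`; the variables are numbered
in this order. -/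
noncomputable def n1Ideal (k : Type u) [CommRing k] : Ideal (MvPolynomial (Fin 4) k) :=
  Ideal.span {MvPolynomial.X 0 * MvPolynomial.X 2 + MvPolynomial.X 1 - 1,
    MvPolynomial.X 1 * MvPolynomial.X 3 - 1}

/-- The ring `k[γ, δ, x, δ⁻¹] / (γ x + δ - 1)`. -/
abbrev N1Ring (k : Type u) [CommRing k] : Type u := MvPolynomial (Fin 4) k ⧸ n1Ideal k

/-- The scheme `Spec k[γ, δ, x, δ⁻¹] / (γ x + δ - 1)`. -/
noncomputable def N1 (k : Type u) [CommRing k] : Over (Spec (CommRingCat.of k)) := Aff k (N1Ring k)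

theorem n1_relations (k : Type u) [CommRing k] :
    (Ideal.Quotient.mk (n1Ideal k) (MvPolynomial.X 0) * Ideal.Quotient.mk (n1Ideal k) (MvPolynomial.X 2) +
      Ideal.Quotient.mk (n1Ideal k) (MvPolynomial.X 1) = 1) ∧
    Ideal.Quotient.mk (n1Ideal k) (MvPolynomial.X 1) *
      Ideal.Quotient.mk (n1Ideal k) (MvPolynomial.X 3) = 1 := by
  constructor
  · rw [← map_mul, ← map_add, ← map_one (Ideal.Quotient.mk (n1Ideal k)), Ideal.Quotient.eq]
    exact Ideal.subset_span (Or.inl rfl)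
  · rw [← map_mul, ← map_one (Ideal.Quotient.mk (n1Ideal k)), Ideal.Quotient.eq]
    exact Ideal.subset_span (Or.inr rfl)

theorem n1_lift_zero (gam x : O T) (del : (O T)ˣ) (h : gam * x + del = 1) (a : MvPolynomial (Fin 4) k)
    (ha : a ∈ n1Ideal k) : MvPolynomial.eval₂Hom (str T) ![gam, del, x, ↑del⁻¹] a = 0 := by
  have : n1Ideal k ≤ RingHom.ker (MvPolynomial.eval₂Hom (str T) ![gam, del, x, ↑del⁻¹]) := by
    rw [n1Ideal, Ideal.span_le]
    rintro b (rfl | rfl)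
    · simp [RingHom.mem_ker, h]
    · simp [RingHom.mem_ker]
  exact this ha

/-- The point of `N₁` with coordinates `γ, δ, x`. -/
noncomputable def N1.mk (gam : O T) (del : (O T)ˣ) (x : O T) (h : gam * x + del = 1) : T ⟶ N1 k :=
  affMk (A := N1Ring k) (Ideal.Quotient.lift (n1Ideal k)
    (MvPolynomial.eval₂Hom (str T) ![gam, del, x, ↑del⁻¹]) (n1_lift_zero gam x del h)) (by
      ext c
      exact MvPolynomial.eval₂_C _ _ c)

/-- The value of the `i`-th coordinate of `N₁` at a point. -/
noncomputable def N1.co (z : T ⟶ N1 k) (i : Fin 4) : O T :=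
  affHom (A := N1Ring k) z (Ideal.Quotient.mk (n1Ideal k) (MvPolynomial.X i))

/-- The coordinate `γ` of a point of `N₁`. -/
noncomputable def N1.gam (z : T ⟶ N1 k) : O T := N1.co z 0

/-- The coordinate `x` of a point of `N₁`. -/
noncomputable def N1.x (z : T ⟶ N1 k) : O T := N1.co z 2

theorem N1.co_rel (z : T ⟶ N1 k) : N1.co z 1 * N1.co z 3 = 1 := by
  rw [N1.co, N1.co, ← map_mul, (n1_relations k).2, map_one]

/-- The coordinate `δ` of a point of `N₁`. -/
noncomputable def N1.del (z : T ⟶ N1 k) : (O T)ˣ where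
  val := N1.co z 1
  inv := N1.co z 3
  val_inv := N1.co_rel z
  inv_val := by rw [mul_comm, N1.co_rel]

theorem N1.rel (z : T ⟶ N1 k) : N1.gam z * N1.x z + N1.del z = 1 := by
  have h := congr_arg (affHom (A := N1Ring k) z) (n1_relations k).1
  rw [map_add, map_mul, map_one] at h
  exact h

theorem N1.co_mk (gam : O T) (del : (O T)ˣ) (x : O T) (h : gam * x + del = 1) (i : Fin 4) :
    N1.co (N1.mk gam del x h) i = ![gam, ↑del, x, ↑del⁻¹] i := by
  rw [N1.co, N1.mk]
  refine (RingHom.congr_fun (affHom_affMk (A := N1Ring k) _ _) _).trans ?_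
  rw [Ideal.Quotient.lift_mk]
  exact MvPolynomial.eval₂_X _ _ i

theorem N1.gam_mk (gam : O T) (del : (O T)ˣ) (x : O T) (h : gam * x + del = 1) :
    N1.gam (N1.mk gam del x h) = gam := N1.co_mk gam del x h 0

theorem N1.x_mk (gam : O T) (del : (O T)ˣ) (x : O T) (h : gam * x + del = 1) :
    N1.x (N1.mk gam del x h) = x := N1.co_mk gam del x h 2

theorem N1.del_mk (gam : O T) (del : (O T)ˣ) (x : O T) (h : gam * x + del = 1) :
    N1.del (N1.mk gam del x h) = del := Units.ext (N1.co_mk gam del x h 1)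

theorem N1.co_comp (g : T' ⟶ T) (z : T ⟶ N1 k) (i : Fin 4) :
    N1.co (g ≫ z) i = res g (N1.co z i) := by
  exact RingHom.congr_fun (affHom_comp (A := N1Ring k) g z) _

theorem N1.gam_comp (g : T' ⟶ T) (z : T ⟶ N1 k) : N1.gam (g ≫ z) = res g (N1.gam z) := N1.co_comp g z 0

theorem N1.x_comp (g : T' ⟶ T) (z : T ⟶ N1 k) : N1.x (g ≫ z) = res g (N1.x z) := N1.co_comp g z 2

theorem N1.del_comp (g : T' ⟶ T) (z : T ⟶ N1 k) :
    N1.del (g ≫ z) = Units.map (res g : O T →* O T') (N1.del z) :=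
  Units.ext (N1.co_comp g z 1)

theorem N1.ext {z z' : T ⟶ N1 k} (h₁ : N1.gam z = N1.gam z') (h₂ : N1.del z = N1.del z')
    (h₃ : N1.x z = N1.x z') : z = z' := by
  apply affHom_injective (A := N1Ring k)
  apply Ideal.Quotient.ringHom_ext
  apply MvPolynomial.ringHom_ext
  · intro c
    have h₁ := RingHom.congr_fun (affHom_algebraMap (A := N1Ring k) z) c
    have h₂ := RingHom.congr_fun (affHom_algebraMap (A := N1Ring k) z') c
    exact h₁.trans h₂.symm
  · intro i
    change N1.co z i = N1.co z' i
    fin_cases i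
    · exact h₁
    · exact congr_arg Units.val h₂
    · exact h₃
    · exact congr_arg (fun u : (O T)ˣ => (u⁻¹).val) h₂

end Affine

section Source

variable {k : Type u} [CommRing k] {T T' : Over (Spec (CommRingCat.of k))}

/-- Pullback of invertible functions. -/
noncomputable abbrev resU (g : T' ⟶ T) : (O T)ˣ →* (O T')ˣ := Units.map (res g : O T →* O T')

theorem Gm.comp_mk (g : T' ⟶ T) (t : (O T)ˣ) : g ≫ Gm.mk t = Gm.mk (k := k) (resU g t) :=
  Gm.ext (by rw [Gm.t_comp, Gm.t_mk, Gm.t_mk])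

theorem A1.comp_mk (g : T' ⟶ T) (x : O T) : g ≫ A1.mk x = A1.mk (res g x) :=
  A1.ext (by rw [A1.x_comp, A1.x_mk, A1.x_mk])

theorem lift_gmMul (a b : T ⟶ Gm k) :
    lift a b ≫ Gm.mk (Gm.t (fst (Gm k) (Gm k)) * Gm.t (snd (Gm k) (Gm k))) =
      Gm.mk (Gm.t a * Gm.t b) := by
  rw [Gm.comp_mk, map_mul, ← Gm.t_comp, ← Gm.t_comp, lift_fst, lift_snd]

theorem gm_inv (a : T ⟶ Gm k) : a ≫ Gm.mk (Gm.t (𝟙 (Gm k)))⁻¹ = Gm.mk (Gm.t a)⁻¹ := by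
  rw [Gm.comp_mk, map_inv, ← Gm.t_comp, Category.comp_id]

theorem gm_one : toUnit T ≫ Gm.mk (k := k) 1 = Gm.mk 1 := by
  rw [Gm.comp_mk, map_one]

/-- The group scheme `𝔾ₘ`. -/
noncomputable instance gmGrp (k : Type u) [CommRing k] : GrpObj (Gm k) :=
  grpObjOfPoints (Gm k) (Gm.mk 1) (Gm.mk (Gm.t (fst (Gm k) (Gm k)) * Gm.t (snd (Gm k) (Gm k))))
    (Gm.mk (Gm.t (𝟙 (Gm k)))⁻¹)
    (by intro T a
        apply Gm.ext
        rw [gm_one, lift_gmMul, Gm.t_mk, Gm.t_mk, one_mul])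
    (by intro T a
        apply Gm.ext
        rw [gm_one, lift_gmMul, Gm.t_mk, Gm.t_mk, mul_one])
    (by intro T a b c
        apply Gm.ext
        simp only [lift_gmMul, Gm.t_mk, mul_assoc])
    (by intro T a
        apply Gm.ext
        rw [gm_one, gm_inv, lift_gmMul, Gm.t_mk, Gm.t_mk, Gm.t_mk, inv_mul_cancel])
    (by intro T a
        apply Gm.ext
        rw [gm_one, gm_inv, lift_gmMul, Gm.t_mk, Gm.t_mk, Gm.t_mk, mul_inv_cancel])

theorem Gm.t_mul (a b : T ⟶ Gm k) : Gm.t (a * b) = Gm.t a * Gm.t b :=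
  (congr_arg Gm.t (lift_gmMul a b)).trans (Gm.t_mk _)

theorem Gm.t_one : Gm.t (1 : T ⟶ Gm k) = 1 :=
  (congr_arg Gm.t (gm_one (T := T) (k := k))).trans (Gm.t_mk _)

theorem Gm.t_inv (a : T ⟶ Gm k) : Gm.t a⁻¹ = (Gm.t a)⁻¹ := by
  rw [eq_inv_iff_mul_eq_one, ← Gm.t_mul, inv_mul_cancel, Gm.t_one]

/-- The action `(t, x) ↦ t x` of `𝔾ₘ` on the affine line. -/
noncomputable def gmSmulA1 (k : Type u) [CommRing k] : Gm k ⊗ A1 k ⟶ A1 k :=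
  A1.mk ((Gm.t (fst (Gm k) (A1 k))).val * A1.x (snd (Gm k) (A1 k)))

theorem lift_gmSmulA1 (a : T ⟶ Gm k) (x : T ⟶ A1 k) :
    lift a x ≫ gmSmulA1 k = A1.mk ((Gm.t a).val * A1.x x) := by
  apply A1.ext
  rw [gmSmulA1, A1.comp_mk, map_mul, ← A1.x_comp, lift_snd]
  have h := congr_arg Units.val (Gm.t_comp (lift a x) (fst (Gm k) (A1 k)))
  rw [lift_fst] at h
  rw [h]
  rfl

noncomputable instance gmModA1 (k : Type u) [CommRing k] : ModObj (Gm k) (A1 k) :=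
  modObjOfPoints (Gm k) (A1 k) (gmSmulA1 k)
    (by intro T x
        apply A1.ext
        rw [lift_gmSmulA1, A1.x_mk, Gm.t_one, Units.val_one, one_mul])
    (by intro T a b x
        apply A1.ext
        rw [lift_gmSmulA1, lift_gmSmulA1, lift_gmSmulA1, A1.x_mk, A1.x_mk, A1.x_mk, Gm.t_mul,
          Units.val_mul, mul_assoc])

theorem A1.x_smul (a : T ⟶ Gm k) (x : T ⟶ A1 k) : A1.x (a • x) = (Gm.t a).val * A1.x x :=
  (congr_arg A1.x (lift_gmSmulA1 a x)).trans (A1.x_mk _)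

theorem n1_smul_rel (t δ : (O T)ˣ) (c x : O T) (h : c * x + δ.val = 1) :
    (t⁻¹.val * c) * (t.val * x) + δ.val = 1 := by
  rw [← h]
  linear_combination c * x * t.inv_mul

/-- The action `(t, (γ, δ, x)) ↦ (t⁻¹ γ, δ, t x)` of `𝔾ₘ` on `N₁`. -/
noncomputable def gmSmulN1 (k : Type u) [CommRing k] : Gm k ⊗ N1 k ⟶ N1 k :=
  N1.mk ((Gm.t (fst (Gm k) (N1 k)))⁻¹.val * N1.gam (snd (Gm k) (N1 k))) (N1.del (snd (Gm k) (N1 k)))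
    ((Gm.t (fst (Gm k) (N1 k))).val * N1.x (snd (Gm k) (N1 k))) (n1_smul_rel _ _ _ _ (N1.rel _))

theorem lift_gmSmulN1 (a : T ⟶ Gm k) (n : T ⟶ N1 k) :
    lift a n ≫ gmSmulN1 k = N1.mk ((Gm.t a)⁻¹.val * N1.gam n) (N1.del n) ((Gm.t a).val * N1.x n)
      (n1_smul_rel _ _ _ _ (N1.rel _)) := by
  have h := Gm.t_comp (lift a n) (fst (Gm k) (N1 k))
  rw [lift_fst] at h
  have h' : ((Gm.t a)⁻¹).val = res (lift a n) ((Gm.t (fst (Gm k) (N1 k)))⁻¹).val := by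
    rw [h, ← map_inv]
    rfl
  have h'' : (Gm.t a).val = res (lift a n) (Gm.t (fst (Gm k) (N1 k))).val := by
    rw [h]
    rfl
  apply N1.ext
  · rw [N1.gam_comp, gmSmulN1, N1.gam_mk, N1.gam_mk, map_mul, ← N1.gam_comp, lift_snd, h']
  · rw [N1.del_comp, gmSmulN1, N1.del_mk, N1.del_mk, ← N1.del_comp, lift_snd]
  · rw [N1.x_comp, gmSmulN1, N1.x_mk, N1.x_mk, map_mul, ← N1.x_comp, lift_snd, h'']

noncomputable instance gmModN1 (k : Type u) [CommRing k] : ModObj (Gm k) (N1 k) :=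
  modObjOfPoints (Gm k) (N1 k) (gmSmulN1 k)
    (by intro T x
        apply N1.ext
        · rw [lift_gmSmulN1, N1.gam_mk, Gm.t_one, inv_one, Units.val_one, one_mul]
        · rw [lift_gmSmulN1, N1.del_mk]
        · rw [lift_gmSmulN1, N1.x_mk, Gm.t_one, Units.val_one, one_mul])
    (by intro T a b x
        apply N1.ext
        · rw [lift_gmSmulN1, lift_gmSmulN1, lift_gmSmulN1, N1.gam_mk, N1.gam_mk, N1.gam_mk, Gm.t_mul,
            mul_inv, Units.val_mul, mul_assoc]
        · rw [lift_gmSmulN1, lift_gmSmulN1, lift_gmSmulN1, N1.del_mk, N1.del_mk, N1.del_mk]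
        · rw [lift_gmSmulN1, lift_gmSmulN1, lift_gmSmulN1, N1.x_mk, N1.x_mk, N1.x_mk, Gm.t_mul,
            Units.val_mul, mul_assoc])

theorem N1.gam_smul (a : T ⟶ Gm k) (n : T ⟶ N1 k) : N1.gam (a • n) = (Gm.t a)⁻¹.val * N1.gam n :=
  (congr_arg N1.gam (lift_gmSmulN1 a n)).trans (N1.gam_mk _ _ _ _)

theorem N1.del_smul (a : T ⟶ Gm k) (n : T ⟶ N1 k) : N1.del (a • n) = N1.del n :=
  (congr_arg N1.del (lift_gmSmulN1 a n)).trans (N1.del_mk _ _ _ _)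

theorem N1.x_smul (a : T ⟶ Gm k) (n : T ⟶ N1 k) : N1.x (a • n) = (Gm.t a).val * N1.x n :=
  (congr_arg N1.x (lift_gmSmulN1 a n)).trans (N1.x_mk _ _ _ _)

/-- The projection `(γ, δ, x) ↦ x` of `N₁` to the affine line. -/
noncomputable def n1Proj (k : Type u) [CommRing k] : N1 k ⟶ A1 k := A1.mk (N1.x (𝟙 (N1 k)))

theorem A1.x_n1Proj (n : T ⟶ N1 k) : A1.x (n ≫ n1Proj k) = N1.x n := by
  rw [A1.x_comp, n1Proj, A1.x_mk, ← N1.x_comp, Category.comp_id]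

/-- The neutral section `x ↦ (0, 1, x)` of `N₁`. -/
noncomputable def n1One (k : Type u) [CommRing k] : A1 k ⟶ N1 k :=
  N1.mk 0 1 (A1.x (𝟙 (A1 k))) (by rw [zero_mul, zero_add, Units.val_one])

theorem N1.gam_n1One (x : T ⟶ A1 k) : N1.gam (x ≫ n1One k) = 0 := by
  rw [N1.gam_comp, n1One, N1.gam_mk, map_zero]

theorem N1.del_n1One (x : T ⟶ A1 k) : N1.del (x ≫ n1One k) = 1 := by
  rw [N1.del_comp, n1One, N1.del_mk, map_one]

theorem N1.x_n1One (x : T ⟶ A1 k) : N1.x (x ≫ n1One k) = A1.x x := by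
  rw [N1.x_comp, n1One, N1.x_mk, ← A1.x_comp, Category.comp_id]

theorem n1_inv_rel {R : Type u} [CommRing R] (δ : Rˣ) (c x : R) (h : c * x + δ.val = 1) :
    -(δ⁻¹.val * c) * x + δ⁻¹.val = 1 := by
  linear_combination δ.inv_mul - δ⁻¹.val * h

/-- The inversion `(γ, δ, x) ↦ (-δ⁻¹ γ, δ⁻¹, x)` of `N₁`. -/
noncomputable def n1Inv (k : Type u) [CommRing k] : N1 k ⟶ N1 k :=
  N1.mk (-((N1.del (𝟙 (N1 k)))⁻¹.val * N1.gam (𝟙 (N1 k)))) (N1.del (𝟙 (N1 k)))⁻¹ (N1.x (𝟙 (N1 k)))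
    (n1_inv_rel (N1.del (𝟙 (N1 k))) (N1.gam (𝟙 (N1 k))) (N1.x (𝟙 (N1 k))) (N1.rel (𝟙 (N1 k))))

theorem N1.del_n1Inv (n : T ⟶ N1 k) : N1.del (n ≫ n1Inv k) = (N1.del n)⁻¹ := by
  rw [N1.del_comp, n1Inv, N1.del_mk, map_inv, ← N1.del_comp, Category.comp_id]

theorem N1.gam_n1Inv (n : T ⟶ N1 k) : N1.gam (n ≫ n1Inv k) = -((N1.del n)⁻¹.val * N1.gam n) := by
  have h : ((N1.del n)⁻¹).val = res n ((N1.del (𝟙 (N1 k)))⁻¹).val := by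
    have := N1.del_comp n (𝟙 (N1 k))
    rw [Category.comp_id] at this
    rw [this, ← map_inv]
    rfl
  rw [N1.gam_comp, n1Inv, N1.gam_mk, map_neg, map_mul, ← N1.gam_comp, Category.comp_id, h]

theorem N1.x_n1Inv (n : T ⟶ N1 k) : N1.x (n ≫ n1Inv k) = N1.x n := by
  rw [N1.x_comp, n1Inv, N1.x_mk, ← N1.x_comp, Category.comp_id]

theorem n1_mul_rel {R : Type u} [CommRing R] (δ δ' : Rˣ) (c c' x x' : R) (h : c * x + δ = 1)
    (h' : c' * x' + δ' = 1) (e : x = x') : (c + δ * c') * x' + ↑(δ * δ') = 1 := by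
  subst e
  rw [Units.val_mul]
  linear_combination h + δ * h'

/-- The product `(γ, δ, x) (γ', δ', x) = (γ + δ γ', δ δ', x)` of `N₁`. -/
noncomputable def n1Mul (n n' : T ⟶ N1 k) (h : n ≫ n1Proj k = n' ≫ n1Proj k) : T ⟶ N1 k :=
  N1.mk (N1.gam n + (N1.del n).val * N1.gam n') (N1.del n * N1.del n') (N1.x n')
    (n1_mul_rel _ _ _ _ _ _ (N1.rel n) (N1.rel n') (by rw [← A1.x_n1Proj, h, A1.x_n1Proj]))

theorem N1.gam_n1Mul (n n' : T ⟶ N1 k) (h : n ≫ n1Proj k = n' ≫ n1Proj k) :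
    N1.gam (n1Mul n n' h) = N1.gam n + (N1.del n).val * N1.gam n' := N1.gam_mk _ _ _ _

theorem N1.del_n1Mul (n n' : T ⟶ N1 k) (h : n ≫ n1Proj k = n' ≫ n1Proj k) :
    N1.del (n1Mul n n' h) = N1.del n * N1.del n' := N1.del_mk _ _ _ _

theorem N1.x_n1Mul (n n' : T ⟶ N1 k) (h : n ≫ n1Proj k = n' ≫ n1Proj k) :
    N1.x (n1Mul n n' h) = N1.x n' := N1.x_mk _ _ _ _

theorem N1.x_eq {n n' : T ⟶ N1 k} (h : n ≫ n1Proj k = n' ≫ n1Proj k) : N1.x n = N1.x n' := by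
  rw [← A1.x_n1Proj, h, A1.x_n1Proj]

theorem comp_n1Mul (f : T' ⟶ T) (g h : T ⟶ N1 k) (w : g ≫ n1Proj k = h ≫ n1Proj k) :
    f ≫ n1Mul g h w = n1Mul (f ≫ g) (f ≫ h) (by simp [w]) := by
  apply N1.ext
  · simp only [N1.gam_comp, N1.gam_n1Mul, N1.del_comp, map_add, map_mul]
    rfl
  · simp only [N1.del_comp, N1.del_n1Mul, map_mul]
  · simp only [N1.x_comp, N1.x_n1Mul]

/-- The groupoid with objects the affine line given by the group scheme `N₁` over the affine line. -/
noncomputable def nGroupoid (k : Type u) [CommRing k] :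
    GroupoidObj (Over (Spec (CommRingCat.of k))) :=
  GroupoidObj.ofPoints (A1 k) (N1 k) (n1Proj k) (n1Proj k) (n1One k) (n1Inv k) n1Mul
    comp_n1Mul
    (A1.ext (by rw [A1.x_n1Proj, ← Category.id_comp (n1One k), N1.x_n1One]))
    (A1.ext (by rw [A1.x_n1Proj, ← Category.id_comp (n1One k), N1.x_n1One]))
    (A1.ext (by
      rw [A1.x_n1Proj, ← Category.id_comp (n1Inv k), N1.x_n1Inv, ← A1.x_n1Proj, Category.id_comp]))
    (A1.ext (by
      rw [A1.x_n1Proj, ← Category.id_comp (n1Inv k), N1.x_n1Inv, ← A1.x_n1Proj, Category.id_comp]))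
    (fun g h w => A1.ext (by rw [A1.x_n1Proj, A1.x_n1Proj, N1.x_n1Mul]))
    (fun g h w => A1.ext (by rw [A1.x_n1Proj, A1.x_n1Proj, N1.x_n1Mul, N1.x_eq w]))
    (by intro T g
        apply N1.ext
        · rw [N1.gam_n1Mul, ← Category.assoc, N1.gam_n1One, N1.del_n1One, Units.val_one, one_mul,
            zero_add]
        · rw [N1.del_n1Mul, ← Category.assoc, N1.del_n1One, one_mul]
        · rw [N1.x_n1Mul])
    (by intro T g
        apply N1.ext
        · rw [N1.gam_n1Mul, ← Category.assoc, N1.gam_n1One, mul_zero, add_zero]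
        · rw [N1.del_n1Mul, ← Category.assoc, N1.del_n1One, mul_one]
        · rw [N1.x_n1Mul, ← Category.assoc, N1.x_n1One, A1.x_n1Proj])
    (by intro T g
        apply N1.ext
        · rw [N1.gam_n1Mul, ← Category.assoc, N1.gam_n1One, N1.gam_n1Inv, N1.del_n1Inv,
            neg_add_cancel]
        · rw [N1.del_n1Mul, ← Category.assoc, N1.del_n1One, N1.del_n1Inv, inv_mul_cancel]
        · rw [N1.x_n1Mul, ← Category.assoc, N1.x_n1One, A1.x_n1Proj])
    (by intro T g
        apply N1.ext
        · rw [N1.gam_n1Mul, ← Category.assoc, N1.gam_n1One, N1.gam_n1Inv, mul_neg, ← mul_assoc,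
            Units.mul_inv, one_mul, add_neg_cancel]
        · rw [N1.del_n1Mul, ← Category.assoc, N1.del_n1One, N1.del_n1Inv, mul_inv_cancel]
        · rw [N1.x_n1Mul, ← Category.assoc, N1.x_n1One, A1.x_n1Proj, N1.x_n1Inv])
    (by intro T f g h hfg hgh
        apply N1.ext
        · simp only [N1.gam_n1Mul, N1.del_n1Mul, Units.val_mul]
          ring
        · simp only [N1.del_n1Mul, mul_assoc]
        · simp only [N1.x_n1Mul])

end Source

section Comp

variable {C : Type u} [Category.{v} C] [HasPullbacks C]

theorem GroupoidHom.w_m_of_comp {𝒳 𝒴 : GroupoidObj C} (f₀ : 𝒳.obj ⟶ 𝒴.obj) (f₁ : 𝒳.mor ⟶ 𝒴.mor)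
    (w_s : f₁ ≫ 𝒴.s = 𝒳.s ≫ f₀) (w_t : f₁ ≫ 𝒴.t = 𝒳.t ≫ f₀)
    (H : ∀ {T : C} (g h : T ⟶ 𝒳.mor) (w : g ≫ 𝒳.s = h ≫ 𝒳.t) (w' : (g ≫ f₁) ≫ 𝒴.s = (h ≫ f₁) ≫ 𝒴.t),
      𝒳.comp g h w ≫ f₁ = 𝒴.comp (g ≫ f₁) (h ≫ f₁) w') :
    𝒳.m ≫ f₁ = pullback.map 𝒳.s 𝒳.t 𝒴.s 𝒴.t f₁ f₁ f₀ w_s.symm w_t.symm ≫ 𝒴.m := by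
  have w' : (pullback.fst 𝒳.s 𝒳.t ≫ f₁) ≫ 𝒴.s = (pullback.snd 𝒳.s 𝒳.t ≫ f₁) ≫ 𝒴.t := by
    rw [Category.assoc, Category.assoc, w_s, w_t, pullback.condition_assoc]
  have h := H (pullback.fst 𝒳.s 𝒳.t) (pullback.snd 𝒳.s 𝒳.t) pullback.condition w'
  have e₁ : 𝒳.comp (pullback.fst 𝒳.s 𝒳.t) (pullback.snd 𝒳.s 𝒳.t) pullback.condition = 𝒳.m := by
    rw [GroupoidObj.comp]
    refine Eq.trans ?_ (Category.id_comp _)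
    congr 1
    ext <;> simp
  rw [e₁] at h
  rw [h, GroupoidObj.comp]

theorem lift_comp_law {obj mor : C} {s t : mor ⟶ obj}
    (c : ∀ {T : C} (g h : T ⟶ mor), g ≫ s = h ≫ t → (T ⟶ mor))
    (c_nat : ∀ {T T' : C} (f : T' ⟶ T) (g h : T ⟶ mor) (w : g ≫ s = h ≫ t),
      f ≫ c g h w = c (f ≫ g) (f ≫ h) (by simp [w]))
    {T : C} (g h : T ⟶ mor) (w : g ≫ s = h ≫ t) :
    pullback.lift g h w ≫ c (pullback.fst s t) (pullback.snd s t) pullback.condition = c g h w := by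
  simp [c_nat, pullback.lift_fst, pullback.lift_snd]

variable [CartesianMonoidalCategory C]

theorem actionGroupoid_comp (G : C) [GrpObj G] (X : C) [ModObj G X] {T : C}
    (g h : T ⟶ G ⊗ X) (w : g ≫ snd G X = h ≫ (fst G X • snd G X)) :
    (actionGroupoid G X).comp g h w = lift ((g ≫ fst G X) * (h ≫ fst G X)) (h ≫ snd G X) :=
  lift_comp_law (s := snd G X) (t := fst G X • snd G X)
    (fun g h _ => lift ((g ≫ fst G X) * (h ≫ fst G X)) (h ≫ snd G X))
    (by intros; simp [MonObj.comp_mul]) g h w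

theorem semidirect_comp (G : C) [GrpObj G] (𝒳 : GroupoidObj C) [ModObj G 𝒳.obj]
    [ModObj G 𝒳.mor] (H : IsEquivariant G 𝒳) {T : C} (g h : T ⟶ G ⊗ 𝒳.mor)
    (w : g ≫ snd G 𝒳.mor ≫ 𝒳.s = h ≫ (fst G 𝒳.mor • snd G 𝒳.mor) ≫ 𝒳.t)
    (w' : ((h ≫ fst G 𝒳.mor)⁻¹ • (g ≫ snd G 𝒳.mor)) ≫ 𝒳.s = (h ≫ snd G 𝒳.mor) ≫ 𝒳.t) :
    (semidirectGroupoid G 𝒳 H).comp g h w = lift ((g ≫ fst G 𝒳.mor) * (h ≫ fst G 𝒳.mor))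
      (𝒳.comp ((h ≫ fst G 𝒳.mor)⁻¹ • (g ≫ snd G 𝒳.mor)) (h ≫ snd G 𝒳.mor) w') :=
  lift_comp_law (s := snd G 𝒳.mor ≫ 𝒳.s) (t := (fst G 𝒳.mor • snd G 𝒳.mor) ≫ 𝒳.t)
    (fun g h w => lift ((g ≫ fst G 𝒳.mor) * (h ≫ fst G 𝒳.mor))
      (𝒳.comp ((h ≫ fst G 𝒳.mor)⁻¹ • (g ≫ snd G 𝒳.mor)) (h ≫ snd G 𝒳.mor) (by
        rw [H.s_smul, semidirect_aux G 𝒳 H w])))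
    (by intro T T' f g h w
        ext
        · simp [MonObj.comp_mul]
        · simp only [lift_snd, Category.assoc, GroupoidObj.comp_nat, comp_lift]
          exact 𝒳.comp_congr _ (by simp [ModObj.comp_smul, GrpObj.comp_inv]) (by simp)) g h w

end Comp

section Morphism

open Matrix

variable {k : Type u} [CommRing k] {T T' : Over (Spec (CommRingCat.of k))}

noncomputable instance nGroupoidObjMod (k : Type u) [CommRing k] :
    ModObj (Gm k) (nGroupoid k).obj := gmModA1 k

noncomputable instance nGroupoidMorMod (k : Type u) [CommRing k] :
    ModObj (Gm k) (nGroupoid k).mor := gmModN1 k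

theorem nGroupoid_comp (g h : T ⟶ N1 k) (w : g ≫ n1Proj k = h ≫ n1Proj k) :
    (nGroupoid k).comp g h w = n1Mul g h w :=
  lift_comp_law n1Mul comp_n1Mul g h w

theorem n1Mul_smul (a : T ⟶ Gm k) (g h : T ⟶ N1 k) (w : g ≫ n1Proj k = h ≫ n1Proj k)
    (w' : (a • g) ≫ n1Proj k = (a • h) ≫ n1Proj k) : a • n1Mul g h w = n1Mul (a • g) (a • h) w' := by
  apply N1.ext
  · rw [N1.gam_smul, N1.gam_n1Mul, N1.gam_n1Mul, N1.gam_smul, N1.gam_smul, N1.del_smul]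
    ring
  · rw [N1.del_smul, N1.del_n1Mul, N1.del_n1Mul, N1.del_smul, N1.del_smul]
  · rw [N1.x_smul, N1.x_n1Mul, N1.x_n1Mul, N1.x_smul]

theorem n1One_smul (a : T ⟶ Gm k) (x : T ⟶ A1 k) : (a • x) ≫ n1One k = a • (x ≫ n1One k) := by
  apply N1.ext
  · rw [N1.gam_n1One, N1.gam_smul, N1.gam_n1One, mul_zero]
  · rw [N1.del_n1One, N1.del_smul, N1.del_n1One]
  · rw [N1.x_n1One, N1.x_smul, N1.x_n1One, A1.x_smul]

theorem n1Inv_smul (a : T ⟶ Gm k) (n : T ⟶ N1 k) : (a • n) ≫ n1Inv k = a • (n ≫ n1Inv k) := by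
  apply N1.ext
  · rw [N1.gam_n1Inv, N1.gam_smul, N1.gam_smul, N1.gam_n1Inv, N1.del_smul]
    ring
  · rw [N1.del_n1Inv, N1.del_smul, N1.del_smul, N1.del_n1Inv]
  · rw [N1.x_n1Inv, N1.x_smul, N1.x_smul, N1.x_n1Inv]

theorem n1Proj_smul (a : T ⟶ Gm k) (n : T ⟶ N1 k) : (a • n) ≫ n1Proj k = a • (n ≫ n1Proj k) :=
  A1.ext (by rw [A1.x_n1Proj, N1.x_smul, A1.x_smul, A1.x_n1Proj])

/-- The action of `𝔾ₘ` on the groupoid `𝒩`. -/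
theorem nGroupoid_isEquivariant (k : Type u) [CommRing k] : IsEquivariant (Gm k) (nGroupoid k) where
  s_smul a n := n1Proj_smul a n
  t_smul a n := n1Proj_smul a n
  e_smul a x := n1One_smul a x
  i_smul a n := n1Inv_smul a n
  comp_smul {T} a g h w := by
    have w₀ : (show T ⟶ N1 k from g) ≫ n1Proj k = (show T ⟶ N1 k from h) ≫ n1Proj k := w
    have w' : (a • (show T ⟶ N1 k from g)) ≫ n1Proj k = (a • (show T ⟶ N1 k from h)) ≫ n1Proj k := by
      rw [n1Proj_smul, n1Proj_smul, w₀]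
    exact (congr_arg (fun z : T ⟶ N1 k => a • z) (nGroupoid_comp g h w)).trans
      ((n1Mul_smul a g h w w').trans (nGroupoid_comp (a • g) (a • h) w').symm)

/-- The semi-direct product groupoid `𝔾ₘ ⋉ 𝒩`. -/
noncomputable def gmnGroupoid (k : Type u) [CommRing k] :
    GroupoidObj (Over (Spec (CommRingCat.of k))) :=
  semidirectGroupoid (Gm k) (nGroupoid k) (nGroupoid_isEquivariant k)

theorem unimodular_x_one {R : Type u} [CommRing R] (x : R) : Unimodular ![x, 1] :=
  ⟨![0, 1], by simp⟩

/-- The point `([x : 1], [0 : 1])` of `ℙ¹ × ℙ¹`. -/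
noncomputable def psiX (x : O T) : T ⟶ P1 k ⊗ P1 k :=
  lift (pt ![x, 1] (unimodular_x_one x)) (pt ![0, 1] (unimodular_x_one 0))

theorem comp_psiX (g : T' ⟶ T) (x : O T) : g ≫ psiX x = psiX (res g x) := by
  rw [psiX, psiX, comp_lift, pt_nat, pt_nat]
  congr 1
  · exact pt_congr (by ext i; fin_cases i <;> simp) _
  · exact pt_congr (by ext i; fin_cases i <;> simp) _

/-- The matrix with rows `(1, 0)` and `(t⁻¹ γ, t⁻¹ δ)`. -/
def psiMat {R : Type u} [CommRing R] (t δ : Rˣ) (c : R) : Matrix (Fin 2) (Fin 2) R :=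
  !![1, 0; t⁻¹.val * c, t⁻¹.val * δ.val]

theorem isUnit_psiMat {R : Type u} [CommRing R] (t δ : Rˣ) (c : R) : IsUnit (psiMat t δ c).det := by
  rw [psiMat, Matrix.det_fin_two_of, one_mul, zero_mul, sub_zero]
  exact (t⁻¹ * δ).isUnit

/-- The point of `PGL₂` given by the matrix with rows `(1, 0)` and `(t⁻¹ γ, t⁻¹ δ)`. -/
noncomputable def psiG (t δ : (O T)ˣ) (c : O T) : T ⟶ PGL2 k :=
  pgl (psiMat t δ c) (isUnit_psiMat t δ c)

theorem comp_psiG (g : T' ⟶ T) (t δ : (O T)ˣ) (c : O T) :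
    g ≫ psiG t δ c = psiG (resU g t) (resU g δ) (res g c) := by
  rw [psiG, pgl_nat]
  refine pgl_congr _ ?_
  ext i j
  fin_cases i <;> fin_cases j <;> simp [psiMat]

/-- The map on morphisms of `𝔾ₘ ⋉ 𝒩 ⟶ PGL₂ ⋉ (ℙ¹ × ℙ¹)`. -/
noncomputable def psi₁ (k : Type u) [CommRing k] : Gm k ⊗ N1 k ⟶ PGL2 k ⊗ (P1 k ⊗ P1 k) :=
  lift (psiG (Gm.t (fst (Gm k) (N1 k))) (N1.del (snd (Gm k) (N1 k))) (N1.gam (snd (Gm k) (N1 k))))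
    (psiX (N1.x (snd (Gm k) (N1 k))))

/-- The map on objects of `𝔾ₘ ⋉ 𝒩 ⟶ PGL₂ ⋉ (ℙ¹ × ℙ¹)`. -/
noncomputable def psi₀ (k : Type u) [CommRing k] : A1 k ⟶ P1 k ⊗ P1 k :=
  psiX (A1.x (𝟙 (A1 k)))

theorem comp_psi₀ (x : T ⟶ A1 k) : x ≫ psi₀ k = psiX (A1.x x) := by
  rw [psi₀, comp_psiX, ← A1.x_comp, Category.comp_id]

theorem comp_psi₁ (g : T ⟶ Gm k ⊗ N1 k) : g ≫ psi₁ k =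
    lift (psiG (Gm.t (g ≫ fst _ _)) (N1.del (g ≫ snd _ _)) (N1.gam (g ≫ snd _ _)))
      (psiX (N1.x (g ≫ snd _ _))) := by
  rw [psi₁, comp_lift, comp_psiG, comp_psiX, Gm.t_comp, N1.del_comp, N1.gam_comp, N1.x_comp]

theorem psiG_smul_psiX (t δ : (O T)ˣ) (c x : O T) (h : c * x + δ.val = 1) :
    psiG t δ c • psiX x = psiX (t.val * x) := by
  rw [psiX]
  refine (diag_smul_lift (PGL2 k) (P1 k) (P1 k) _ _ _).trans ?_
  rw [psiX, psiG, pgl_smul_pt, pgl_smul_pt]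
  have h₁ : psiMat t δ c *ᵥ ![x, 1] = ![x, t⁻¹.val] := by
    ext i
    fin_cases i
    · simp [psiMat]
    · simp [psiMat]
      linear_combination t⁻¹.val * h
  have h₂ : psiMat t δ c *ᵥ ![0, 1] = ![0, t⁻¹.val * δ.val] := by
    ext i
    fin_cases i <;> simp [psiMat]
  congr 1
  · apply pt_eq_of_cross
    intro i j
    rw [h₁]
    fin_cases i <;> fin_cases j <;> simp
  · apply pt_eq_of_cross
    intro i j
    rw [h₂]
    fin_cases i <;> fin_cases j <;> simp

theorem psiG_mul_psiG (t t' δ δ' : (O T)ˣ) (c c' : O T) :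
    psiG t δ c * psiG t' δ' c' =
      psiG (k := k) (t * t') (δ * δ') (t'.val * c + δ.val * c') := by
  rw [psiG, psiG, pgl_mul_pgl]
  refine pgl_congr _ ?_
  ext i j
  fin_cases i <;> fin_cases j <;> simp [psiMat]
  · linear_combination - t⁻¹.val * c * t'.inv_mul
  · ring

theorem psiG_one : psiG (T := T) 1 1 0 = 1 := by
  rw [one_eq_pgl]
  refine pgl_congr _ ?_
  ext i j
  fin_cases i <;> fin_cases j <;> simp [psiMat]

theorem psi_w_s (k : Type u) [CommRing k] : psi₁ k ≫ snd (PGL2 k) (P1 k ⊗ P1 k) =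
    (snd (Gm k) (N1 k) ≫ n1Proj k) ≫ psi₀ k := by
  rw [comp_psi₀, psi₁, lift_snd, A1.x_n1Proj]

theorem psi_w_t (k : Type u) [CommRing k] :
    psi₁ k ≫ (fst (PGL2 k) (P1 k ⊗ P1 k) • snd (PGL2 k) (P1 k ⊗ P1 k)) =
      ((fst (Gm k) (N1 k) • snd (Gm k) (N1 k)) ≫ n1Proj k) ≫ psi₀ k := by
  rw [comp_psi₀, ModObj.comp_smul, psi₁, lift_fst, lift_snd, A1.x_n1Proj, N1.x_smul,
    psiG_smul_psiX _ _ _ _ (N1.rel _)]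

theorem psi_w_e (k : Type u) [CommRing k] : lift 1 (n1One k) ≫ psi₁ k =
    psi₀ k ≫ lift 1 (𝟙 (P1 k ⊗ P1 k)) := by
  rw [comp_psi₁, lift_fst, lift_snd, ← Category.id_comp (n1One k), N1.gam_n1One, N1.del_n1One,
    N1.x_n1One, Gm.t_one, psiG_one, comp_lift, Category.comp_id, MonObj.comp_one]
  rfl

theorem psi_comp (a b : T ⟶ Gm k) (n n' : T ⟶ N1 k) (w : (b⁻¹ • n) ≫ n1Proj k = n' ≫ n1Proj k) :
    lift (a * b) (n1Mul (b⁻¹ • n) n' w) ≫ psi₁ k =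
      lift (((lift a n ≫ psi₁ k) ≫ fst _ _) * ((lift b n' ≫ psi₁ k) ≫ fst _ _))
        ((lift b n' ≫ psi₁ k) ≫ snd _ _) := by
  rw [comp_psi₁, comp_psi₁, comp_psi₁]
  simp only [lift_fst, lift_snd]
  rw [psiG_mul_psiG, N1.x_n1Mul, N1.gam_n1Mul, N1.del_n1Mul, N1.gam_smul, N1.del_smul, Gm.t_mul,
    Gm.t_inv, inv_inv]

theorem psi_w_m (g h : T ⟶ Gm k ⊗ N1 k)
    (w : g ≫ (gmnGroupoid k).s = h ≫ (gmnGroupoid k).t)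
    (w' : (g ≫ psi₁ k) ≫ (pglGroupoid k).s = (h ≫ psi₁ k) ≫ (pglGroupoid k).t) :
    (gmnGroupoid k).comp g h w ≫ psi₁ k = (pglGroupoid k).comp (g ≫ psi₁ k) (h ≫ psi₁ k) w' := by
  have w₁ : ((h ≫ fst (Gm k) (N1 k))⁻¹ • (g ≫ snd (Gm k) (N1 k))) ≫ n1Proj k =
      (h ≫ snd (Gm k) (N1 k)) ≫ n1Proj k :=
    (n1Proj_smul _ _).trans (semidirect_aux (Gm k) (nGroupoid k) (nGroupoid_isEquivariant k) w)
  have e₁ : (gmnGroupoid k).comp g h w =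
      lift ((g ≫ fst (Gm k) (N1 k)) * (h ≫ fst (Gm k) (N1 k)))
        (n1Mul ((h ≫ fst (Gm k) (N1 k))⁻¹ • (g ≫ snd (Gm k) (N1 k))) (h ≫ snd (Gm k) (N1 k)) w₁) :=
    (semidirect_comp (Gm k) (nGroupoid k) (nGroupoid_isEquivariant k) g h w w₁).trans
      (congr_arg (fun z : T ⟶ N1 k => lift ((g ≫ fst (Gm k) (N1 k)) * (h ≫ fst (Gm k) (N1 k))) z)
        (nGroupoid_comp _ _ w₁))
  have e₂ : (pglGroupoid k).comp (g ≫ psi₁ k) (h ≫ psi₁ k) w' = _ :=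
    actionGroupoid_comp (PGL2 k) (P1 k ⊗ P1 k) (g ≫ psi₁ k) (h ≫ psi₁ k) w'
  have e₃ := psi_comp (g ≫ fst (Gm k) (N1 k)) (h ≫ fst (Gm k) (N1 k)) (g ≫ snd (Gm k) (N1 k))
    (h ≫ snd (Gm k) (N1 k)) w₁
  have eg : lift (g ≫ fst (Gm k) (N1 k)) (g ≫ snd (Gm k) (N1 k)) = g := by ext1 <;> simp
  have eh : lift (h ≫ fst (Gm k) (N1 k)) (h ≫ snd (Gm k) (N1 k)) = h := by ext1 <;> simp
  rw [eg, eh] at e₃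
  exact (congr_arg (fun z : T ⟶ Gm k ⊗ N1 k => z ≫ psi₁ k) e₁).trans (e₃.trans e₂.symm)

/-- The morphism of groupoids `𝔾ₘ ⋉ 𝒩 ⟶ PGL₂ ⋉ (ℙ¹ × ℙ¹)`: on objects it is
`x ↦ ([x : 1], [0 : 1])`, and on morphisms it sends `(t, (γ, δ, x))` to the element of `PGL₂` given by
the matrix with rows `(1, 0)` and `(t⁻¹ γ, t⁻¹ δ)`, together with the point `([x : 1], [0 : 1])`. -/
noncomputable def psi (k : Type u) [CommRing k] : GroupoidHom (gmnGroupoid k) (pglGroupoid k) where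
  f₀ := psi₀ k
  f₁ := psi₁ k
  w_s := psi_w_s k
  w_t := psi_w_t k
  w_e := psi_w_e k
  w_m := GroupoidHom.w_m_of_comp (𝒳 := gmnGroupoid k) (𝒴 := pglGroupoid k) (psi₀ k) (psi₁ k)
    (psi_w_s k) (psi_w_t k) (fun g h w w' => psi_w_m g h w w')

end Morphism

end GrpdSch

/-! That `psi k` is an equivalence is a computation with matrices. An element [a] of PGL₂ carrying
([x : 1], [0 : 1]) to ([x' : 1], [0 : 1]) fixes [0 : 1], so its upper right entry vanishes and both
diagonal entries are units. The value s = a₁₀ x + a₁₁ of the lower row at (x, 1) is a unit because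
the image is [x' : 1]. Then t = a₀₀/s, γ = a₁₀/s, δ = a₁₁/s satisfy γ x + δ = 1 and t x = x', and
dividing a by a₀₀ gives the matrix prescribed by Ψ. The relation γ x + δ = 1 recovers t, hence γ and
δ, from that matrix. This is full faithfulness (`exists_psiG`, `psiG_injective`). For essential
surjectivity, near any pair ([u], [v]) there is a third point [w] distinct from both: one of [1 :
0], [0 : 1], [1 : 1] works at a given point of the base. The matrix with columns w, v sends [0 : 1]
to [v] and some [x : 1] to [u] (`exists_open_cross`, `exists_psi_lift`). So lifts exist Zariski
locally, and Zariski coverings are fpqc.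

The statement on representations is general: `GroupoidHom.LocalLifts.isEquivalence_pullbackVB` holds
for every fully faithful f : 𝒳 → 𝒴 with Zariski-local lifts, and needs only Zariski descent. A lift
of a point y of 𝒴₀ is a pair (x, c : f x → y). By full faithfulness two lifts of the same y are
joined by a unique morphism x → x', called a link. A representation A of 𝒴 turns c into an
isomorphism between the fibres of A at f x and at y. Hence a morphism of representations is
determined by its pullback along f₀, and a morphism b of pulled back representations, conjugated by
c, gives local morphisms that do not depend on the lift and therefore glue. Conversely, for W on 𝒳
the modules x_i^* W on a cover of 𝒴₀, with the actions of the links as transition isomorphisms, glue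
to a module N. It comes with comparisons of y^* N with x^* W for all lifts (x, c) of y. A morphism g
: y → z turns a lift (x, c) of y into the lift (x, g ∘ c) of z; equating the two comparisons defines
the action of g on N. The cocycle condition follows by composing lifts, and the tautological lift of
f₀ identifies f₀^* N with W.

Modules are glued as a limit of direct images from the members of a cover and from their overlaps.
Sections over an open subset commute with this limit, and the cocycle condition shows that over U l
a section amounts to its l-th component (`GluingDatum.π_injective`, `GluingDatum.π_surjective`).
Identities between inverse images are verified on generalized points by means of `tr`, which absorbs
the canonical isomorphisms (g ≫ f)^* ≅ g^* f^*. -/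

namespace GrpdSch

/-! ### Inverse and direct images of sheaves of modules, pullback of sections, and limits -/

section ModuleDescent

open Scheme.Modules

/-- Over opens contained in the image, the unit `M ⟶ j_* j^* M` of an open immersion is bijective. -/
theorem isIso_unit_app {X Y : Scheme.{u}} (j : X ⟶ Y) [IsOpenImmersion j] (M : Y.Modules)
    (O : Y.Opens) (hO : O ≤ j.opensRange) :
    IsIso (((pullbackPushforwardAdjunction j).unit.app M).app O) := by
  -- Restriction along `j` is also left adjoint to `j_*`, so its unit agrees with that of the
  -- inverse image up to an isomorphism. For the restriction the unit over `O` is the restriction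
  -- map to the open subset j(j⁻¹ O), which is `O` itself.
  have h := Adjunction.unit_leftAdjointUniq_hom_app (restrictAdjunction j)
    (pullbackPushforwardAdjunction j) M
  rw [← h, Hom.comp_app]
  have h₁ : IsIso (((restrictAdjunction j).unit.app M).app O) := by
    rw [restrictAdjunction_unit_app_app]
    have hO' : j ''ᵁ j ⁻¹ᵁ O = O := by
      rw [Scheme.Hom.image_preimage_eq_opensRange_inf]
      exact inf_eq_right.mpr hO
    have : IsIso (homOfLE (j.image_preimage_le O)) := inferInstanceAs (IsIso (eqToHom hO'))
    exact Functor.map_isIso M.presheaf (homOfLE (j.image_preimage_le O)).op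
  infer_instance

/-- A morphism of sheaves of modules is an isomorphism if it is bijective on small sections. -/
theorem isIso_of_forall_le {Y : Scheme.{u}} {M N : Y.Modules} (f : M ⟶ N) {I : Type*}
    (U : I → Y.Opens) (hU : ⨆ i, U i = ⊤) (h : ∀ i (O : Y.Opens), O ≤ U i → IsIso (f.app O)) :
    IsIso f := by
  -- The open subsets contained in some `U i` form a basis of the topology, and isomorphisms of
  -- sheaves can be tested on a basis.
  let B : {O : Y.Opens // ∃ i, O ≤ U i} → Y.Opens := fun O => O.1
  have hB : TopologicalSpace.Opens.IsBasis (Set.range B) := by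
    rw [TopologicalSpace.Opens.isBasis_iff_nbhd]
    intro V x hx
    have hx' : x ∈ ⨆ i, U i := by rw [hU]; trivial
    obtain ⟨i, hi⟩ := TopologicalSpace.Opens.mem_iSup.mp hx'
    exact ⟨V ⊓ U i, ⟨⟨V ⊓ U i, i, inf_le_right⟩, rfl⟩, ⟨hx, hi⟩, inf_le_left⟩
  let F : TopCat.Sheaf Ab Y := ⟨M.presheaf, M.isSheaf⟩
  let G : TopCat.Sheaf Ab Y := ⟨N.presheaf, N.isSheaf⟩
  let φ : F ⟶ G := ⟨f.mapPresheaf⟩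
  have hφ : IsIso φ :=
    TopCat.Sheaf.isIso_iff_isIso_basis hB (fun O => h O.2.choose O.1 O.2.choose_spec)
  have : IsIso ((toPresheaf Y).map f) :=
    inferInstanceAs (IsIso ((TopCat.Sheaf.forget Ab Y).map φ))
  exact isIso_of_reflects_iso f (toPresheaf Y)

variable {X Y Z T T' T'' : Scheme.{u}}

/-- The unit `V ⟶ g_* g^* V` of the adjunction between inverse and direct images. -/
noncomputable def pullUnit (g : X ⟶ Y) (V : Y.Modules) :
    V ⟶ (pushforward g).obj ((Scheme.Modules.pullback g).obj V) :=
  (pullbackPushforwardAdjunction g).unit.app V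

theorem pullUnit_naturality (g : X ⟶ Y) {V W : Y.Modules} (a : V ⟶ W) :
    a ≫ pullUnit g W = pullUnit g V ≫ (pushforward g).map ((Scheme.Modules.pullback g).map a) :=
  (pullbackPushforwardAdjunction g).unit.naturality a

/-- The canonical isomorphisms of composites for inverse and for direct images are mates, so they
match the unit of the composite adjunction with the unit for `g ≫ f`. -/
theorem pullUnit_comp (g : Z ⟶ Y) (f : Y ⟶ X) (V : X.Modules) :
    pullUnit f V ≫ (pushforward f).map (pullUnit g ((Scheme.Modules.pullback f).obj V)) ≫
      (pushforwardComp g f).hom.app _ =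
    pullUnit (g ≫ f) V ≫ (pushforward (g ≫ f)).map (compIso rfl V).hom := by
  have h := unit_conjugateEquiv
    ((pullbackPushforwardAdjunction f).comp (pullbackPushforwardAdjunction g))
    (pullbackPushforwardAdjunction (g ≫ f)) (pullbackComp g f).inv V
  rw [conjugateEquiv_pullbackComp_inv, Adjunction.comp_unit_app] at h
  have e : (compIso (g := g) (f := f) rfl V).hom = (pullbackComp g f).inv.app V := by
    simp [compIso, isoCompApp, pullbackCongr]
  rw [e]
  exact (Category.assoc _ _ _).symm.trans h

/-- The morphism `F ⟶ q_* M` corresponding to `q^* F ⟶ M` by adjunction. -/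
noncomputable def transpose (q : T ⟶ Y) {F : Y.Modules} {M : T.Modules}
    (f : (Scheme.Modules.pullback q).obj F ⟶ M) : F ⟶ (pushforward q).obj M :=
  pullUnit q F ≫ (pushforward q).map f

theorem transpose_bijective (q : T ⟶ Y) (F : Y.Modules) (M : T.Modules) :
    Function.Bijective (transpose q : ((Scheme.Modules.pullback q).obj F ⟶ M) → _) :=
  ((pullbackPushforwardAdjunction q).homEquiv F M).bijective

theorem transpose_comp (q : T ⟶ Y) {F : Y.Modules} {M N : T.Modules}
    (f : (Scheme.Modules.pullback q).obj F ⟶ M) (g : M ⟶ N) :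
    transpose q (f ≫ g) = transpose q f ≫ (pushforward q).map g := by
  rw [transpose, transpose, Functor.map_comp, Category.assoc]

theorem transpose_map_comp (q : T ⟶ Y) {F F' : Y.Modules} {M : T.Modules}
    (a : F' ⟶ F) (f : (Scheme.Modules.pullback q).obj F ⟶ M) :
    transpose q ((Scheme.Modules.pullback q).map a ≫ f) = a ≫ transpose q f := by
  rw [transpose, transpose, Functor.map_comp, reassoc_of% (pullUnit_naturality q a)]

/-- The counit `q^* q_* M ⟶ M` of the adjunction between inverse and direct images. -/
noncomputable def pullCounit (q : T ⟶ Y) (M : T.Modules) :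
    (Scheme.Modules.pullback q).obj ((pushforward q).obj M) ⟶ M :=
  (pullbackPushforwardAdjunction q).counit.app M

theorem pullCounit_naturality (q : T ⟶ Y) {M N : T.Modules} (f : M ⟶ N) :
    (Scheme.Modules.pullback q).map ((pushforward q).map f) ≫ pullCounit q N =
      pullCounit q M ≫ f :=
  (pullbackPushforwardAdjunction q).counit.naturality f

theorem transpose_pullCounit (q : T ⟶ Y) (M : T.Modules) : transpose q (pullCounit q M) = 𝟙 _ :=
  (pullbackPushforwardAdjunction q).right_triangle_components M

theorem map_transpose_pullCounit (q : T ⟶ Y) {F : Y.Modules} {M : T.Modules}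
    (f : (Scheme.Modules.pullback q).obj F ⟶ M) :
    (Scheme.Modules.pullback q).map (transpose q f) ≫ pullCounit q M = f := by
  apply (transpose_bijective q F M).1
  rw [transpose_map_comp, transpose_pullCounit, Category.comp_id]

/-- Pullback of sections `q_* x^* V ⟶ (g ≫ q)_* (g ≫ x)^* V`. -/
noncomputable def pullSec (g : T' ⟶ T) {q : T ⟶ Y} {q' : T' ⟶ Y} (hq : g ≫ q = q') {x : T ⟶ X}
    {x' : T' ⟶ X} (hx : g ≫ x = x') (V : X.Modules) :
    (pushforward q).obj ((Scheme.Modules.pullback x).obj V) ⟶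
      (pushforward q').obj ((Scheme.Modules.pullback x').obj V) :=
  transpose q' (baseChange (pullCounit q ((Scheme.Modules.pullback x).obj V)) g q' x' hq hx)

theorem baseChange_map_comp (g : T' ⟶ T) {q : T ⟶ Y} {q' : T' ⟶ Y}
    (hq : g ≫ q = q') {x : T ⟶ X} {x' : T' ⟶ X} (hx : g ≫ x = x') {F F' : Y.Modules}
    {W : X.Modules} (a : F' ⟶ F)
    (f : (Scheme.Modules.pullback q).obj F ⟶ (Scheme.Modules.pullback x).obj W) :
    baseChange ((Scheme.Modules.pullback q).map a ≫ f) g q' x' hq hx =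
      (Scheme.Modules.pullback q').map a ≫ baseChange f g q' x' hq hx := by
  rw [baseChange, baseChange, Functor.map_comp, Category.assoc,
    reassoc_of% (compIso_naturality hq a)]

/-- The dictionary between base change and pullback of sections: `f` is the inverse image of its
transpose followed by the counit, so the statement reduces to the counit, for which it is the
definition of `pullSec`. -/
theorem transpose_baseChange (g : T' ⟶ T) {q : T ⟶ Y} {q' : T' ⟶ Y}
    (hq : g ≫ q = q') {x : T ⟶ X} {x' : T' ⟶ X} (hx : g ≫ x = x') {F : Y.Modules} {W : X.Modules}
    (f : (Scheme.Modules.pullback q).obj F ⟶ (Scheme.Modules.pullback x).obj W) :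
    transpose q' (baseChange f g q' x' hq hx) = transpose q f ≫ pullSec g hq hx W := by
  rw [pullSec, ← transpose_map_comp, ← baseChange_map_comp, map_transpose_pullCounit]

/-- Transitivity of base change, read through `transpose_baseChange`. -/
theorem pullSec_comp (g : T' ⟶ T) (h : T'' ⟶ T') {q : T ⟶ Y} {q' : T' ⟶ Y} {q'' : T'' ⟶ Y}
    (hq : g ≫ q = q') (hq' : h ≫ q' = q'') {x : T ⟶ X} {x' : T' ⟶ X} {x'' : T'' ⟶ X}
    (hx : g ≫ x = x') (hx' : h ≫ x' = x'') (V : X.Modules) {l : T'' ⟶ T} (w : h ≫ g = l)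
    (hq'' : l ≫ q = q'') (hx'' : l ≫ x = x'') :
    pullSec g hq hx V ≫ pullSec h hq' hx' V = pullSec l hq'' hx'' V := by
  rw [pullSec, ← transpose_baseChange, baseChange_baseChange _ _ _ _ _ _ _ _ _ _ _ _ w, pullSec]

theorem pullSec_naturality {X' : Scheme.{u}} (g : T' ⟶ T) {q : T ⟶ Y} {q' : T' ⟶ Y}
    (hq : g ≫ q = q') {x : T ⟶ X} {y : T ⟶ X'} {x' : T' ⟶ X} {y' : T' ⟶ X'} (hx : g ≫ x = x')
    (hy : g ≫ y = y') {V : X.Modules} {W : X'.Modules}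
    (φ : (Scheme.Modules.pullback x).obj V ⟶ (Scheme.Modules.pullback y).obj W) :
    (pushforward q).map φ ≫ pullSec g hq hy W =
      pullSec g hq hx V ≫ (pushforward q').map (baseChange φ g x' y' hx hy) := by
  rw [pullSec, pullSec, ← transpose_map_comp, ← baseChange_map_comp, pullCounit_naturality,
    baseChange_comp _ _ _ _ x' _ _ hx, transpose_comp]

/-- Unfolding the adjunctions by a triangle identity leaves only the unit of `g`. In this form
bijectivity of `pullSec` over an open subset can be read off from that of the unit. -/
theorem pullSec_rfl (g : T' ⟶ T) (q : T ⟶ Y) {x : T ⟶ X} {x' : T' ⟶ X} (hx : g ≫ x = x')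
    (V : X.Modules) : pullSec g (q := q) rfl hx V =
      (pushforward q).map (pullUnit g _ ≫ (pushforward g).map (compIso hx V).inv) ≫
        (pushforwardComp g q).hom.app _ := by
  have h₁ := pullUnit_comp g q ((pushforward q).obj ((Scheme.Modules.pullback x).obj V))
  have h₂ := (pushforwardComp g q).hom.naturality ((Scheme.Modules.pullback g).map
    (pullCounit q ((Scheme.Modules.pullback x).obj V)) ≫ (compIso hx V).inv)
  have h₃ := transpose_pullCounit q ((Scheme.Modules.pullback x).obj V)
  have h₄ : pullUnit g _ ≫ (pushforward g).map ((Scheme.Modules.pullback g).map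
      (pullCounit q ((Scheme.Modules.pullback x).obj V)) ≫ (compIso hx V).inv) =
      pullCounit q _ ≫ pullUnit g _ ≫ (pushforward g).map (compIso hx V).inv := by
    rw [Functor.map_comp, reassoc_of% (pullUnit_naturality g (pullCounit q _))]
  rw [transpose] at h₃
  rw [Functor.comp_map] at h₂
  rw [pullSec, transpose, baseChange, Functor.map_comp, ← reassoc_of% h₁, ← h₂,
    ← Functor.map_comp_assoc, h₄, Functor.map_comp, Category.assoc, reassoc_of% h₃]

/-- All factors of the formula in `pullSec_rfl` are isomorphisms except the unit of `g`, which is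
one over q⁻¹ O as this open subset lies in the image of `g`. -/
theorem isIso_pullSec_app (g : T' ⟶ T) [IsOpenImmersion g] {q : T ⟶ Y} {q' : T' ⟶ Y}
    (hq : g ≫ q = q') {x : T ⟶ X} {x' : T' ⟶ X} (hx : g ≫ x = x') (V : X.Modules) (O : Y.Opens)
    (hO : q ⁻¹ᵁ O ≤ g.opensRange) : IsIso ((pullSec g hq hx V).app O) := by
  subst hq
  have h₁ : IsIso (Hom.app (pullUnit g ((Scheme.Modules.pullback x).obj V)) (q ⁻¹ᵁ O)) :=
    isIso_unit_app g _ _ hO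
  have h₂ : IsIso ((pushforwardComp g q).hom.app ((Scheme.Modules.pullback x').obj V)) :=
    inferInstance
  rw [pullSec_rfl, Hom.comp_app, pushforward_map_app, Hom.comp_app]
  have h₃ : IsIso ((pushforward g).map (compIso hx V).inv) := inferInstance
  exact IsIso.comp_isIso' (IsIso.comp_isIso' h₁ (Hom.isIso_iff_isIso_app.mp h₃ _))
    (Hom.isIso_iff_isIso_app.mp h₂ O)

/-- Sections over an open subset. -/
noncomputable def sectionsFunctor (Y : Scheme.{u}) (O : Y.Opens) : Y.Modules ⥤ Type u :=
  toPresheaf Y ⋙ (CategoryTheory.evaluation _ _).obj (op O) ⋙ forget Ab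

instance (O : Y.Opens) : PreservesLimits (sectionsFunctor Y O) :=
  have : PreservesLimits ((CategoryTheory.evaluation Y.Opensᵒᵖ Ab.{u}).obj (op O)) :=
    ⟨inferInstance⟩
  have := comp_preservesLimits ((CategoryTheory.evaluation Y.Opensᵒᵖ Ab.{u}).obj (op O)) (forget Ab)
  comp_preservesLimits (toPresheaf Y) _

/-- Two sections have the same image. -/
structure SectionsAgree {M M' N : Y.Modules} (f : M ⟶ N) (f' : M' ⟶ N) (O : Y.Opens) (s : Γ(M, O))
    (s' : Γ(M', O)) : Prop where
  eq : f.app O s = f'.app O s'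

/-- A section and its image. -/
structure MapsSection {M N : Y.Modules} (f : M ⟶ N) (O : Y.Opens) (s : Γ(M, O)) (s' : Γ(N, O)) :
    Prop where
  eq : f.app O s = s'

/-- A limit of a diagram of parallel pairs `left i ⟶ right i j ⟵ left j` in sheaves of modules, with
its universal properties for morphisms and for sections. -/
structure PairLimit {I : Type u} (left : I → Y.Modules) (right : I → I → Y.Modules)
    (fst : ∀ i j, left i ⟶ right i j) (snd : ∀ i j, left j ⟶ right i j) where
  pt : Y.Modules
  π : ∀ i, pt ⟶ left i
  condition : ∀ i j, CommSq (π i) (π j) (fst i j) (snd i j)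
  section_ext : ∀ (O : Y.Opens) (s s' : Γ(pt, O)), (∀ i, SectionsAgree (π i) (π i) O s s') → s = s'
  exists_section : ∀ (O : Y.Opens) (s : ∀ i, Γ(left i, O)),
    (∀ i j, SectionsAgree (fst i j) (snd i j) O (s i) (s j)) →
      ∃ z : Γ(pt, O), ∀ i, MapsSection (π i) O z (s i)
  exists_lift : ∀ (F : Y.Modules) (f : ∀ i, F ⟶ left i),
    (∀ i j, CommSq (f i) (f j) (fst i j) (snd i j)) → ∃ l : F ⟶ pt, ∀ i, l ≫ π i = f i

/-- The multiequalizer works: taking sections over `O` preserves limits, so its sections are exactly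
the compatible families of sections of the modules `left i`. -/
theorem nonempty_pairLimit {I : Type u} (left : I → Y.Modules) (right : I → I → Y.Modules)
    (fst : ∀ i j, left i ⟶ right i j) (snd : ∀ i j, left j ⟶ right i j) :
    Nonempty (PairLimit left right fst snd) := by
  let J : MulticospanShape.{u, u} := ⟨I, I × I, Prod.fst, Prod.snd⟩
  let D : MulticospanIndex J Y.Modules :=
    { left := left, right := fun p => right p.1 p.2, fst := fun p => fst p.1 p.2,
      snd := fun p => snd p.1 p.2 }
  have hc (O : Y.Opens) : IsLimit ((sectionsFunctor Y O).mapCone (Multiequalizer.multifork D)) :=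
    isLimitOfPreserves (sectionsFunctor Y O) (limit.isLimit D.multicospan)
  refine ⟨{ pt := multiequalizer D, π := Multiequalizer.ι D,
            condition := fun i j => ⟨Multiequalizer.condition D (i, j)⟩,
            section_ext := fun O s s' h => ?_,
            exists_section := fun O s h => ?_,
            exists_lift := fun F f h => ⟨Multiequalizer.lift D F f fun p => (h p.1 p.2).w, fun i =>
              Multiequalizer.lift_ι D F f (fun p => (h p.1 p.2).w) i⟩ }⟩
  · apply (Types.isLimitEquivSections (hc O)).injective
    refine Subtype.ext (funext fun a => ?_)
    refine (Types.isLimitEquivSections_apply (hc O) a s).trans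
      (Eq.trans ?_ (Types.isLimitEquivSections_apply (hc O) a s').symm)
    rcases a with i | j
    · exact (h i).eq
    -- The component at a right-hand vertex is the image of a left-hand one, so it carries no
    -- further information.
    · have w := ((sectionsFunctor Y O).mapCone (Multiequalizer.multifork D)).w
        (WalkingMulticospan.Hom.fst j)
      rw [← w]
      exact congr_arg ((D.fst j).app O) (h (J.fst j)).eq
  · let x : (D.multicospan ⋙ sectionsFunctor Y O).sections := ⟨fun a => match a with
      | .left i => s i
      | .right j => (D.fst j).app O (s (J.fst j)), by
        rintro a b (_ | j | j)
        · exact ConcreteCategory.congr_hom ((D.multicospan ⋙ sectionsFunctor Y O).map_id a) _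
        · rfl
        · exact (h j.1 j.2).eq.symm⟩
    exact ⟨(Types.isLimitEquivSections (hc O)).symm x,
      fun i => ⟨Types.isLimitEquivSections_symm_apply (hc O) x (.left i)⟩⟩

end ModuleDescent

/-! ### Gluing sheaves of modules along an open cover -/

section Gluing

open Scheme.Modules

variable {Y X : Scheme.{u}}

theorem app_eq_of_comp {M N P Q : Y.Modules} {f : M ⟶ N} {g : N ⟶ Q} {f' : M ⟶ P} {g' : P ⟶ Q}
    (h : f ≫ g = f' ≫ g') (O : Y.Opens) (s : Γ(M, O)) : g.app O (f.app O s) = g'.app O (f'.app O s) :=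
  ConcreteCategory.congr_hom (congr_arg (fun z => Hom.app z O) h) s

theorem SectionsAgree.of_comp {M M' N P : Y.Modules} {f : M ⟶ N} {f' : M' ⟶ N} {g : P ⟶ M} {g' : P ⟶ M'}
    (h : g ≫ f = g' ≫ f') (O : Y.Opens) (s : Γ(P, O)) : SectionsAgree f f' O (g.app O s) (g'.app O s) :=
  ⟨app_eq_of_comp h O s⟩

theorem SectionsAgree.unique {M M' N : Y.Modules} {f : M ⟶ N} {f' : M' ⟶ N} {O : Y.Opens} {s : Γ(M, O)}
    {s₁ s₂ : Γ(M', O)} (h₁ : SectionsAgree f f' O s s₁) (h₂ : SectionsAgree f f' O s s₂) 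
    (hf : Function.Injective (f'.app O)) : s₁ = s₂ :=
  hf (h₁.eq.symm.trans h₂.eq)

theorem SectionsAgree.comp {M M' N N' : Y.Modules} {f : M ⟶ N} {f' : M' ⟶ N} {O : Y.Opens} {s : Γ(M, O)}
    {s' : Γ(M', O)} (h : SectionsAgree f f' O s s') (g : N ⟶ N') :
    SectionsAgree (f ≫ g) (f' ≫ g) O s s' :=
  ⟨congr_arg (g.app O) h.eq⟩

theorem SectionsAgree.of_comp_injective {M M' N N' : Y.Modules} {f : M ⟶ N} {f' : M' ⟶ N} {O : Y.Opens}
    {s : Γ(M, O)} {s' : Γ(M', O)} {g : N ⟶ N'} (h : SectionsAgree (f ≫ g) (f' ≫ g) O s s')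
    (hg : Function.Injective (g.app O)) : SectionsAgree f f' O s s' :=
  ⟨hg h.eq⟩

theorem SectionsAgree.trans {M M' M'' N N' : Y.Modules} {f : M ⟶ N} {f' : M' ⟶ N} {g : N ⟶ N'}
    {f'' : M'' ⟶ N'} {O : Y.Opens} {s : Γ(M, O)} {s' : Γ(M', O)} {s'' : Γ(M'', O)}
    (h : SectionsAgree f f' O s s') (h' : SectionsAgree (f ≫ g) f'' O s s'') :
    SectionsAgree (f' ≫ g) f'' O s' s'' :=
  ⟨(congr_arg (g.app O) h.eq).symm.trans h'.eq⟩

theorem exists_sectionsAgree {M M' N : Y.Modules} (f : M ⟶ N) (f' : M' ⟶ N) {O : Y.Opens}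
    (hf : Function.Surjective (f'.app O)) (s : Γ(M, O)) : ∃ s', SectionsAgree f f' O s s' :=
  (hf (f.app O s)).imp fun _ h => ⟨h.symm⟩

/-- Descent data for an open cover of `Y`, given by the inverse images of a module `W` along morphisms
`x i : U i ⟶ X` and by isomorphisms between them on the overlaps. -/
structure GluingDatum (Y : Scheme.{u}) {X : Scheme.{u}} (W : X.Modules) (I : Type u) where
  U : I → Y.Opens
  x : ∀ i, (U i).toScheme ⟶ X
  θ : ∀ {T : Scheme.{u}} (i j : I) (a : T ⟶ (U i).toScheme) (b : T ⟶ (U j).toScheme),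
    a ≫ (U i).ι = b ≫ (U j).ι →
      ((Scheme.Modules.pullback (a ≫ x i)).obj W ⟶ (Scheme.Modules.pullback (b ≫ x j)).obj W)
  θ_nat : ∀ {T T' : Scheme.{u}} (g : T' ⟶ T) (i j : I) (a : T ⟶ (U i).toScheme)
    (b : T ⟶ (U j).toScheme) (h : a ≫ (U i).ι = b ≫ (U j).ι) (a' : T' ⟶ (U i).toScheme)
    (b' : T' ⟶ (U j).toScheme) (_ : g ≫ a = a') (_ : g ≫ b = b') (h' : a' ≫ (U i).ι = b' ≫ (U j).ι)
    (ha : g ≫ a ≫ x i = a' ≫ x i) (hb : g ≫ b ≫ x j = b' ≫ x j),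
    baseChange (θ i j a b h) g (a' ≫ x i) (b' ≫ x j) ha hb = θ i j a' b' h'
  θ_id : ∀ {T : Scheme.{u}} (i : I) (a : T ⟶ (U i).toScheme), θ i i a a rfl = 𝟙 _
  θ_comp : ∀ {T : Scheme.{u}} (i j l : I) (a : T ⟶ (U i).toScheme) (b : T ⟶ (U j).toScheme)
    (c : T ⟶ (U l).toScheme) (h : a ≫ (U i).ι = b ≫ (U j).ι) (h' : b ≫ (U j).ι = c ≫ (U l).ι),
    θ i j a b h ≫ θ j l b c h' = θ i l a c (h.trans h')

namespace GluingDatum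

variable {Y X : Scheme.{u}} {W : X.Modules} {I : Type u} (G : GluingDatum Y W I)

/-- The inclusion of an overlap in the first open subset. -/
noncomputable abbrev p₁ (i j : I) : (G.U i ⊓ G.U j).toScheme ⟶ (G.U i).toScheme :=
  Y.homOfLE inf_le_left

/-- The inclusion of an overlap in the second open subset. -/
noncomputable abbrev p₂ (i j : I) : (G.U i ⊓ G.U j).toScheme ⟶ (G.U j).toScheme :=
  Y.homOfLE inf_le_right

theorem p_ι (i j : I) : G.p₁ i j ≫ (G.U i).ι = G.p₂ i j ≫ (G.U j).ι := by
  rw [Scheme.homOfLE_ι, Scheme.homOfLE_ι]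

theorem bijective_pullSec {T T' : Scheme.{u}} (g : T' ⟶ T) [IsOpenImmersion g] {q : T ⟶ Y} {q' : T' ⟶ Y}
    (hq : g ≫ q = q') {x : T ⟶ X} {x' : T' ⟶ X} (hx : g ≫ x = x') (V : X.Modules) (O : Y.Opens)
    (hO : q ⁻¹ᵁ O ≤ g.opensRange) : Function.Bijective ((pullSec g hq hx V).app O) := by
  have := isIso_pullSec_app g hq hx V O hO
  exact ConcreteCategory.bijective_of_isIso ((pullSec g hq hx V).app O)

theorem preimage_le_opensRange_homOfLE {U V O : Y.Opens} (h : U ≤ V) (hO : O ⊓ V ≤ U) :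
    V.ι ⁻¹ᵁ O ≤ (Y.homOfLE h).opensRange := by
  rw [Scheme.opensRange_homOfLE]
  rintro ⟨y, hy⟩ hyO
  exact hO ⟨hyO, hy⟩

/-- A glued module: a limit of the diagram given by the descent datum. -/
structure Glued where
  pt : Y.Modules
  π : ∀ i, pt ⟶ (pushforward (G.U i).ι).obj ((Scheme.Modules.pullback (G.x i)).obj W)
  condition : ∀ i j, CommSq (π i) (π j)
    (pullSec (G.p₁ i j) (Scheme.homOfLE_ι _ _) rfl W ≫
      (pushforward (G.U i ⊓ G.U j).ι).map (G.θ i j _ _ (G.p_ι i j)))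
    (pullSec (G.p₂ i j) (Scheme.homOfLE_ι _ _) rfl W)
  section_ext : ∀ (O : Y.Opens) (s s' : Γ(pt, O)), (∀ i, SectionsAgree (π i) (π i) O s s') → s = s'
  exists_section : ∀ (O : Y.Opens)
    (s : ∀ i, Γ((pushforward (G.U i).ι).obj ((Scheme.Modules.pullback (G.x i)).obj W), O)),
    (∀ i j, SectionsAgree (pullSec (G.p₁ i j) (Scheme.homOfLE_ι _ _) rfl W ≫
        (pushforward (G.U i ⊓ G.U j).ι).map (G.θ i j _ _ (G.p_ι i j)))
      (pullSec (G.p₂ i j) (Scheme.homOfLE_ι _ _) rfl W) O (s i) (s j)) →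
      ∃ z : Γ(pt, O), ∀ i, MapsSection (π i) O z (s i)
  exists_lift : ∀ (F : Y.Modules)
    (f : ∀ i, F ⟶ (pushforward (G.U i).ι).obj ((Scheme.Modules.pullback (G.x i)).obj W)),
    (∀ i j, CommSq (f i) (f j)
      (pullSec (G.p₁ i j) (Scheme.homOfLE_ι _ _) rfl W ≫
        (pushforward (G.U i ⊓ G.U j).ι).map (G.θ i j _ _ (G.p_ι i j)))
      (pullSec (G.p₂ i j) (Scheme.homOfLE_ι _ _) rfl W)) → ∃ l : F ⟶ pt, ∀ i, l ≫ π i = f i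

theorem nonempty_glued : Nonempty G.Glued := by
  obtain ⟨E⟩ := nonempty_pairLimit
    (fun i => (pushforward (G.U i).ι).obj ((Scheme.Modules.pullback (G.x i)).obj W))
    (fun i j => (pushforward (G.U i ⊓ G.U j).ι).obj
      ((Scheme.Modules.pullback (G.p₂ i j ≫ G.x j)).obj W))
    (fun i j => pullSec (G.p₁ i j) (Scheme.homOfLE_ι _ _) rfl W ≫
      (pushforward (G.U i ⊓ G.U j).ι).map (G.θ i j _ _ (G.p_ι i j)))
    (fun i j => pullSec (G.p₂ i j) (Scheme.homOfLE_ι _ _) rfl W)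
  exact ⟨⟨E.pt, E.π, E.condition, E.section_ext, E.exists_section, E.exists_lift⟩⟩

variable {G} (E : G.Glued)

/-- Pulling back further along `c` turns the transition morphism θ on `P` into its base change θ' on
`T`. -/
theorem pullSec_map_pullSec {P T U U' : Scheme.{u}} (p : P ⟶ U) (p' : P ⟶ U') {q : U ⟶ Y}
    {r : P ⟶ Y} (hp : p ≫ q = r) {x : U ⟶ X} {x' : U' ⟶ X}
    (θ : (Scheme.Modules.pullback (p ≫ x)).obj W ⟶ (Scheme.Modules.pullback (p' ≫ x')).obj W)
    (c : T ⟶ P) {a : T ⟶ U} {b : T ⟶ U'} {y : T ⟶ Y} (hc : c ≫ r = y) (ha : c ≫ p = a)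
    (hx : c ≫ p ≫ x = a ≫ x) (hy : c ≫ p' ≫ x' = b ≫ x') (ha' : a ≫ q = y)
    (θ' : (Scheme.Modules.pullback (a ≫ x)).obj W ⟶ (Scheme.Modules.pullback (b ≫ x')).obj W)
    (hθ : baseChange θ c (a ≫ x) (b ≫ x') hx hy = θ') :
    (pullSec p hp rfl W ≫ (pushforward r).map θ) ≫ pullSec c hc hy W =
      pullSec a ha' rfl W ≫ (pushforward y).map θ' := by
  have h₁ := pullSec_naturality c hc hx hy θ
  rw [← pullSec_comp p c hp hc rfl hx W ha, Category.assoc, h₁, hθ, Category.assoc]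

-- The overlap is the fibre product of the two open subschemes over `Y`.
variable (G) in
theorem exists_lift_inf {i j : I} {T : Scheme.{u}} (a : T ⟶ (G.U i).toScheme)
    (b : T ⟶ (G.U j).toScheme) (y : T ⟶ Y) (ha : a ≫ (G.U i).ι = y) (hb : b ≫ (G.U j).ι = y) :
    ∃ c : T ⟶ (G.U i ⊓ G.U j).toScheme, c ≫ (G.U i ⊓ G.U j).ι = y ∧ c ≫ G.p₁ i j = a ∧
      c ≫ G.p₂ i j = b := by
  obtain ⟨c, hc⟩ : ∃ c : T ⟶ (G.U i ⊓ G.U j).toScheme, c ≫ (G.U i ⊓ G.U j).ι = y := by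
    refine ⟨IsOpenImmersion.lift (G.U i ⊓ G.U j).ι y ?_, IsOpenImmersion.lift_fac _ _ _⟩
    rintro _ ⟨t, rfl⟩
    have h₁ : y t ∈ Set.range (G.U i).ι := ⟨a t, by rw [← ha, Scheme.Hom.comp_apply]⟩
    have h₂ : y t ∈ Set.range (G.U j).ι := ⟨b t, by rw [← hb, Scheme.Hom.comp_apply]⟩
    rw [Scheme.Opens.range_ι] at h₁ h₂ ⊢
    exact ⟨h₁, h₂⟩
  refine ⟨c, hc, ?_, ?_⟩
  · rw [← cancel_mono (G.U i).ι, Category.assoc, Scheme.homOfLE_ι, hc, ha]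
  · rw [← cancel_mono (G.U j).ι, Category.assoc, Scheme.homOfLE_ι, hc, hb]

variable (G) in
theorem fst_pullSec {i j : I} {T : Scheme.{u}} (a : T ⟶ (G.U i).toScheme)
    (b : T ⟶ (G.U j).toScheme) (y : T ⟶ Y) (ha : a ≫ (G.U i).ι = y)
    (hab : a ≫ (G.U i).ι = b ≫ (G.U j).ι) (c : T ⟶ (G.U i ⊓ G.U j).toScheme)
    (hc : c ≫ (G.U i ⊓ G.U j).ι = y) (hca : c ≫ G.p₁ i j = a) (hcb : c ≫ G.p₂ i j = b)
    (hy : c ≫ G.p₂ i j ≫ G.x j = b ≫ G.x j) :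
    (pullSec (G.p₁ i j) (Scheme.homOfLE_ι _ _) rfl W ≫
      (pushforward (G.U i ⊓ G.U j).ι).map (G.θ i j _ _ (G.p_ι i j))) ≫ pullSec c hc hy W =
    pullSec a ha rfl W ≫ (pushforward y).map (G.θ i j a b hab) := by
  have hx : c ≫ G.p₁ i j ≫ G.x i = a ≫ G.x i := by rw [← Category.assoc, hca]
  exact pullSec_map_pullSec (G.p₁ i j) (G.p₂ i j) _ _ c hc hca hx hy ha _
    (G.θ_nat c i j _ _ _ a b hca hcb _ hx hy)

/-- The limit diagram imposes compatibility only on the intersections. Since every pair of points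
`a`, `b` over the same point of `Y` factors through an intersection, and θ commutes with base
change, compatibility holds on all `T`. -/
theorem compat_of_condition {F : Y.Modules} {i j : I}
    (f : F ⟶ (pushforward (G.U i).ι).obj ((Scheme.Modules.pullback (G.x i)).obj W))
    (f' : F ⟶ (pushforward (G.U j).ι).obj ((Scheme.Modules.pullback (G.x j)).obj W))
    (h : CommSq f f' (pullSec (G.p₁ i j) (Scheme.homOfLE_ι _ _) rfl W ≫
      (pushforward (G.U i ⊓ G.U j).ι).map (G.θ i j _ _ (G.p_ι i j)))
      (pullSec (G.p₂ i j) (Scheme.homOfLE_ι _ _) rfl W))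
    {T : Scheme.{u}} (a : T ⟶ (G.U i).toScheme) (b : T ⟶ (G.U j).toScheme)
    (y : T ⟶ Y) (ha : a ≫ (G.U i).ι = y) (hb : b ≫ (G.U j).ι = y)
    (hab : a ≫ (G.U i).ι = b ≫ (G.U j).ι) :
    f ≫ pullSec a ha rfl W ≫ (pushforward y).map (G.θ i j a b hab) = f' ≫ pullSec b hb rfl W := by
  obtain ⟨c, hc, hca, hcb⟩ := G.exists_lift_inf a b y ha hb
  have hy : c ≫ G.p₂ i j ≫ G.x j = b ≫ G.x j := by rw [← Category.assoc, hcb]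
  rw [← G.fst_pullSec a b y ha hab c hc hca hcb hy, ← Category.assoc, h.w, Category.assoc,
    pullSec_comp (G.p₂ i j) c (Scheme.homOfLE_ι _ _) hc rfl hy W hcb hb rfl]

/-- The counterpart of `compat_of_condition` for individual sections, which need not come from a
morphism. -/
theorem agree_of_condition {i j : I} {O : Y.Opens}
    {s : Γ((pushforward (G.U i).ι).obj ((Scheme.Modules.pullback (G.x i)).obj W), O)}
    {s' : Γ((pushforward (G.U j).ι).obj ((Scheme.Modules.pullback (G.x j)).obj W), O)}
    (h : SectionsAgree (pullSec (G.p₁ i j) (Scheme.homOfLE_ι _ _) rfl W ≫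
      (pushforward (G.U i ⊓ G.U j).ι).map (G.θ i j _ _ (G.p_ι i j)))
      (pullSec (G.p₂ i j) (Scheme.homOfLE_ι _ _) rfl W) O s s')
    {T : Scheme.{u}} (a : T ⟶ (G.U i).toScheme) (b : T ⟶ (G.U j).toScheme)
    (y : T ⟶ Y) (ha : a ≫ (G.U i).ι = y) (hb : b ≫ (G.U j).ι = y)
    (hab : a ≫ (G.U i).ι = b ≫ (G.U j).ι) :
    SectionsAgree (pullSec a ha rfl W ≫ (pushforward y).map (G.θ i j a b hab))
      (pullSec b hb rfl W) O s s' := by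
  obtain ⟨c, hc, hca, hcb⟩ := G.exists_lift_inf a b y ha hb
  have hy : c ≫ G.p₂ i j ≫ G.x j = b ≫ G.x j := by rw [← Category.assoc, hcb]
  rw [← G.fst_pullSec a b y ha hab c hc hca hcb hy,
    ← pullSec_comp (G.p₂ i j) c (Scheme.homOfLE_ι _ _) hc rfl hy W hcb hb rfl]
  exact h.comp _

theorem compat {T : Scheme.{u}} (i j : I) (a : T ⟶ (G.U i).toScheme) (b : T ⟶ (G.U j).toScheme)
    (y : T ⟶ Y) (ha : a ≫ (G.U i).ι = y) (hb : b ≫ (G.U j).ι = y)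
    (hab : a ≫ (G.U i).ι = b ≫ (G.U j).ι) :
    E.π i ≫ pullSec a ha rfl W ≫ (pushforward y).map (G.θ i j a b hab) =
      E.π j ≫ pullSec b hb rfl W :=
  compat_of_condition _ _ (E.condition i j) a b y ha hb hab

/-- Because `O` lies in `U l`, the part of `O` inside `U i` already lies in the overlap, so nothing
is lost by passing to it. -/
theorem bijective_p₂ {l : I} {O : Y.Opens} (hO : O ≤ G.U l) (i : I) :
    Function.Bijective ((pullSec (G.p₂ l i) (Scheme.homOfLE_ι _ _) (rfl : _ ≫ G.x i = _) W).app O) :=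
  bijective_pullSec _ _ _ _ _
    (preimage_le_opensRange_homOfLE _ (le_inf (inf_le_left.trans hO) inf_le_right))

/-- The `l`-th component of a section determines its image on each overlap with `U l`, hence by
`bijective_p₂` every other component. -/
theorem π_injective {l : I} {O : Y.Opens} (hO : O ≤ G.U l) : Function.Injective ((E.π l).app O) := by
  intro s s' h
  refine E.section_ext O s s' fun i => ⟨?_⟩
  have h₁ := SectionsAgree.of_comp (E.condition l i).w O s
  have h₂ := SectionsAgree.of_comp (E.condition l i).w O s'
  rw [h] at h₁
  exact h₁.unique h₂ (bijective_p₂ hO i).1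

/-- A section `n` of the `l`-th module is transported to every `U i` by the transition morphism from
`l` to `i`; the cocycle condition makes the resulting family compatible. -/
theorem π_surjective {l : I} {O : Y.Opens} (hO : O ≤ G.U l) :
    Function.Surjective ((E.π l).app O) := by
  intro n
  choose s hs using fun i => exists_sectionsAgree (pullSec (G.p₁ l i) (Scheme.homOfLE_ι _ _) rfl W ≫
      (pushforward (G.U l ⊓ G.U i).ι).map (G.θ l i _ _ (G.p_ι l i)))
      (pullSec (G.p₂ l i) (Scheme.homOfLE_ι _ _) rfl W) (bijective_p₂ hO i).2 n
  obtain ⟨z, hz⟩ := E.exists_section O s fun i j => by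
    -- Compatibility of the components at `i` and `j` is tested on the triple overlap with `U l`.
    let a : (G.U l ⊓ (G.U i ⊓ G.U j)).toScheme ⟶ (G.U l).toScheme := Y.homOfLE inf_le_left
    let t : (G.U l ⊓ (G.U i ⊓ G.U j)).toScheme ⟶ (G.U i ⊓ G.U j).toScheme := Y.homOfLE inf_le_right
    have ha : a ≫ (G.U l).ι = (G.U l ⊓ (G.U i ⊓ G.U j)).ι := Scheme.homOfLE_ι _ _
    have ht : t ≫ (G.U i ⊓ G.U j).ι = (G.U l ⊓ (G.U i ⊓ G.U j)).ι := Scheme.homOfLE_ι _ _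
    have hb : (t ≫ G.p₁ i j) ≫ (G.U i).ι = (G.U l ⊓ (G.U i ⊓ G.U j)).ι := by
      rw [Category.assoc, Scheme.homOfLE_ι, ht]
    have hc : (t ≫ G.p₂ i j) ≫ (G.U j).ι = (G.U l ⊓ (G.U i ⊓ G.U j)).ι := by
      rw [Category.assoc, Scheme.homOfLE_ι, ht]
    have hy : t ≫ G.p₂ i j ≫ G.x j = (t ≫ G.p₂ i j) ≫ G.x j := (Category.assoc _ _ _).symm
    have h₁ := agree_of_condition (hs i) a (t ≫ G.p₁ i j) _ ha hb (ha.trans hb.symm)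
    have h₂ := agree_of_condition (hs j) a (t ≫ G.p₂ i j) _ ha hc (ha.trans hc.symm)
    -- The transition from `l` to `j` factors through `i`; cancelling the common part from `l` to
    -- `i` relates the components at `i` and `j` directly.
    rw [← G.θ_comp l i j _ _ _ (ha.trans hb.symm) (hb.trans hc.symm), Functor.map_comp,
      ← Category.assoc] at h₂
    have h₃ := h₁.trans h₂
    rw [← G.fst_pullSec (t ≫ G.p₁ i j) (t ≫ G.p₂ i j) _ hb (hb.trans hc.symm) t ht rfl rfl hy,
      ← pullSec_comp (G.p₂ i j) t (Scheme.homOfLE_ι _ _) ht rfl hy W rfl hc rfl] at h₃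
    -- Over `O`, which lies in `U l`, passing from the double to the triple overlap is injective on
    -- sections.
    refine h₃.of_comp_injective (bijective_pullSec _ _ _ _ _ ?_).1
    exact preimage_le_opensRange_homOfLE _ (le_inf (inf_le_left.trans hO) inf_le_right)
  refine ⟨z, (hz l).eq.trans ?_⟩
  -- On the diagonal the transition morphism is the identity, so the `l`-th component of the
  -- constructed section is `n` itself.
  have h := agree_of_condition (hs l) (𝟙 _) (𝟙 _) (G.U l).ι (Category.id_comp _) (Category.id_comp _) rfl
  rw [G.θ_id, CategoryTheory.Functor.map_id, Category.comp_id] at h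
  refine ((bijective_pullSec (𝟙 _) _ _ W O ?_).1 h.eq).symm
  rw [Scheme.Hom.opensRange_of_isIso]
  exact le_top

/-- The isomorphism of the glued module with the given one over a member of the cover. -/
noncomputable def β (i : I) :
    (Scheme.Modules.pullback (G.U i).ι).obj E.pt ⟶ (Scheme.Modules.pullback (G.x i)).obj W :=
  (Scheme.Modules.pullback (G.U i).ι).map (E.π i) ≫ pullCounit _ _

theorem transpose_β (i : I) : transpose (G.U i).ι (β E i) = E.π i := by
  rw [β, transpose_map_comp, transpose_pullCounit, Category.comp_id]

/-- The adjoint form of `compat`: the transpose of `β E i` is the projection `E.π i`. -/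
theorem baseChange_β {T : Scheme.{u}} (i j : I) (a : T ⟶ (G.U i).toScheme) (b : T ⟶ (G.U j).toScheme)
    (y : T ⟶ Y) (ha : a ≫ (G.U i).ι = y) (hb : b ≫ (G.U j).ι = y)
    (hab : a ≫ (G.U i).ι = b ≫ (G.U j).ι) :
    baseChange (β E i) a y (a ≫ G.x i) ha rfl ≫ G.θ i j a b hab =
      baseChange (β E j) b y (b ≫ G.x j) hb rfl := by
  apply (transpose_bijective y _ _).1
  rw [transpose_comp, transpose_baseChange, transpose_baseChange, transpose_β, transpose_β,
    Category.assoc, compat E i j a b y ha hb hab]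

/-- Local morphisms to the modules of a descent datum that agree on overlaps. -/
def IsCompatible (G : GluingDatum Y W I) {F : Y.Modules} (f : ∀ i,
    (Scheme.Modules.pullback (G.U i).ι).obj F ⟶ (Scheme.Modules.pullback (G.x i)).obj W) : Prop :=
  ∀ ⦃T : Scheme.{u}⦄ (i j : I) (a : T ⟶ (G.U i).toScheme) (b : T ⟶ (G.U j).toScheme)
    (y : T ⟶ Y) (ha : a ≫ (G.U i).ι = y) (hb : b ≫ (G.U j).ι = y)
    (hab : a ≫ (G.U i).ι = b ≫ (G.U j).ι),
    baseChange (f i) a y (a ≫ G.x i) ha rfl ≫ G.θ i j a b hab =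
      baseChange (f j) b y (b ≫ G.x j) hb rfl

theorem isCompatible_β : G.IsCompatible (β E) :=
  fun _ i j a b y ha hb hab => baseChange_β E i j a b y ha hb hab

/-- The transposes of compatible local morphisms form a cone over the diagram whose limit is the
glued module. -/
theorem exists_lift {F : Y.Modules} {f : ∀ i, (Scheme.Modules.pullback (G.U i).ι).obj F ⟶
      (Scheme.Modules.pullback (G.x i)).obj W} (h : G.IsCompatible f) :
    ∃ l : F ⟶ E.pt, ∀ i, (Scheme.Modules.pullback (G.U i).ι).map l ≫ β E i = f i := by
  obtain ⟨l, hl⟩ := E.exists_lift F (fun i => transpose _ (f i)) fun i j => by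
    have h₁ := congr_arg (transpose _) (h i j _ _ (G.U i ⊓ G.U j).ι (Scheme.homOfLE_ι _ _)
      (Scheme.homOfLE_ι _ _) (G.p_ι i j))
    rw [transpose_comp, transpose_baseChange, transpose_baseChange, Category.assoc] at h₁
    exact ⟨h₁⟩
  refine ⟨l, fun i => (transpose_bijective _ _ _).1 ?_⟩
  rw [transpose_map_comp, transpose_β]
  exact hl i

theorem isIso_app_congr {M N : Y.Modules} (f : M ⟶ N) {O O' : Y.Opens} (h : O = O')
    (hO : IsIso (f.app O)) : IsIso (f.app O') :=
  h ▸ hO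

/-- The projection `E.π i` is the unit followed by the direct image of `β E i`. Over open subsets of
`U i` both the projection and the unit are bijective, hence so is `β E i`. -/
theorem isIso_β (i : I) : IsIso (β E i) := by
  rw [Hom.isIso_iff_isIso_app]
  intro O'
  have hO : (G.U i).ι ''ᵁ O' ≤ G.U i := by
    simpa using (G.U i).ι.image_le_opensRange O'
  have h₁ : IsIso ((E.π i).app ((G.U i).ι ''ᵁ O')) := by
    rw [ConcreteCategory.isIso_iff_bijective]
    exact ⟨π_injective E hO, π_surjective E hO⟩
  have h₂ : IsIso ((pullUnit (G.U i).ι E.pt).app ((G.U i).ι ''ᵁ O')) :=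
    isIso_unit_app (G.U i).ι E.pt _ (by simpa using hO)
  rw [← transpose_β, transpose, Hom.comp_app] at h₁
  have h₃ := IsIso.of_isIso_comp_left ((pullUnit (G.U i).ι E.pt).app ((G.U i).ι ''ᵁ O'))
    (((pushforward (G.U i).ι).map (β E i)).app ((G.U i).ι ''ᵁ O'))
  exact isIso_app_congr (β E i) ((G.U i).ι.preimage_image_eq O') h₃

/-- By naturality of the unit, which is bijective over open subsets of `U i`, the map induced by `f`
on such sections is conjugate to the one induced by its inverse image on `U i`. -/
theorem isIso_of_isIso_pullback {M N : Y.Modules} (f : M ⟶ N) {I : Type*} (U : I → Y.Opens)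
    (hU : ⨆ i, U i = ⊤) (h : ∀ i, IsIso ((Scheme.Modules.pullback (U i).ι).map f)) : IsIso f := by
  refine isIso_of_forall_le f U hU fun i O hO => ?_
  have h₁ : IsIso ((pullUnit (U i).ι M).app O) := isIso_unit_app (U i).ι M _ (by simpa using hO)
  have h₂ : IsIso ((pullUnit (U i).ι N).app O) := isIso_unit_app (U i).ι N _ (by simpa using hO)
  have h₄ : IsIso ((pushforward (U i).ι).map ((Scheme.Modules.pullback (U i).ι).map f)) := inferInstance
  have h₅ := Hom.isIso_iff_isIso_app.mp h₄ O
  have h₆ := congr_arg (fun z => Hom.app z O) (pullUnit_naturality (U i).ι f)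
  simp only [Hom.comp_app] at h₆
  have h₇ : IsIso (f.app O ≫ (pullUnit (U i).ι N).app O) := by
    rw [h₆]
    exact IsIso.comp_isIso' h₁ h₅
  exact IsIso.of_isIso_comp_right _ ((pullUnit (U i).ι N).app O)

end GluingDatum

/-! ### Gluing morphisms of sheaves of modules -/

section GlueHom

variable {I : Type u}

theorem baseChange_trans {X Y Z T T' : Scheme.{u}} {V : X.Modules} {W : Y.Modules}
    {s : Z ⟶ X} {t : Z ⟶ Y}
    (φ : (Scheme.Modules.pullback s).obj V ⟶ (Scheme.Modules.pullback t).obj W)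
    (g : T ⟶ Z) (gs : T ⟶ X) (gt : T ⟶ Y) (hs : g ≫ s = gs) (ht : g ≫ t = gt)
    (h : T' ⟶ T) (hgs : T' ⟶ X) (hgt : T' ⟶ Y) (hs' : h ≫ gs = hgs) (ht' : h ≫ gt = hgt)
    (hg : T' ⟶ Z) (w : h ≫ g = hg) (hs'' : hg ≫ s = hgs) (ht'' : hg ≫ t = hgt) :
    baseChange (baseChange φ g gs gt hs ht) h hgs hgt hs' ht' =
      baseChange φ hg hgs hgt hs'' ht'' :=
  baseChange_baseChange φ g gs gt hs ht h hgs hgt hs' ht' hg w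

theorem baseChange_id {Z T : Scheme.{u}} {s : Z ⟶ X} {V : X.Modules} (g : T ⟶ Z) (gs : T ⟶ X)
    (hs : g ≫ s = gs) : baseChange (𝟙 ((Scheme.Modules.pullback s).obj V)) g gs gs hs hs = 𝟙 _ := by
  rw [baseChange, CategoryTheory.Functor.map_id, Category.id_comp, Iso.hom_inv_id]

/-- The identification of the inverse images of a module along equal morphisms. -/
noncomputable def pullEq {T : Scheme.{u}} (N : Y.Modules) {a b : T ⟶ Y} (h : a = b) :
    (Scheme.Modules.pullback a).obj N ⟶ (Scheme.Modules.pullback b).obj N :=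
  baseChange (𝟙 ((Scheme.Modules.pullback (𝟙 Y)).obj N)) a a b (Category.comp_id _)
    ((Category.comp_id _).trans h)

theorem pullEq_rfl {T : Scheme.{u}} (N : Y.Modules) (a : T ⟶ Y) : pullEq N (rfl : a = a) = 𝟙 _ :=
  baseChange_id _ _ _

theorem pullEq_baseChange {T T' : Scheme.{u}} (N : Y.Modules) {a b : T ⟶ Y} (h : a = b) (g : T' ⟶ T)
    (a' b' : T' ⟶ Y) (ha : g ≫ a = a') (hb : g ≫ b = b') (h' : a' = b') :
    baseChange (pullEq N h) g a' b' ha hb = pullEq N h' := by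
  subst h h'
  rw [pullEq_rfl, pullEq_rfl, baseChange_id]

theorem pullEq_trans {T : Scheme.{u}} (N : Y.Modules) {a b c : T ⟶ Y} (h : a = b) (h' : b = c)
    (h'' : a = c) : pullEq N h ≫ pullEq N h' = pullEq N h'' := by
  subst h h'
  rw [pullEq_rfl, Category.comp_id]


theorem baseChange_comp_pullEq {X' T Z : Scheme.{u}} {M : X'.Modules} {N : Y.Modules} {s : Z ⟶ X'}
    {t : Z ⟶ Y} (φ : (Scheme.Modules.pullback s).obj M ⟶ (Scheme.Modules.pullback t).obj N) (g : T ⟶ Z)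
    (gs : T ⟶ X') {gt gt' : T ⟶ Y} (hs : g ≫ s = gs) (ht : g ≫ t = gt) (ht' : g ≫ t = gt') (h : gt = gt') :
    baseChange φ g gs gt hs ht ≫ pullEq N h = baseChange φ g gs gt' hs ht' := by
  subst h
  rw [pullEq_rfl, Category.comp_id]

/-- Local morphisms that agree on overlaps. -/
def IsCompatibleHom {M N : Y.Modules} (U : I → Y.Opens) (α : ∀ i,
    (Scheme.Modules.pullback (U i).ι).obj M ⟶ (Scheme.Modules.pullback (U i).ι).obj N) : Prop :=
  ∀ ⦃T : Scheme.{u}⦄ (i j : I) (a : T ⟶ (U i).toScheme) (b : T ⟶ (U j).toScheme) (y : T ⟶ Y)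
    (ha : a ≫ (U i).ι = y) (hb : b ≫ (U j).ι = y),
    baseChange (α i) a y y ha ha = baseChange (α j) b y y hb hb

/-- A module that restricts to the given ones. -/
structure Descended {W : X.Modules} (G : GluingDatum Y W I) (N : Y.Modules) where
  τ : ∀ i, (Scheme.Modules.pullback (G.U i).ι).obj N ⟶ (Scheme.Modules.pullback (G.x i)).obj W
  isIso : ∀ i, IsIso (τ i)
  compatible : G.IsCompatible τ

/-- Any module is glued from its own restrictions, with the canonical identifications as transition
isomorphisms. This reduces gluing of morphisms into an arbitrary module to the universal property of
a glued one. -/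
theorem exists_descended (N : Y.Modules) (U : I → Y.Opens) :
    ∃ G : GluingDatum Y N I, G.U = U ∧ Nonempty (Descended G N) := by
  let G : GluingDatum Y N I :=
    { U := U
      x i := (U i).ι
      θ i j a b h := pullEq N h
      θ_nat g i j a b h a' b' _ _ h' ha hb := pullEq_baseChange N h g _ _ ha hb h'
      θ_id i a := pullEq_rfl N _
      θ_comp i j l a b c h h' := pullEq_trans N h h' _ }
  refine ⟨G, rfl, ⟨⟨fun i => 𝟙 ((Scheme.Modules.pullback (U i).ι).obj N), fun i => inferInstance, ?_⟩⟩⟩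
  rintro T i j a b y ha rfl hab
  -- Here `y` is freed so that it can be replaced by the composite through `U i` instead of the one
  -- through `U j`.
  have h₁ : ∀ (y : T ⟶ Y) (h : a ≫ (U i).ι = y) (hb : b ≫ (U j).ι = y) (h' : a ≫ (U i).ι = b ≫ (U j).ι),
      baseChange (𝟙 ((Scheme.Modules.pullback (U i).ι).obj N)) a y (a ≫ (U i).ι) h rfl ≫
        pullEq N h' = baseChange (𝟙 ((Scheme.Modules.pullback (U j).ι).obj N)) b y (b ≫ (U j).ι) hb rfl := by
    rintro _ rfl hb h'
    rw [baseChange_id, Category.id_comp, ← baseChange_comp_pullEq _ b _ hb hb rfl h', baseChange_id,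
      Category.id_comp]
  exact h₁ _ ha rfl hab

namespace Descended

variable {W : X.Modules} {G : GluingDatum Y W I} {M N : Y.Modules} (D : Descended G N)

/-- The morphism to the glued module exists by the universal property and becomes an isomorphism on
every member of the cover, as `D.τ i` and `β E i` are isomorphisms. -/
theorem exists_iso (hU : ⨆ i, G.U i = ⊤) (E : G.Glued) : ∃ e : N ⟶ E.pt, IsIso e ∧
    ∀ i, (Scheme.Modules.pullback (G.U i).ι).map e ≫ GluingDatum.β E i = D.τ i := by
  obtain ⟨e, he⟩ := GluingDatum.exists_lift E D.compatible
  refine ⟨e, GluingDatum.isIso_of_isIso_pullback e G.U hU fun i => ?_, he⟩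
  have h₁ : IsIso (GluingDatum.β E i) := GluingDatum.isIso_β E i
  have h₂ := D.isIso i
  rw [← he] at h₂
  exact IsIso.of_isIso_comp_right _ (GluingDatum.β E i)

-- Followed by `D.τ i`, the local morphisms become compatible with the descent datum and so define a
-- morphism to the glued module, which is isomorphic to `N`.
include D in
theorem exists_glueHom (hU : ⨆ i, G.U i = ⊤) {α : ∀ i,
      (Scheme.Modules.pullback (G.U i).ι).obj M ⟶ (Scheme.Modules.pullback (G.U i).ι).obj N}
    (hα : IsCompatibleHom G.U α) :
    ∃ f : M ⟶ N, ∀ i, (Scheme.Modules.pullback (G.U i).ι).map f = α i := by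
  obtain ⟨E⟩ := G.nonempty_glued
  obtain ⟨e, _, he⟩ := D.exists_iso hU E
  obtain ⟨l, hl⟩ := GluingDatum.exists_lift E (F := M) (f := fun i => α i ≫ D.τ i)
    fun T i j a b y ha hb hab => by
      rw [baseChange_comp _ _ a y y _ ha ha rfl, baseChange_comp _ _ b y y _ hb hb rfl, Category.assoc,
        D.compatible i j a b y ha hb hab, hα i j a b y ha hb]
  refine ⟨l ≫ inv e, fun i => ?_⟩
  have := D.isIso i
  have h₁ : (Scheme.Modules.pullback (G.U i).ι).map (inv e) ≫ D.τ i = GluingDatum.β E i := by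
    rw [← he, ← Functor.map_comp_assoc, IsIso.inv_hom_id, CategoryTheory.Functor.map_id, Category.id_comp]
  rw [← cancel_mono (D.τ i), ← hl, Functor.map_comp, Category.assoc, h₁]

-- After identifying `N` with the glued module, equality can be checked on the components of
-- sections, and these are transposes of local morphisms.
include D in
theorem hom_ext (hU : ⨆ i, G.U i = ⊤) {f f' : M ⟶ N} (h : ∀ i,
    (Scheme.Modules.pullback (G.U i).ι).map f = (Scheme.Modules.pullback (G.U i).ι).map f') :
    f = f' := by
  obtain ⟨E⟩ := G.nonempty_glued
  obtain ⟨e, _, he⟩ := D.exists_iso hU E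
  have h₁ (i : I) : (f ≫ e) ≫ E.π i = (f' ≫ e) ≫ E.π i := by
    rw [← GluingDatum.transpose_β, ← transpose_map_comp, ← transpose_map_comp, Functor.map_comp,
      Functor.map_comp, h]
  rw [← cancel_mono e]
  exact Scheme.Modules.hom_ext _ _ fun O => ConcreteCategory.hom_ext _ _ fun s =>
    E.section_ext O _ _ fun i => ⟨app_eq_of_comp (h₁ i) O s⟩

end Descended

theorem exists_glueHom {M N : Y.Modules} {U : I → Y.Opens} (hU : ⨆ i, U i = ⊤) {α : ∀ i,
      (Scheme.Modules.pullback (U i).ι).obj M ⟶ (Scheme.Modules.pullback (U i).ι).obj N}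
    (hα : IsCompatibleHom U α) :
    ∃ f : M ⟶ N, ∀ i, (Scheme.Modules.pullback (U i).ι).map f = α i := by
  obtain ⟨G, rfl, ⟨D⟩⟩ := exists_descended N U
  exact D.exists_glueHom hU hα

theorem hom_ext_of_pullback {M N : Y.Modules} {U : I → Y.Opens} (hU : ⨆ i, U i = ⊤) {f f' : M ⟶ N}
    (h : ∀ i, (Scheme.Modules.pullback (U i).ι).map f = (Scheme.Modules.pullback (U i).ι).map f') :
    f = f' := by
  obtain ⟨G, rfl, ⟨D⟩⟩ := exists_descended N U
  exact D.hom_ext hU h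

end GlueHom
end Gluing

/-! ### Base change of morphisms between inverse images, made total in its endpoints -/

section Transport

variable {X Y X' X'' Z T T' T'' : Scheme.{u}}

open Classical in
/-- The base-change of `φ : x^* V ⟶ y^* W` along `g`, as a morphism `x'^* V ⟶ y'^* W`, for
`x' = g ≫ x` and `y' = g ≫ y` (and zero for all other `x'` and `y'`). -/
noncomputable def tr {V : X.Modules} {W : Y.Modules} {x : T ⟶ X} {y : T ⟶ Y}
    (φ : (Scheme.Modules.pullback x).obj V ⟶ (Scheme.Modules.pullback y).obj W) (g : T' ⟶ T)
    (x' : T' ⟶ X) (y' : T' ⟶ Y) :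
    (Scheme.Modules.pullback x').obj V ⟶ (Scheme.Modules.pullback y').obj W :=
  if h : g ≫ x = x' ∧ g ≫ y = y' then baseChange φ g x' y' h.1 h.2 else 0

variable {V : X.Modules} {W : Y.Modules} {x : T ⟶ X} {y : T ⟶ Y}
    (φ : (Scheme.Modules.pullback x).obj V ⟶ (Scheme.Modules.pullback y).obj W) (g : T' ⟶ T)
    {x' : T' ⟶ X} {y' : T' ⟶ Y}

theorem tr_eq (hx : g ≫ x = x') (hy : g ≫ y = y') : tr φ g x' y' = baseChange φ g x' y' hx hy :=
  dif_pos ⟨hx, hy⟩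

theorem tr_tr (hx : g ≫ x = x') (hy : g ≫ y = y') (h : T'' ⟶ T') {x'' : T'' ⟶ X} {y'' : T'' ⟶ Y}
    (hx' : h ≫ x' = x'') (hy' : h ≫ y' = y'') {l : T'' ⟶ T} (w : h ≫ g = l) :
    tr (tr φ g x' y') h x'' y'' = tr φ l x'' y'' := by
  have e₁ : l ≫ x = x'' := by rw [← w, Category.assoc, hx, hx']
  have e₂ : l ≫ y = y'' := by rw [← w, Category.assoc, hy, hy']
  rw [tr_eq φ g hx hy, tr_eq _ h hx' hy', tr_eq φ l e₁ e₂]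
  exact baseChange_trans φ g _ _ hx hy h _ _ hx' hy' l w e₁ e₂

theorem tr_comp {U : X''.Modules} {z : T ⟶ X''} {z' : T' ⟶ X''}
    (ψ : (Scheme.Modules.pullback y).obj W ⟶ (Scheme.Modules.pullback z).obj U)
    (hx : g ≫ x = x') (hy : g ≫ y = y') (hz : g ≫ z = z') :
    tr (φ ≫ ψ) g x' z' = tr φ g x' y' ≫ tr ψ g y' z' := by
  rw [tr_eq _ g hx hz, tr_eq _ g hx hy, tr_eq _ g hy hz, baseChange_comp _ _ _ _ _ _ hx hy hz]

theorem isIso_tr [IsIso φ] (hx : g ≫ x = x') (hy : g ≫ y = y') : IsIso (tr φ g x' y') := by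
  rw [tr_eq _ g hx hy]
  exact isIso_baseChange φ g _ _ hx hy

theorem isIso_of_isIso_tr (hx : g ≫ x = x') (hy : g ≫ y = y') (h : IsIso (tr φ g x' y')) :
    IsIso ((Scheme.Modules.pullback g).map φ) := by
  rw [tr_eq _ g hx hy, baseChange] at h
  have h₁ := IsIso.of_isIso_comp_left (compIso hx V).hom
    ((Scheme.Modules.pullback g).map φ ≫ (compIso hy W).inv)
  exact IsIso.of_isIso_comp_right _ (compIso hy W).inv

instance : (Scheme.Modules.pullback (𝟙 T)).Faithful :=
  Functor.Faithful.of_iso (Scheme.Modules.pullbackId T).symm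

instance : (Scheme.Modules.pullback (𝟙 T)).Full :=
  Functor.Full.of_iso (Scheme.Modules.pullbackId T).symm

theorem map_eq_map_of_tr_eq {φ φ' : (Scheme.Modules.pullback x).obj V ⟶
    (Scheme.Modules.pullback y).obj W} (hx : g ≫ x = x') (hy : g ≫ y = y')
    (h : tr φ g x' y' = tr φ' g x' y') :
    (Scheme.Modules.pullback g).map φ = (Scheme.Modules.pullback g).map φ' := by
  rw [tr_eq _ g hx hy, tr_eq _ g hx hy, baseChange, baseChange, cancel_epi, cancel_mono] at h
  exact h

/-- Base change along the identity is idempotent, and inverse image along the identity is faithful;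
together these replace a coherence law for units. -/
theorem tr_one : tr φ (𝟙 T) x y = φ := by
  apply (Scheme.Modules.pullback (𝟙 T)).map_injective
  have hx : 𝟙 T ≫ x = x := Category.id_comp x
  have hy : 𝟙 T ≫ y = y := Category.id_comp y
  exact map_eq_map_of_tr_eq (𝟙 T) hx hy (tr_tr φ (𝟙 T) hx hy (𝟙 T) hx hy (Category.id_comp _))

theorem tr_map {V' : X.Modules} (a : V ⟶ V') (hx : g ≫ x = x') :
    tr ((Scheme.Modules.pullback x).map a) g x' x' = (Scheme.Modules.pullback x').map a := by
  have h := compIso_naturality hx a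
  rw [tr_eq _ g hx hx, baseChange, ← reassoc_of% h, Iso.hom_inv_id, Category.comp_id]

theorem tr_naturality {V' : X.Modules} {W' : Y.Modules} {a : V ⟶ V'} {b : W ⟶ W'}
    {φ : (Scheme.Modules.pullback x).obj V ⟶ (Scheme.Modules.pullback y).obj W}
    {φ' : (Scheme.Modules.pullback x).obj V' ⟶ (Scheme.Modules.pullback y).obj W'}
    (H : φ ≫ (Scheme.Modules.pullback y).map b = (Scheme.Modules.pullback x).map a ≫ φ')
    (hx : g ≫ x = x') (hy : g ≫ y = y') :
    tr φ g x' y' ≫ (Scheme.Modules.pullback y').map b =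
      (Scheme.Modules.pullback x').map a ≫ tr φ' g x' y' := by
  rw [← tr_map g b hy, ← tr_map g a hx, ← tr_comp φ g _ hx hy hy, H, tr_comp _ g _ hx hx hy]

theorem map_eq_of_pullback_map {V V' : X.Modules} {a a' : V ⟶ V'} (g : T ⟶ Z) (f : Z ⟶ X) (y : T ⟶ X)
    (hy : g ≫ f = y) (h : (Scheme.Modules.pullback f).map a = (Scheme.Modules.pullback f).map a') :
    (Scheme.Modules.pullback y).map a = (Scheme.Modules.pullback y).map a' := by
  rw [← tr_map g a hy, h, tr_map g a' hy]

section Local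

variable {I : Type u} {O : I → T.Opens} (hO : ⨆ i, O i = ⊤)
include hO

theorem tr_ext {φ φ' : (Scheme.Modules.pullback x).obj V ⟶ (Scheme.Modules.pullback y).obj W}
    (h : ∀ i, tr φ (O i).ι ((O i).ι ≫ x) ((O i).ι ≫ y) =
      tr φ' (O i).ι ((O i).ι ≫ x) ((O i).ι ≫ y)) : φ = φ' :=
  hom_ext_of_pullback hO fun i => map_eq_map_of_tr_eq (O i).ι rfl rfl (h i)

theorem isIso_of_tr {φ : (Scheme.Modules.pullback x).obj V ⟶ (Scheme.Modules.pullback y).obj W}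
    (h : ∀ i, IsIso (tr φ (O i).ι ((O i).ι ≫ x) ((O i).ι ≫ y))) : IsIso φ :=
  GluingDatum.isIso_of_isIso_pullback φ O hO fun i => isIso_of_isIso_tr φ (O i).ι rfl rfl (h i)

/-- Under the canonical isomorphisms the given morphisms become morphisms between restrictions of
x^* V and y^* W, to which gluing of morphisms applies. -/
theorem exists_tr (φ : ∀ i, (Scheme.Modules.pullback ((O i).ι ≫ x)).obj V ⟶
      (Scheme.Modules.pullback ((O i).ι ≫ y)).obj W)
    (h : ∀ (T' : Scheme.{u}) (i j : I) (a : T' ⟶ (O i).toScheme) (b : T' ⟶ (O j).toScheme)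
      (z : T' ⟶ T), a ≫ (O i).ι = z → b ≫ (O j).ι = z →
        tr (φ i) a (z ≫ x) (z ≫ y) = tr (φ j) b (z ≫ x) (z ≫ y)) :
    ∃ ψ : (Scheme.Modules.pullback x).obj V ⟶ (Scheme.Modules.pullback y).obj W,
      ∀ i, tr ψ (O i).ι ((O i).ι ≫ x) ((O i).ι ≫ y) = φ i := by
  have aux : ∀ {T' : Scheme.{u}} (i : I) (a : T' ⟶ (O i).toScheme) (z : T' ⟶ T)
      (ha : a ≫ (O i).ι = z) (hx : a ≫ (O i).ι ≫ x = z ≫ x) (hy : a ≫ (O i).ι ≫ y = z ≫ y),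
      baseChange (unComp rfl rfl (φ i)) a z z ha ha =
        unComp rfl rfl (baseChange (φ i) a (z ≫ x) (z ≫ y) hx hy) := fun i a z ha hx hy =>
    baseChange_unComp rfl rfl (φ i) a z z ha ha (z ≫ x) (z ≫ y) hx hy
  obtain ⟨ψ, hψ⟩ := exists_glueHom (M := (Scheme.Modules.pullback x).obj V)
    (N := (Scheme.Modules.pullback y).obj W) hO (α := fun i => unComp rfl rfl (φ i))
    fun T' i j a b z ha hb => by
      have e₁ : a ≫ (O i).ι ≫ x = z ≫ x := by rw [← ha, Category.assoc]
      have e₂ : a ≫ (O i).ι ≫ y = z ≫ y := by rw [← ha, Category.assoc]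
      have e₃ : b ≫ (O j).ι ≫ x = z ≫ x := by rw [← hb, Category.assoc]
      have e₄ : b ≫ (O j).ι ≫ y = z ≫ y := by rw [← hb, Category.assoc]
      have h₁ := h T' i j a b z ha hb
      rw [tr_eq _ a e₁ e₂, tr_eq _ b e₃ e₄] at h₁
      rw [aux i a z ha e₁ e₂, aux j b z hb e₃ e₄, h₁]
  refine ⟨ψ, fun i => ?_⟩
  rw [tr_eq _ _ rfl rfl, baseChange, hψ, unComp]
  simp

end Local

end Transport

/-! ### Composition in a groupoid scheme as a relation between scheme-valued points -/

section SchemePoints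

variable {S : Scheme.{u}} {T T' : Scheme.{u}}

/-- `l = g ∘ h` for scheme-valued points `g`, `h`, `l` of the scheme of morphisms of a groupoid. -/
def GroupoidObj.IsComp (𝒢 : GroupoidObj (Over S)) (g h l : T ⟶ 𝒢.mor.left) : Prop :=
  ∃ p : T ⟶ (pullback 𝒢.s 𝒢.t).left, p ≫ (pullback.fst 𝒢.s 𝒢.t).left = g ∧
    p ≫ (pullback.snd 𝒢.s 𝒢.t).left = h ∧ p ≫ 𝒢.m.left = l

namespace GroupoidObj

variable {𝒢 : GroupoidObj (Over S)}

theorem isComp_of_comp {T : Over S} (g h : T ⟶ 𝒢.mor) (w : g ≫ 𝒢.s = h ≫ 𝒢.t) :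
    𝒢.IsComp g.left h.left (𝒢.comp g h w).left :=
  ⟨(pullback.lift g h w).left, by rw [← Over.comp_left, pullback.lift_fst],
    by rw [← Over.comp_left, pullback.lift_snd], by rw [← Over.comp_left]; rfl⟩

/-- The test scheme `T` acquires a structure over `S` through `p`; the hypothesis on `f` makes `q` a
morphism over `S` for the same structure. -/
theorem left_ext {P Q R : Over S} {p q : T ⟶ P.left} (f : P ⟶ Q) (g : P ⟶ R)
    (H : ∀ {T : Over S} (a b : T ⟶ P), a ≫ f = b ≫ f → a ≫ g = b ≫ g → a = b)
    (hf : p ≫ f.left = q ≫ f.left) (hg : p ≫ g.left = q ≫ g.left) : p = q := by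
  let p' : Over.mk (p ≫ P.hom) ⟶ P := Over.homMk p
  let q' : Over.mk (p ≫ P.hom) ⟶ P := Over.homMk q (by
    change q ≫ P.hom = p ≫ P.hom
    rw [← Over.w f, ← Category.assoc, ← hf, Category.assoc])
  have h : p' = q' := H p' q' (Over.OverMorphism.ext hf) (Over.OverMorphism.ext hg)
  exact congr_arg (fun z => z.left) h

theorem IsComp.unique {g h l l' : T ⟶ 𝒢.mor.left} (H : 𝒢.IsComp g h l) (H' : 𝒢.IsComp g h l') :
    l = l' := by
  obtain ⟨p, rfl, rfl, rfl⟩ := H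
  obtain ⟨q, h₁, h₂, rfl⟩ := H'
  rw [left_ext (pullback.fst 𝒢.s 𝒢.t) (pullback.snd 𝒢.s 𝒢.t)
    (fun a b h₁ h₂ => pullback.hom_ext h₁ h₂) h₁ h₂]

/-- Composable points induce the same structure over `S` on `T`, so facts about points over `S`
apply to them. -/
theorem hom_eq_of_comp {g h : T ⟶ 𝒢.mor.left} (w : g ≫ 𝒢.s.left = h ≫ 𝒢.t.left) :
    h ≫ 𝒢.mor.hom = g ≫ 𝒢.mor.hom := by
  rw [← Over.w 𝒢.t, ← Category.assoc, ← w, Category.assoc, Over.w, Over.w]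

theorem exists_isComp (g h : T ⟶ 𝒢.mor.left) (w : g ≫ 𝒢.s.left = h ≫ 𝒢.t.left) :
    ∃ l, 𝒢.IsComp g h l :=
  let g' : Over.mk (g ≫ 𝒢.mor.hom) ⟶ 𝒢.mor := Over.homMk g
  let h' : Over.mk (g ≫ 𝒢.mor.hom) ⟶ 𝒢.mor := Over.homMk h (hom_eq_of_comp w)
  ⟨_, isComp_of_comp g' h' (Over.OverMorphism.ext w)⟩

theorem IsComp.w {g h l : T ⟶ 𝒢.mor.left} (H : 𝒢.IsComp g h l) : g ≫ 𝒢.s.left = h ≫ 𝒢.t.left := by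
  obtain ⟨p, rfl, rfl, rfl⟩ := H
  rw [Category.assoc, Category.assoc, ← Over.comp_left, ← Over.comp_left, pullback.condition]

theorem IsComp.s {g h l : T ⟶ 𝒢.mor.left} (H : 𝒢.IsComp g h l) : l ≫ 𝒢.s.left = h ≫ 𝒢.s.left := by
  obtain ⟨p, rfl, rfl, rfl⟩ := H
  rw [Category.assoc, Category.assoc, ← Over.comp_left, ← Over.comp_left, 𝒢.m_s]

theorem IsComp.t {g h l : T ⟶ 𝒢.mor.left} (H : 𝒢.IsComp g h l) : l ≫ 𝒢.t.left = g ≫ 𝒢.t.left := by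
  obtain ⟨p, rfl, rfl, rfl⟩ := H
  rw [Category.assoc, Category.assoc, ← Over.comp_left, ← Over.comp_left, 𝒢.m_t]

theorem IsComp.pre {g h l : T ⟶ 𝒢.mor.left} (H : 𝒢.IsComp g h l) (q : T' ⟶ T) :
    𝒢.IsComp (q ≫ g) (q ≫ h) (q ≫ l) := by
  obtain ⟨p, rfl, rfl, rfl⟩ := H
  exact ⟨q ≫ p, Category.assoc _ _ _, Category.assoc _ _ _, Category.assoc _ _ _⟩

theorem IsComp.map {𝒳 𝒴 : GroupoidObj (Over S)} (f : GroupoidHom 𝒳 𝒴) {g h l : T ⟶ 𝒳.mor.left}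
    (H : 𝒳.IsComp g h l) : 𝒴.IsComp (g ≫ f.f₁.left) (h ≫ f.f₁.left) (l ≫ f.f₁.left) := by
  obtain ⟨p, rfl, rfl, rfl⟩ := H
  refine ⟨p ≫ (pullback.map 𝒳.s 𝒳.t 𝒴.s 𝒴.t f.f₁ f.f₁ f.f₀ f.w_s.symm f.w_t.symm).left, ?_, ?_, ?_⟩
  · rw [Category.assoc, Category.assoc, ← Over.comp_left, ← Over.comp_left, pullback.lift_fst]
  · rw [Category.assoc, Category.assoc, ← Over.comp_left, ← Over.comp_left, pullback.lift_snd]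
  · rw [Category.assoc, Category.assoc, ← Over.comp_left, ← Over.comp_left, f.w_m]

theorem isComp_id (g : T ⟶ 𝒢.mor.left) : 𝒢.IsComp g (g ≫ 𝒢.s.left ≫ 𝒢.e.left) g := by
  let g' : Over.mk (g ≫ 𝒢.mor.hom) ⟶ 𝒢.mor := Over.homMk g
  have h := isComp_of_comp g' (g' ≫ 𝒢.s ≫ 𝒢.e) (by simp [𝒢.e_t])
  rwa [show 𝒢.comp g' (g' ≫ 𝒢.s ≫ 𝒢.e) (by simp [𝒢.e_t]) = g' from 𝒢.comp_id g'] at h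

theorem id_isComp (g : T ⟶ 𝒢.mor.left) : 𝒢.IsComp (g ≫ 𝒢.t.left ≫ 𝒢.e.left) g g := by
  let g' : Over.mk (g ≫ 𝒢.mor.hom) ⟶ 𝒢.mor := Over.homMk g
  have h := isComp_of_comp (g' ≫ 𝒢.t ≫ 𝒢.e) g' (by simp [𝒢.e_s])
  rwa [show 𝒢.comp (g' ≫ 𝒢.t ≫ 𝒢.e) g' (by simp [𝒢.e_s]) = g' from 𝒢.id_comp g'] at h

theorem inv_isComp (g : T ⟶ 𝒢.mor.left) :
    𝒢.IsComp (g ≫ 𝒢.i.left) g (g ≫ 𝒢.s.left ≫ 𝒢.e.left) := by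
  let g' : Over.mk (g ≫ 𝒢.mor.hom) ⟶ 𝒢.mor := Over.homMk g
  have h := isComp_of_comp (g' ≫ 𝒢.i) g' (by simp [𝒢.i_s])
  rwa [show 𝒢.comp (g' ≫ 𝒢.i) g' (by simp [𝒢.i_s]) = g' ≫ 𝒢.s ≫ 𝒢.e from 𝒢.inv_comp g'] at h

theorem isComp_inv (g : T ⟶ 𝒢.mor.left) :
    𝒢.IsComp g (g ≫ 𝒢.i.left) (g ≫ 𝒢.t.left ≫ 𝒢.e.left) := by
  let g' : Over.mk (g ≫ 𝒢.mor.hom) ⟶ 𝒢.mor := Over.homMk g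
  have h := isComp_of_comp g' (g' ≫ 𝒢.i) (by simp [𝒢.i_t])
  rwa [show 𝒢.comp g' (g' ≫ 𝒢.i) (by simp [𝒢.i_t]) = g' ≫ 𝒢.t ≫ 𝒢.e from 𝒢.comp_inv g'] at h

theorem e_s_left : 𝒢.e.left ≫ 𝒢.s.left = 𝟙 _ := by
  rw [← Over.comp_left, 𝒢.e_s, Over.id_left]

theorem e_t_left : 𝒢.e.left ≫ 𝒢.t.left = 𝟙 _ := by
  rw [← Over.comp_left, 𝒢.e_t, Over.id_left]

theorem i_s_left : 𝒢.i.left ≫ 𝒢.s.left = 𝒢.t.left := by rw [← Over.comp_left, 𝒢.i_s]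

/-- `f ∘ (g ∘ h) = (f ∘ g) ∘ h`. -/
theorem IsComp.assoc {f g h fg gh l : T ⟶ 𝒢.mor.left} (H₁ : 𝒢.IsComp f g fg) (H₂ : 𝒢.IsComp fg h l)
    (H₃ : 𝒢.IsComp g h gh) : 𝒢.IsComp f gh l := by
  let f' : Over.mk (f ≫ 𝒢.mor.hom) ⟶ 𝒢.mor := Over.homMk f
  let g' : Over.mk (f ≫ 𝒢.mor.hom) ⟶ 𝒢.mor := Over.homMk g (hom_eq_of_comp H₁.w)
  let h' : Over.mk (f ≫ 𝒢.mor.hom) ⟶ 𝒢.mor :=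
    Over.homMk h ((hom_eq_of_comp H₃.w).trans (hom_eq_of_comp H₁.w))
  have w₁ : f' ≫ 𝒢.s = g' ≫ 𝒢.t := Over.OverMorphism.ext H₁.w
  have w₂ : g' ≫ 𝒢.s = h' ≫ 𝒢.t := Over.OverMorphism.ext H₃.w
  have w₃ : 𝒢.comp f' g' w₁ ≫ 𝒢.s = h' ≫ 𝒢.t := by rw [𝒢.comp_s, w₂]
  have w₄ : f' ≫ 𝒢.s = 𝒢.comp g' h' w₂ ≫ 𝒢.t := by rw [𝒢.comp_t, w₁]
  have e₁ := IsComp.unique H₁ (isComp_of_comp f' g' w₁)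
  have e₂ := IsComp.unique H₃ (isComp_of_comp g' h' w₂)
  have h₁ := isComp_of_comp (𝒢.comp f' g' w₁) h' w₃
  have h₂ := isComp_of_comp f' (𝒢.comp g' h' w₂) w₄
  have h₃ : 𝒢.comp (𝒢.comp f' g' w₁) h' w₃ = 𝒢.comp f' (𝒢.comp g' h' w₂) w₄ := 𝒢.assoc _ _ _ w₁ w₂
  rw [← e₁, h₃] at h₁
  rw [← e₂, ← IsComp.unique H₂ h₁] at h₂
  exact h₂

/-- `(f ∘ g) ∘ h = f ∘ (g ∘ h)`. -/
theorem IsComp.assoc' {f g h fg gh l : T ⟶ 𝒢.mor.left} (H₁ : 𝒢.IsComp f g fg) (H₃ : 𝒢.IsComp g h gh)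
    (H₂ : 𝒢.IsComp f gh l) : 𝒢.IsComp fg h l := by
  obtain ⟨m, hm⟩ := exists_isComp fg h (by rw [H₁.s, H₃.w])
  rwa [H₂.unique (H₁.assoc hm H₃)]

/-- Left cancellation, by composing with the inverse of `g`. -/
theorem IsComp.cancel {g h h' l : T ⟶ 𝒢.mor.left} (H : 𝒢.IsComp g h l) (H' : 𝒢.IsComp g h' l) :
    h = h' := by
  have h₁ := id_isComp h
  have h₂ := id_isComp h'
  rw [← Category.assoc, ← H.w, Category.assoc] at h₁
  rw [← Category.assoc, ← H'.w, Category.assoc] at h₂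
  exact ((inv_isComp g).assoc h₁ H).unique ((inv_isComp g).assoc h₂ H')

/-- The solution of g ∘ h = l is g⁻¹ ∘ l. -/
theorem exists_isComp_eq (g l : T ⟶ 𝒢.mor.left) (w : g ≫ 𝒢.t.left = l ≫ 𝒢.t.left) :
    ∃ h, 𝒢.IsComp g h l := by
  obtain ⟨h, hh⟩ := exists_isComp (g ≫ 𝒢.i.left) l (by rw [Category.assoc, i_s_left, w])
  have h₁ := id_isComp l
  rw [← Category.assoc, ← w, Category.assoc] at h₁
  exact ⟨h, (isComp_inv g).assoc h₁ hh⟩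

end GroupoidObj

/-- The existence half of the cartesian square, evaluated at a point of the morphism scheme of 𝒴
whose source and target come from 𝒳. -/
theorem GroupoidHom.FullyFaithful.exists_lift {𝒳 𝒴 : GroupoidObj (Over S)} {f : GroupoidHom 𝒳 𝒴}
    (hf : f.FullyFaithful) (x x' : T ⟶ 𝒳.obj.left) (g : T ⟶ 𝒴.mor.left)
    (hs : g ≫ 𝒴.s.left = x ≫ f.f₀.left) (ht : g ≫ 𝒴.t.left = x' ≫ f.f₀.left) :
    ∃ h : T ⟶ 𝒳.mor.left, h ≫ f.f₁.left = g ∧ h ≫ 𝒳.s.left = x ∧ h ≫ 𝒳.t.left = x' := by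
  let g' : Over.mk (g ≫ 𝒴.mor.hom) ⟶ 𝒴.mor := Over.homMk g
  let y : Over.mk (g ≫ 𝒴.mor.hom) ⟶ 𝒳.obj := Over.homMk x (by
    change x ≫ 𝒳.obj.hom = g ≫ 𝒴.mor.hom
    rw [← Over.w f.f₀, ← Category.assoc, ← hs, Category.assoc, Over.w])
  let y' : Over.mk (g ≫ 𝒴.mor.hom) ⟶ 𝒳.obj := Over.homMk x' (by
    change x' ≫ 𝒳.obj.hom = g ≫ 𝒴.mor.hom
    rw [← Over.w f.f₀, ← Category.assoc, ← ht, Category.assoc, Over.w])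
  have hs' : g' ≫ 𝒴.s = y ≫ f.f₀ := Over.OverMorphism.ext hs
  have ht' : g' ≫ 𝒴.t = y' ≫ f.f₀ := Over.OverMorphism.ext ht
  have w : g' ≫ lift 𝒴.s 𝒴.t = lift y y' ≫ (f.f₀ ⊗ₘ f.f₀) := by
    rw [comp_lift, lift_map, hs', ht']
  have h₁ := IsPullback.lift_fst hf g' (lift y y') w
  have h₂ := IsPullback.lift_snd hf g' (lift y y') w
  have h₃ := congr_arg (fun z => z ≫ fst _ _) h₂
  have h₄ := congr_arg (fun z => z ≫ snd _ _) h₂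
  simp only [Category.assoc, lift_fst, lift_snd] at h₃ h₄
  exact ⟨(IsPullback.lift hf g' (lift y y') w).left, congr_arg (fun z => z.left) h₁,
    congr_arg (fun z => z.left) h₃, congr_arg (fun z => z.left) h₄⟩

theorem GroupoidHom.FullyFaithful.hom_ext {𝒳 𝒴 : GroupoidObj (Over S)} {f : GroupoidHom 𝒳 𝒴}
    (hf : f.FullyFaithful) {h h' : T ⟶ 𝒳.mor.left} (h₁ : h ≫ f.f₁.left = h' ≫ f.f₁.left)
    (hs : h ≫ 𝒳.s.left = h' ≫ 𝒳.s.left) (ht : h ≫ 𝒳.t.left = h' ≫ 𝒳.t.left) : h = h' := by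
  let p : Over.mk (h ≫ 𝒳.mor.hom) ⟶ 𝒳.mor := Over.homMk h
  let p' : Over.mk (h ≫ 𝒳.mor.hom) ⟶ 𝒳.mor := Over.homMk h' (by
    change h' ≫ 𝒳.mor.hom = h ≫ 𝒳.mor.hom
    rw [← Over.w 𝒳.s, ← Category.assoc, ← hs, Category.assoc])
  have e : p = p' := IsPullback.hom_ext hf (Over.OverMorphism.ext h₁) (by
    rw [comp_lift, comp_lift, show p ≫ 𝒳.s = p' ≫ 𝒳.s from Over.OverMorphism.ext hs,
      show p ≫ 𝒳.t = p' ≫ 𝒳.t from Over.OverMorphism.ext ht])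
  exact congr_arg (fun z => z.left) e

end SchemePoints

/-! ### The action of generalized morphisms on an equivariant vector bundle -/

section Act

variable {S : Scheme.{u}} {T T' : Scheme.{u}} {𝒢 : GroupoidObj (Over S)}

/-- The cocycle condition lives on the scheme of composable pairs; base change along the point `p`
of that scheme gives the identity for one pair. -/
theorem tr_comp_of_isCocycle {V : 𝒢.obj.left.Modules}
    {φ : (Scheme.Modules.pullback 𝒢.s.left).obj V ⟶ (Scheme.Modules.pullback 𝒢.t.left).obj V}
    (hφ : IsCocycle 𝒢 φ) {g h l : T ⟶ 𝒢.mor.left} (H : 𝒢.IsComp g h l) {x y z : T ⟶ 𝒢.obj.left}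
    (hx : h ≫ 𝒢.s.left = x) (hy : h ≫ 𝒢.t.left = y) (hz : g ≫ 𝒢.t.left = z) :
    tr φ h x y ≫ tr φ g y z = tr φ l x z := by
  have hy' := H.w.trans hy
  have hx' := H.s.trans hx
  have hz' := H.t.trans hz
  obtain ⟨p, rfl, rfl, rfl⟩ := H
  have h₁ : p ≫ (pullback.snd 𝒢.s 𝒢.t).left ≫ 𝒢.s.left = x := by rw [← hx, Category.assoc]
  have h₂ : p ≫ (pullback.fst 𝒢.s 𝒢.t).left ≫ 𝒢.s.left = y := by rw [← hy', Category.assoc]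
  have h₃ : p ≫ (pullback.fst 𝒢.s 𝒢.t).left ≫ 𝒢.t.left = z := by rw [← hz, Category.assoc]
  have e₁ : (pullback.snd 𝒢.s 𝒢.t).left ≫ 𝒢.t.left = (pullback.fst 𝒢.s 𝒢.t).left ≫ 𝒢.s.left := by
    rw [← Over.comp_left, ← pullback.condition, Over.comp_left]
  have e₂ : 𝒢.m.left ≫ 𝒢.s.left = (pullback.snd 𝒢.s 𝒢.t).left ≫ 𝒢.s.left := by
    rw [← Over.comp_left, 𝒢.m_s, Over.comp_left]
  have e₃ : 𝒢.m.left ≫ 𝒢.t.left = (pullback.fst 𝒢.s 𝒢.t).left ≫ 𝒢.t.left := by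
    rw [← Over.comp_left, 𝒢.m_t, Over.comp_left]
  have H := hφ
  rw [IsCocycle, ← tr_eq, ← tr_eq, ← tr_eq] at H
  have H' := congr_arg (fun ψ => tr ψ p x z) H
  simp only [tr_comp _ p _ h₁ h₂ h₃] at H'
  rw [tr_tr _ _ e₂ e₃ p h₁ h₃ rfl, tr_tr _ _ rfl e₁ p h₁ h₂ rfl, tr_tr _ _ rfl rfl p h₂ h₃ rfl] at H'
  exact H'.symm

/-- It suffices to take the universal composable pair, given by the identity of the scheme of
composable pairs. -/
theorem isCocycle_of_tr {V : 𝒢.obj.left.Modules}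
    {φ : (Scheme.Modules.pullback 𝒢.s.left).obj V ⟶ (Scheme.Modules.pullback 𝒢.t.left).obj V}
    (h : ∀ {T : Scheme.{u}} {g h l : T ⟶ 𝒢.mor.left} (_ : 𝒢.IsComp g h l) {x y z : T ⟶ 𝒢.obj.left}
    (_ : h ≫ 𝒢.s.left = x) (_ : h ≫ 𝒢.t.left = y) (_ : g ≫ 𝒢.t.left = z),
    tr φ h x y ≫ tr φ g y z = tr φ l x z) : IsCocycle 𝒢 φ := by
  have e₁ : (pullback.snd 𝒢.s 𝒢.t).left ≫ 𝒢.t.left = (pullback.fst 𝒢.s 𝒢.t).left ≫ 𝒢.s.left := by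
    rw [← Over.comp_left, ← pullback.condition, Over.comp_left]
  rw [IsCocycle, ← tr_eq, ← tr_eq, ← tr_eq]
  exact (h ⟨𝟙 _, Category.id_comp _, Category.id_comp _, Category.id_comp _⟩ rfl e₁ rfl).symm

/-- The isomorphism `x^* V ⟶ y^* V` given by a generalized morphism `g : x ⟶ y` and an equivariant vector
bundle. -/
noncomputable abbrev EquivariantVB.act (A : EquivariantVB 𝒢) (g : T ⟶ 𝒢.mor.left)
    (x y : T ⟶ 𝒢.obj.left) :
    (Scheme.Modules.pullback x).obj A.V ⟶ (Scheme.Modules.pullback y).obj A.V :=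
  tr A.φ g x y

namespace EquivariantVB

variable (A : EquivariantVB 𝒢)

theorem isIso_act {g : T ⟶ 𝒢.mor.left} {x y : T ⟶ 𝒢.obj.left} (hx : g ≫ 𝒢.s.left = x)
    (hy : g ≫ 𝒢.t.left = y) : IsIso (A.act g x y) := by
  have := A.isIso
  exact isIso_tr A.φ g hx hy

theorem act_comp {g h l : T ⟶ 𝒢.mor.left} (H : 𝒢.IsComp g h l) {x y z : T ⟶ 𝒢.obj.left}
    (hx : h ≫ 𝒢.s.left = x) (hy : h ≫ 𝒢.t.left = y) (hz : g ≫ 𝒢.t.left = z) :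
    A.act h x y ≫ A.act g y z = A.act l x z :=
  tr_comp_of_isCocycle A.cocycle H hx hy hz

/-- An identity composed with itself is itself, so its action is an idempotent isomorphism. -/
theorem act_e {g : T ⟶ 𝒢.mor.left} (x : T ⟶ 𝒢.obj.left) (hg : x ≫ 𝒢.e.left = g) : A.act g x x = 𝟙 _ := by
  subst hg
  have hs : (x ≫ 𝒢.e.left) ≫ 𝒢.s.left = x := by
    rw [Category.assoc, GroupoidObj.e_s_left, Category.comp_id]
  have ht : (x ≫ 𝒢.e.left) ≫ 𝒢.t.left = x := by
    rw [Category.assoc, GroupoidObj.e_t_left, Category.comp_id]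
  have h := GroupoidObj.isComp_id (x ≫ 𝒢.e.left)
  rw [← Category.assoc (x ≫ 𝒢.e.left), hs] at h
  have := A.isIso_act hs ht
  rw [← cancel_epi (A.act (x ≫ 𝒢.e.left) x x), A.act_comp h hs ht ht, Category.comp_id]

theorem act_pre (g : T ⟶ 𝒢.mor.left) {x y : T ⟶ 𝒢.obj.left} (hx : g ≫ 𝒢.s.left = x)
    (hy : g ≫ 𝒢.t.left = y) (q : T' ⟶ T) {x' y' : T' ⟶ 𝒢.obj.left} (hx' : q ≫ x = x')
    (hy' : q ≫ y = y') {g' : T' ⟶ 𝒢.mor.left} (w : q ≫ g = g') :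
    tr (A.act g x y) q x' y' = A.act g' x' y' :=
  tr_tr A.φ g hx hy q hx' hy' w

theorem act_map {A B : EquivariantVB 𝒢} (a : A ⟶ B) (g : T ⟶ 𝒢.mor.left) {x y : T ⟶ 𝒢.obj.left}
    (hx : g ≫ 𝒢.s.left = x) (hy : g ≫ 𝒢.t.left = y) :
    A.act g x y ≫ (Scheme.Modules.pullback y).map a.f =
      (Scheme.Modules.pullback x).map a.f ≫ B.act g x y :=
  tr_naturality g a.comm hx hy

end EquivariantVB

end Act

/-! ### Lifts, links, and full faithfulness of the pullback functor -/

section Descent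

variable {S : Scheme.{u}} {T T' : Scheme.{u}} {𝒳 𝒴 : GroupoidObj (Over S)}

theorem iSup_preimage {Y : Scheme.{u}} {I : Type*} {U : I → Y.Opens} (hU : ⨆ i, U i = ⊤) (y : T ⟶ Y) :
    ⨆ i, y ⁻¹ᵁ U i = ⊤ := by
  rw [← Scheme.Hom.preimage_iSup, hU, Scheme.Hom.preimage_top]

/-- A lift of a generalized object `y` of the target of `f`: a generalized object `x` of the source and
a morphism `c : f x ⟶ y`. -/
structure GroupoidHom.IsLift (f : GroupoidHom 𝒳 𝒴) (x : T ⟶ 𝒳.obj.left) (c : T ⟶ 𝒴.mor.left)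
    (y : T ⟶ 𝒴.obj.left) : Prop where
  s : c ≫ 𝒴.s.left = x ≫ f.f₀.left
  t : c ≫ 𝒴.t.left = y

/-- A morphism `h : x ⟶ x'` compatible with `c : f x ⟶ y` and `c' : f x' ⟶ y`. -/
structure GroupoidHom.IsLink (f : GroupoidHom 𝒳 𝒴) (x : T ⟶ 𝒳.obj.left) (c : T ⟶ 𝒴.mor.left)
    (x' : T ⟶ 𝒳.obj.left) (c' : T ⟶ 𝒴.mor.left) (h : T ⟶ 𝒳.mor.left) : Prop where
  s : h ≫ 𝒳.s.left = x
  t : h ≫ 𝒳.t.left = x'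
  comp : 𝒴.IsComp c' (h ≫ f.f₁.left) c

/-- Local lifts of the objects of the target of `f`. -/
structure GroupoidHom.LocalLifts (f : GroupoidHom 𝒳 𝒴) where
  I : Type u
  U : I → 𝒴.obj.left.Opens
  iSup_eq_top : ⨆ i, U i = ⊤
  x : ∀ i, (U i).toScheme ⟶ 𝒳.obj.left
  c : ∀ i, (U i).toScheme ⟶ 𝒴.mor.left
  isLift : ∀ i, f.IsLift (x i) (c i) (U i).ι

variable {f : GroupoidHom 𝒳 𝒴}

namespace GroupoidHom

theorem IsLift.pre {x : T ⟶ 𝒳.obj.left} {c : T ⟶ 𝒴.mor.left} {y : T ⟶ 𝒴.obj.left}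
    (H : f.IsLift x c y) (q : T' ⟶ T) : f.IsLift (q ≫ x) (q ≫ c) (q ≫ y) :=
  ⟨by rw [Category.assoc, H.s, Category.assoc], by rw [Category.assoc, H.t]⟩

theorem IsLink.pre {x x' : T ⟶ 𝒳.obj.left} {c c' : T ⟶ 𝒴.mor.left} {h : T ⟶ 𝒳.mor.left}
    (H : f.IsLink x c x' c' h) (q : T' ⟶ T) : f.IsLink (q ≫ x) (q ≫ c) (q ≫ x') (q ≫ c') (q ≫ h) :=
  ⟨by rw [Category.assoc, H.s], by rw [Category.assoc, H.t],
    by rw [Category.assoc]; exact H.comp.pre q⟩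

theorem IsLink.refl {x : T ⟶ 𝒳.obj.left} {c : T ⟶ 𝒴.mor.left} {y : T ⟶ 𝒴.obj.left}
    (H : f.IsLift x c y) : f.IsLink x c x c (x ≫ 𝒳.e.left) := by
  refine ⟨by rw [Category.assoc, GroupoidObj.e_s_left, Category.comp_id],
    by rw [Category.assoc, GroupoidObj.e_t_left, Category.comp_id], ?_⟩
  have h := GroupoidObj.isComp_id c
  rwa [← Category.assoc, H.s, Category.assoc, ← Over.comp_left, ← f.w_e, Over.comp_left,
    ← Category.assoc] at h

theorem IsLink.trans {x x' x'' : T ⟶ 𝒳.obj.left} {c c' c'' : T ⟶ 𝒴.mor.left} {h h' l : T ⟶ 𝒳.mor.left}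
    (H : f.IsLink x c x' c' h) (H' : f.IsLink x' c' x'' c'' h') (hl : 𝒳.IsComp h' h l) :
    f.IsLink x c x'' c'' l :=
  ⟨hl.s.trans H.s, hl.t.trans H'.t, H'.comp.assoc H.comp (hl.map f)⟩

theorem IsLink.postcomp {x x' : T ⟶ 𝒳.obj.left} {c c' g l l' : T ⟶ 𝒴.mor.left} {h : T ⟶ 𝒳.mor.left}
    (H : f.IsLink x c x' c' h) (hl : 𝒴.IsComp g c l) (hl' : 𝒴.IsComp g c' l') :
    f.IsLink x l x' l' h :=
  ⟨H.s, H.t, hl'.assoc' H.comp hl⟩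

theorem IsLift.postcomp {x : T ⟶ 𝒳.obj.left} {c g l : T ⟶ 𝒴.mor.left} {y : T ⟶ 𝒴.obj.left}
    (H : f.IsLift x c y) (hl : 𝒴.IsComp g c l) : f.IsLift x l (g ≫ 𝒴.t.left) :=
  ⟨hl.s.trans H.s, hl.t⟩

/-- The morphism c'⁻¹ ∘ c from f x to f x' comes from a morphism x → x', because `f` is full. -/
theorem FullyFaithful.exists_isLink (hf : f.FullyFaithful) {x x' : T ⟶ 𝒳.obj.left}
    {c c' : T ⟶ 𝒴.mor.left} {y : T ⟶ 𝒴.obj.left} (H : f.IsLift x c y) (H' : f.IsLift x' c' y) :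
    ∃ h, f.IsLink x c x' c' h := by
  obtain ⟨g, hg⟩ := GroupoidObj.exists_isComp_eq c' c (H'.t.trans H.t.symm)
  obtain ⟨h, rfl, h₂, h₃⟩ := hf.exists_lift x x' g (hg.s.symm.trans H.s) (hg.w.symm.trans H'.s)
  exact ⟨h, h₂, h₃, hg⟩

theorem FullyFaithful.isLink_unique (hf : f.FullyFaithful) {x x' : T ⟶ 𝒳.obj.left}
    {c c' : T ⟶ 𝒴.mor.left} {h h' : T ⟶ 𝒳.mor.left} (H : f.IsLink x c x' c' h)
    (H' : f.IsLink x c x' c' h') : h = h' :=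
  hf.hom_ext (H.comp.cancel H'.comp) (H.s.trans H'.s.symm) (H.t.trans H'.t.symm)

theorem LocalLifts.exists_isLift (D : f.LocalLifts) (y : T ⟶ 𝒴.obj.left) (i : D.I) :
    ∃ x c, f.IsLift x c ((y ⁻¹ᵁ D.U i).ι ≫ y) := by
  rw [← morphismRestrict_ι]
  exact ⟨_, _, (D.isLift i).pre _⟩

/-- Faithfulness: the action of a local lift `D.c i` conjugates the restriction of a morphism to
`D.U i` into its inverse image along `D.x i ≫ f₀`, which depends only on the inverse image along f₀.
-/
theorem LocalLifts.pullback_map_eq (D : f.LocalLifts) {A B : EquivariantVB 𝒴} {a a' : A ⟶ B}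
    (h : (Scheme.Modules.pullback f.f₀.left).map a.f = (Scheme.Modules.pullback f.f₀.left).map a'.f) :
    a = a' := by
  refine EquivariantVB.hom_ext _ _ (hom_ext_of_pullback D.iSup_eq_top fun i => ?_)
  have := A.isIso_act (D.isLift i).s (D.isLift i).t
  rw [← cancel_epi (A.act (D.c i) (D.x i ≫ f.f₀.left) (D.U i).ι), A.act_map a _ (D.isLift i).s (D.isLift i).t,
    A.act_map a' _ (D.isLift i).s (D.isLift i).t, map_eq_of_pullback_map _ _ _ rfl h]

/-! ### Descent of morphisms of equivariant vector bundles -/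

section Full

variable {A B : EquivariantVB 𝒴}
    (b : (Scheme.Modules.pullback f.f₀.left).obj A.V ⟶ (Scheme.Modules.pullback f.f₀.left).obj B.V)

theorem comp_tr_of_unComp_comp {X X' Y Y' Z : Scheme.{u}} {V V' : X.Modules} {W W' : X'.Modules}
    {s : Z ⟶ Y} {f : Y ⟶ X} {t : Z ⟶ Y'} {f' : Y' ⟶ X'} {x : Z ⟶ X} {y : Z ⟶ X'} (hs : s ≫ f = x)
    (ht : t ≫ f' = y)
    {ψ : (Scheme.Modules.pullback x).obj V ⟶ (Scheme.Modules.pullback y).obj W}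
    {ψ' : (Scheme.Modules.pullback x).obj V' ⟶ (Scheme.Modules.pullback y).obj W'}
    {p : (Scheme.Modules.pullback f).obj V ⟶ (Scheme.Modules.pullback f).obj V'}
    {q : (Scheme.Modules.pullback f').obj W ⟶ (Scheme.Modules.pullback f').obj W'}
    (H : unComp hs ht ψ ≫ (Scheme.Modules.pullback t).map q =
      (Scheme.Modules.pullback s).map p ≫ unComp hs ht ψ') :
    ψ ≫ tr q t y y = tr p s x x ≫ ψ' := by
  rw [unComp, unComp, Category.assoc, Category.assoc, Iso.inv_comp_eq] at H
  rw [tr_eq q t ht ht, tr_eq p s hs hs, baseChange, baseChange, reassoc_of% H]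
  simp only [Category.assoc, Iso.hom_inv_id, Category.comp_id]

/-- The equivariance of `b`, an identity over the whole morphism scheme of 𝒳, is evaluated at the
point `h`. -/
theorem tr_comp_act_of_comm
    (hb : pullbackφ f A.φ ≫ (Scheme.Modules.pullback 𝒳.t.left).map b =
      (Scheme.Modules.pullback 𝒳.s.left).map b ≫ pullbackφ f B.φ) {x x' : T ⟶ 𝒳.obj.left}
    (h : T ⟶ 𝒳.mor.left) {y y' : T ⟶ 𝒴.obj.left} (hs : h ≫ 𝒳.s.left = x) (ht : h ≫ 𝒳.t.left = x')
    (hy : x ≫ f.f₀.left = y) (hy' : x' ≫ f.f₀.left = y') :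
    A.act (h ≫ f.f₁.left) y y' ≫ tr b x' y' y' = tr b x y y ≫ B.act (h ≫ f.f₁.left) y y' := by
  have h₁ : A.act f.f₁.left (𝒳.s.left ≫ f.f₀.left) (𝒳.t.left ≫ f.f₀.left) ≫ tr b 𝒳.t.left _ _ =
      tr b 𝒳.s.left _ _ ≫ B.act f.f₁.left (𝒳.s.left ≫ f.f₀.left) (𝒳.t.left ≫ f.f₀.left) := by
    rw [EquivariantVB.act, EquivariantVB.act, tr_eq _ _ f.w_s_left f.w_t_left,
      tr_eq _ _ f.w_s_left f.w_t_left]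
    exact comp_tr_of_unComp_comp rfl rfl hb
  have e₁ : h ≫ 𝒳.s.left ≫ f.f₀.left = y := by rw [← hy, ← hs, Category.assoc]
  have e₂ : h ≫ 𝒳.t.left ≫ f.f₀.left = y' := by rw [← hy', ← ht, Category.assoc]
  have h₂ := congr_arg (fun z => tr z h y y') h₁
  simp only [tr_comp _ h _ e₁ e₂ e₂, tr_comp _ h _ e₁ e₁ e₂] at h₂
  rwa [tr_tr _ _ rfl rfl h e₂ e₂ ht, tr_tr _ _ rfl rfl h e₁ e₁ hs,
    tr_tr _ _ f.w_s_left f.w_t_left h e₁ e₂ rfl, tr_tr _ _ f.w_s_left f.w_t_left h e₁ e₂ rfl] at h₂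

/-- `α` is obtained from `x^* b` by transport along `c`. -/
def IsConj (x : T ⟶ 𝒳.obj.left) (c : T ⟶ 𝒴.mor.left) (y : T ⟶ 𝒴.obj.left)
    (α : (Scheme.Modules.pullback y).obj A.V ⟶ (Scheme.Modules.pullback y).obj B.V) : Prop :=
  A.act c (x ≫ f.f₀.left) y ≫ α =
    tr b x (x ≫ f.f₀.left) (x ≫ f.f₀.left) ≫ B.act c (x ≫ f.f₀.left) y

variable {b} {x x' : T ⟶ 𝒳.obj.left} {c c' : T ⟶ 𝒴.mor.left} {y : T ⟶ 𝒴.obj.left}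
    {α α' : (Scheme.Modules.pullback y).obj A.V ⟶ (Scheme.Modules.pullback y).obj B.V}

theorem IsConj.unique (H : IsConj b x c y α) (H' : IsConj b x c y α') (hl : f.IsLift x c y) : α = α' := by
  have := A.isIso_act hl.s hl.t
  rw [← cancel_epi (A.act c (x ≫ f.f₀.left) y)]
  exact Eq.trans H (Eq.symm H')

variable (b) in
theorem exists_isConj (hl : f.IsLift x c y) : ∃ α, IsConj b x c y α := by
  have := A.isIso_act hl.s hl.t
  exact ⟨inv (A.act c (x ≫ f.f₀.left) y) ≫ tr b x (x ≫ f.f₀.left) (x ≫ f.f₀.left) ≫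
    B.act c (x ≫ f.f₀.left) y, IsIso.hom_inv_id_assoc _ _⟩

theorem IsConj.pre (H : IsConj b x c y α) (hl : f.IsLift x c y) (q : T' ⟶ T) :
    IsConj b (q ≫ x) (q ≫ c) (q ≫ y) (tr α q (q ≫ y) (q ≫ y)) := by
  have h := congr_arg (fun z => tr z q ((q ≫ x) ≫ f.f₀.left) (q ≫ y)) H
  have e : q ≫ x ≫ f.f₀.left = (q ≫ x) ≫ f.f₀.left := (Category.assoc _ _ _).symm
  beta_reduce at h
  rw [tr_comp _ q _ e rfl rfl, tr_comp _ q _ e e rfl] at h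
  rw [A.act_pre c hl.s hl.t q e rfl rfl, B.act_pre c hl.s hl.t q e rfl rfl, tr_tr _ _ rfl rfl q e e rfl] at h
  exact h

/-- Since c' = c ∘ f(h) and `b` commutes with the action of f(h), conjugation by c' and by c gives
the same result. Thus the transported morphism depends on the point `y` only, not on its lift. -/
theorem IsConj.of_isLink
    (hb : pullbackφ f A.φ ≫ (Scheme.Modules.pullback 𝒳.t.left).map b =
      (Scheme.Modules.pullback 𝒳.s.left).map b ≫ pullbackφ f B.φ) 
    (H : IsConj b x c y α) {h : T ⟶ 𝒳.mor.left} (hh : f.IsLink x' c' x c h) (hl : f.IsLift x c y) :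
    IsConj b x' c' y α := by
  have e₁ : (h ≫ f.f₁.left) ≫ 𝒴.s.left = x' ≫ f.f₀.left := by
    rw [Category.assoc, f.w_s_left, ← hh.s, Category.assoc]
  have e₂ : (h ≫ f.f₁.left) ≫ 𝒴.t.left = x ≫ f.f₀.left := by
    rw [Category.assoc, f.w_t_left, ← hh.t, Category.assoc]
  rw [IsConj, ← A.act_comp hh.comp e₁ e₂ hl.t, Category.assoc, H,
    ← Category.assoc, tr_comp_act_of_comm b hb h hh.s hh.t rfl rfl, Category.assoc,
    B.act_comp hh.comp e₁ e₂ hl.t]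

theorem LocalLifts.exists_isConj (D : f.LocalLifts) (hf : f.FullyFaithful)
    (hb : pullbackφ f A.φ ≫ (Scheme.Modules.pullback 𝒳.t.left).map b =
      (Scheme.Modules.pullback 𝒳.s.left).map b ≫ pullbackφ f B.φ) :
    ∃ α : A.V ⟶ B.V, ∀ {T : Scheme.{u}} {x : T ⟶ 𝒳.obj.left} {c : T ⟶ 𝒴.mor.left}
      {y : T ⟶ 𝒴.obj.left}, f.IsLift x c y → IsConj b x c y ((Scheme.Modules.pullback y).map α) := by
  -- On each member of the cover `b` is conjugated by the chosen local lift.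
  choose α hα using fun i => GroupoidHom.exists_isConj b (D.isLift i)
  -- Independence of the lift: an arbitrary lift of a point of `D.U i` is linked to the pullback of
  -- the chosen one.
  have key : ∀ {T : Scheme.{u}} {x : T ⟶ 𝒳.obj.left} {c : T ⟶ 𝒴.mor.left} {y : T ⟶ 𝒴.obj.left}
      (_ : f.IsLift x c y) (i : D.I) (u : T ⟶ (D.U i).toScheme) (_ : u ≫ (D.U i).ι = y),
      IsConj b x c y (tr (α i) u y y) := by
    rintro T x c _ hl i u rfl
    obtain ⟨h, hh⟩ := hf.exists_isLink hl ((D.isLift i).pre u)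
    exact ((hα i).pre (D.isLift i) u).of_isLink hb hh ((D.isLift i).pre u)
  obtain ⟨a, ha⟩ := exists_glueHom D.iSup_eq_top (α := α) fun T i j u v y hu hv => by
    rw [← tr_eq, ← tr_eq]
    subst hu
    have hl := (D.isLift i).pre u
    exact (key hl i u rfl).unique (key hl j v hv) hl
  refine ⟨a, fun {T x c y} hl => tr_ext (iSup_preimage D.iSup_eq_top y) fun i => ?_⟩
  have h₁ := key (hl.pre (y ⁻¹ᵁ D.U i).ι) i (y ∣_ D.U i) (morphismRestrict_ι y (D.U i))
  rw [← ha, tr_map _ _ (morphismRestrict_ι y (D.U i))] at h₁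
  have e : (y ⁻¹ᵁ D.U i).ι ≫ x ≫ f.f₀.left = ((y ⁻¹ᵁ D.U i).ι ≫ x) ≫ f.f₀.left := (Category.assoc _ _ _).symm
  rw [e, tr_comp _ _ _ e rfl rfl, tr_comp _ _ _ e e rfl, A.act_pre c hl.s hl.t _ e rfl rfl,
    B.act_pre c hl.s hl.t _ e rfl rfl, tr_tr _ _ rfl rfl _ e e rfl, tr_map _ _ rfl]
  exact h₁

/-- Applying `exists_isConj` to suitable lifts yields both properties of the glued morphism: lifts
of the source and target of the universal morphism give equivariance, and the tautological lift of
f₀ gives back `b`. -/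
theorem LocalLifts.exists_equivariant (D : f.LocalLifts) (hf : f.FullyFaithful)
    (hb : pullbackφ f A.φ ≫ (Scheme.Modules.pullback 𝒳.t.left).map b =
      (Scheme.Modules.pullback 𝒳.s.left).map b ≫ pullbackφ f B.φ) :
    ∃ α : A.V ⟶ B.V, A.φ ≫ (Scheme.Modules.pullback 𝒴.t.left).map α =
      (Scheme.Modules.pullback 𝒴.s.left).map α ≫ B.φ ∧
        (Scheme.Modules.pullback f.f₀.left).map α = b := by
  obtain ⟨α, hα⟩ := D.exists_isConj hf hb
  refine ⟨α, ?_, ?_⟩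
  · refine tr_ext (iSup_preimage D.iSup_eq_top 𝒴.s.left) fun i => ?_
    obtain ⟨x, c, hl⟩ := D.exists_isLift 𝒴.s.left i
    -- Composing a lift `c` of the source of the universal morphism with that morphism gives a lift
    -- of its target with the same `x`. Comparing the two conjugation identities isolates the action
    -- of the universal morphism.
    obtain ⟨l, hc⟩ := GroupoidObj.exists_isComp (𝒴.s.left ⁻¹ᵁ D.U i).ι c hl.t.symm
    have h₁ := hα hl
    have h₂ := hα (hl.postcomp hc)
    have := A.isIso_act hl.s hl.t
    rw [IsConj] at h₁ h₂
    rw [tr_comp _ _ _ rfl rfl rfl, tr_comp _ _ _ rfl rfl rfl, tr_map _ _ rfl, tr_map _ _ rfl,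
      ← cancel_epi (A.act c (x ≫ f.f₀.left) ((𝒴.s.left ⁻¹ᵁ D.U i).ι ≫ 𝒴.s.left)), ← Category.assoc,
      A.act_comp hc hl.s hl.t rfl, h₂, reassoc_of% h₁, B.act_comp hc hl.s hl.t rfl]
  -- For the lift of f₀ by the identity, both conjugating isomorphisms are trivial.
  · have e : (f.f₀.left ≫ 𝒴.e.left) ≫ 𝒴.s.left = 𝟙 _ ≫ f.f₀.left := by
      rw [Category.assoc, GroupoidObj.e_s_left, Category.comp_id, Category.id_comp]
    have h := hα (x := 𝟙 _) (c := f.f₀.left ≫ 𝒴.e.left) (y := f.f₀.left)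
      ⟨e, by rw [Category.assoc, GroupoidObj.e_t_left, Category.comp_id]⟩
    rwa [IsConj, Category.id_comp, A.act_e _ rfl, B.act_e _ rfl, tr_one, Category.id_comp,
      Category.comp_id] at h

theorem LocalLifts.exists_map_eq (D : f.LocalLifts) (hf : f.FullyFaithful)
    (b : (pullbackVB f).obj A ⟶ (pullbackVB f).obj B) : ∃ a : A ⟶ B, (pullbackVB f).map a = b := by
  obtain ⟨α, h, hα⟩ := D.exists_equivariant hf b.comm
  exact ⟨⟨α, h⟩, EquivariantVB.hom_ext _ _ hα⟩

end Full

end GroupoidHom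
end Descent

/-! ### Descent of equivariant vector bundles: gluing the underlying module -/

section EssSurj

variable {S : Scheme.{u}} {T T' : Scheme.{u}} {𝒳 𝒴 : GroupoidObj (Over S)} {f : GroupoidHom 𝒳 𝒴}

namespace GroupoidHom

/-- The composite of two links is a link, hence equals the given third one by uniqueness. -/
theorem IsLink.act_comp {x x' x'' : T ⟶ 𝒳.obj.left} {c c' c'' : T ⟶ 𝒴.mor.left}
    {h h' l : T ⟶ 𝒳.mor.left} (H : f.IsLink x c x' c' h) (H' : f.IsLink x' c' x'' c'' h')
    (H'' : f.IsLink x c x'' c'' l) (hf : f.FullyFaithful) (W : EquivariantVB 𝒳) :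
    W.act h x x' ≫ W.act h' x' x'' = W.act l x x'' := by
  obtain ⟨m, hm⟩ := GroupoidObj.exists_isComp h' h (H'.s.trans H.t.symm)
  rw [hf.isLink_unique H'' (H.trans H' hm), W.act_comp hm H.s H.t H'.t]

/-- A sheaf of modules `N` on the objects of `𝒴` that restricts locally to the inverse images of an
equivariant vector bundle on `𝒳`. -/
structure LocalComparison (D : f.LocalLifts) (W : EquivariantVB 𝒳) (N : 𝒴.obj.left.Modules) where
  β : ∀ i, (Scheme.Modules.pullback (D.U i).ι).obj N ⟶ (Scheme.Modules.pullback (D.x i)).obj W.V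
  isIso : ∀ i, IsIso (β i)
  compatible : ∀ {T : Scheme.{u}} (i j : D.I) (u : T ⟶ (D.U i).toScheme) (v : T ⟶ (D.U j).toScheme)
    (y : T ⟶ 𝒴.obj.left) (_ : u ≫ (D.U i).ι = y) (_ : v ≫ (D.U j).ι = y) (l : T ⟶ 𝒳.mor.left)
    (_ : f.IsLink (u ≫ D.x i) (u ≫ D.c i) (v ≫ D.x j) (v ≫ D.c j) l),
    tr (β i) u y (u ≫ D.x i) ≫ W.act l (u ≫ D.x i) (v ≫ D.x j) = tr (β j) v y (v ≫ D.x j)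

theorem LocalLifts.exists_localComparison (D : f.LocalLifts) (hf : f.FullyFaithful)
    (W : EquivariantVB 𝒳) : ∃ N, Nonempty (LocalComparison D W N) := by
  have H {T : Scheme.{u}} (i j : D.I) (u : T ⟶ (D.U i).toScheme) (v : T ⟶ (D.U j).toScheme)
      (h : u ≫ (D.U i).ι = v ≫ (D.U j).ι) :
      ∃ l, f.IsLink (u ≫ D.x i) (u ≫ D.c i) (v ≫ D.x j) (v ≫ D.c j) l :=
    hf.exists_isLink ((D.isLift i).pre u) (by rw [h]; exact (D.isLift j).pre v)
  -- The links between pullbacks of the chosen lifts act on `W` as transition isomorphisms; their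
  -- uniqueness gives compatibility with base change, the identity law and the cocycle condition.
  choose l hl using @H
  let G : GluingDatum 𝒴.obj.left W.V D.I :=
    { U := D.U
      x := D.x
      θ i j u v h := W.act (l i j u v h) (u ≫ D.x i) (v ≫ D.x j)
      θ_nat g i j u v h u' v' hu hv h' hu' hv' := by
        have h₁ := (hl i j u v h).pre g
        have h₂ := hl i j u' v' h'
        rw [hu', hv', ← Category.assoc, ← Category.assoc, hu, hv] at h₁
        rw [← tr_eq]
        exact W.act_pre _ (hl i j u v h).s (hl i j u v h).t g hu' hv' (hf.isLink_unique h₁ h₂)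
      θ_id i u := W.act_e _ (hf.isLink_unique (IsLink.refl ((D.isLift i).pre u)) (hl i i u u rfl))
      θ_comp i j m u v w h h' := (hl i j u v h).act_comp (hl j m v w h') (hl i m u w (h.trans h')) hf W }
  obtain ⟨E⟩ := G.nonempty_glued
  refine ⟨E.pt, ⟨⟨GluingDatum.β E, GluingDatum.isIso_β E, ?_⟩⟩⟩
  intro T i j u v y hu hv m hm
  have h := GluingDatum.isCompatible_β E i j u v y hu hv (hu.trans hv.symm)
  rw [← tr_eq, ← tr_eq] at h
  rw [hf.isLink_unique hm (hl i j u v (hu.trans hv.symm))]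
  exact h

namespace LocalComparison

variable {D : f.LocalLifts} {W : EquivariantVB 𝒳} {N : 𝒴.obj.left.Modules}
    (L : LocalComparison D W N) {x x' : T ⟶ 𝒳.obj.left} {c c' : T ⟶ 𝒴.mor.left} {y : T ⟶ 𝒴.obj.left}

/-- The comparison of y^* N with x^* W obtained through the chart `i` agrees with the one through
the chart `j`, as the links form a commutative triangle. -/
theorem tr_comp_act_eq (hf : f.FullyFaithful) {i j : D.I} {u : T ⟶ (D.U i).toScheme}
    {v : T ⟶ (D.U j).toScheme} (hu : u ≫ (D.U i).ι = y) (hv : v ≫ (D.U j).ι = y)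
    {l m : T ⟶ 𝒳.mor.left} (hl : f.IsLink (u ≫ D.x i) (u ≫ D.c i) x c l)
    (hm : f.IsLink (v ≫ D.x j) (v ≫ D.c j) x c m) :
    tr (L.β i) u y (u ≫ D.x i) ≫ W.act l (u ≫ D.x i) x =
      tr (L.β j) v y (v ≫ D.x j) ≫ W.act m (v ≫ D.x j) x := by
  obtain ⟨n, hn⟩ := hf.exists_isLink ((D.isLift i).pre u) (by rw [hu, ← hv]; exact (D.isLift j).pre v)
  rw [← hn.act_comp hm hl hf W, ← Category.assoc, L.compatible i j u v y hu hv n hn]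

/-- `B` is the comparison of `y^* N` with `x^* W` determined by a lift `(x, c)` of `y`. -/
def IsComparison (x : T ⟶ 𝒳.obj.left) (c : T ⟶ 𝒴.mor.left) (y : T ⟶ 𝒴.obj.left)
    (B : (Scheme.Modules.pullback y).obj N ⟶ (Scheme.Modules.pullback x).obj W.V) : Prop :=
  ∀ ⦃T' : Scheme.{u}⦄ (q : T' ⟶ T) (x' : T' ⟶ 𝒳.obj.left) (c' : T' ⟶ 𝒴.mor.left)
    (y' : T' ⟶ 𝒴.obj.left) (_ : q ≫ x = x') (_ : q ≫ c = c') (_ : q ≫ y = y') (i : D.I)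
    (u : T' ⟶ (D.U i).toScheme) (_ : u ≫ (D.U i).ι = y') (l : T' ⟶ 𝒳.mor.left)
    (_ : f.IsLink (u ≫ D.x i) (u ≫ D.c i) x' c' l),
    tr B q y' x' = tr (L.β i) u y' (u ≫ D.x i) ≫ W.act l (u ≫ D.x i) x'

variable {L} {B B' : (Scheme.Modules.pullback y).obj N ⟶ (Scheme.Modules.pullback x).obj W.V}

theorem exists_isLink_restrict (hf : f.FullyFaithful) (hl : f.IsLift x c y) (i : D.I) :
    ∃ l, f.IsLink ((y ∣_ D.U i) ≫ D.x i) ((y ∣_ D.U i) ≫ D.c i) ((y ⁻¹ᵁ D.U i).ι ≫ x)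
      ((y ⁻¹ᵁ D.U i).ι ≫ c) l :=
  hf.exists_isLink (y := (y ⁻¹ᵁ D.U i).ι ≫ y)
    (by rw [← morphismRestrict_ι]; exact (D.isLift i).pre _) (hl.pre _)

/-- Over the inverse image of each `D.U i` there is a link from the chosen lift, and the defining
formula then leaves no choice. -/
theorem IsComparison.unique (hf : f.FullyFaithful) (hl : f.IsLift x c y)
    (H : L.IsComparison x c y B) (H' : L.IsComparison x c y B') : B = B' := by
  refine tr_ext (iSup_preimage D.iSup_eq_top y) fun i => ?_
  obtain ⟨l, h⟩ := exists_isLink_restrict hf hl i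
  rw [H _ _ _ _ rfl rfl rfl i _ (morphismRestrict_ι y (D.U i)) l h,
    H' _ _ _ _ rfl rfl rfl i _ (morphismRestrict_ι y (D.U i)) l h]

theorem IsComparison.isIso (hf : f.FullyFaithful) (hl : f.IsLift x c y)
    (H : L.IsComparison x c y B) : IsIso B := by
  refine isIso_of_tr (iSup_preimage D.iSup_eq_top y) fun i => ?_
  obtain ⟨l, h⟩ := exists_isLink_restrict hf hl i
  rw [H _ _ _ _ rfl rfl rfl i _ (morphismRestrict_ι y (D.U i)) l h]
  have := L.isIso i
  have h₁ : IsIso (tr (L.β i) (y ∣_ D.U i) ((y ⁻¹ᵁ D.U i).ι ≫ y) ((y ∣_ D.U i) ≫ D.x i)) :=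
    isIso_tr (L.β i) (y ∣_ D.U i) (morphismRestrict_ι y (D.U i)) rfl
  exact IsIso.comp_isIso' h₁ (W.isIso_act h.s h.t)

theorem IsComparison.pre (H : L.IsComparison x c y B) (q : T' ⟶ T) {x' : T' ⟶ 𝒳.obj.left}
    {c' : T' ⟶ 𝒴.mor.left} {y' : T' ⟶ 𝒴.obj.left} (hx : q ≫ x = x') (hc : q ≫ c = c')
    (hy : q ≫ y = y') : L.IsComparison x' c' y' (tr B q y' x') := by
  intro T'' r x'' c'' y'' hx' hc' hy' i u hu l hl
  rw [tr_tr B q hy hx r hy' hx' rfl]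
  exact H (r ≫ q) x'' c'' y'' (by rw [Category.assoc, hx, hx']) (by rw [Category.assoc, hc, hc'])
    (by rw [Category.assoc, hy, hy']) i u hu l hl

/-- The link from a chosen lift to (x', c') is the link to (x, c) followed by `h`. -/
theorem IsComparison.comp_act (hf : f.FullyFaithful) (hl : f.IsLift x c y)
    (H : L.IsComparison x c y B) {h : T ⟶ 𝒳.mor.left}
    (hh : f.IsLink x c x' c' h) : L.IsComparison x' c' y (B ≫ W.act h x x') := by
  intro T' q _ _ _ rfl rfl rfl i u hu l hl'
  obtain ⟨n, hn⟩ := hf.exists_isLink ((D.isLift i).pre u) (by rw [hu]; exact hl.pre q)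
  rw [tr_comp _ _ _ rfl rfl rfl, W.act_pre h hh.s hh.t q rfl rfl rfl,
    H q _ _ _ rfl rfl rfl i u hu n hn, Category.assoc, hn.act_comp (hh.pre q) hl' hf W]

-- Over the inverse image of `D.U i` the comparison is the local one followed by the action of a
-- link; by `tr_comp_act_eq` these pieces agree on overlaps and glue.
variable (L) in
theorem exists_isComparison (hf : f.FullyFaithful) (hl : f.IsLift x c y) :
    ∃ B, L.IsComparison x c y B := by
  choose l h using exists_isLink_restrict (D := D) hf hl
  -- The base change of the `i`-th local piece is of the same shape, with a pulled back chart and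
  -- link, so `tr_comp_act_eq` applies to it.
  have hφ {T' : Scheme.{u}} (i : D.I) (a : T' ⟶ (y ⁻¹ᵁ D.U i).toScheme) (z : T' ⟶ T)
      (ha : a ≫ (y ⁻¹ᵁ D.U i).ι = z) :
      tr (tr (L.β i) (y ∣_ D.U i) ((y ⁻¹ᵁ D.U i).ι ≫ y) ((y ∣_ D.U i) ≫ D.x i) ≫
        W.act (l i) ((y ∣_ D.U i) ≫ D.x i) ((y ⁻¹ᵁ D.U i).ι ≫ x)) a (z ≫ y) (z ≫ x) =
      tr (L.β i) (a ≫ (y ∣_ D.U i)) (z ≫ y) ((a ≫ (y ∣_ D.U i)) ≫ D.x i) ≫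
        W.act (a ≫ l i) ((a ≫ (y ∣_ D.U i)) ≫ D.x i) (z ≫ x) ∧
      (a ≫ (y ∣_ D.U i)) ≫ (D.U i).ι = z ≫ y ∧
      f.IsLink ((a ≫ (y ∣_ D.U i)) ≫ D.x i) ((a ≫ (y ∣_ D.U i)) ≫ D.c i) (z ≫ x) (z ≫ c) (a ≫ l i) := by
    have e₁ : a ≫ (y ⁻¹ᵁ D.U i).ι ≫ y = z ≫ y := by rw [← ha, Category.assoc]
    have e₂ : a ≫ (y ⁻¹ᵁ D.U i).ι ≫ x = z ≫ x := by rw [← ha, Category.assoc]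
    have e₃ : a ≫ (y ∣_ D.U i) ≫ D.x i = (a ≫ (y ∣_ D.U i)) ≫ D.x i := (Category.assoc _ _ _).symm
    have e₄ : a ≫ (y ∣_ D.U i) ≫ D.c i = (a ≫ (y ∣_ D.U i)) ≫ D.c i := (Category.assoc _ _ _).symm
    have e₅ : a ≫ (y ⁻¹ᵁ D.U i).ι ≫ c = z ≫ c := by rw [← ha, Category.assoc]
    refine ⟨?_, by rw [Category.assoc, morphismRestrict_ι, e₁], ?_⟩
    · rw [tr_comp _ a _ e₁ e₃ e₂, tr_tr _ _ (morphismRestrict_ι y (D.U i)) rfl a e₁ e₃ rfl,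
        W.act_pre _ (h i).s (h i).t a e₃ e₂ rfl]
    · have h₁ := (h i).pre a
      rwa [e₂, e₃, e₄, e₅] at h₁
  obtain ⟨B, hB⟩ := exists_tr (x := y) (y := x) (iSup_preimage D.iSup_eq_top y) (V := N) (W := W.V)
    (fun i => tr (L.β i) (y ∣_ D.U i) ((y ⁻¹ᵁ D.U i).ι ≫ y) ((y ∣_ D.U i) ≫ D.x i) ≫
      W.act (l i) ((y ∣_ D.U i) ≫ D.x i) ((y ⁻¹ᵁ D.U i).ι ≫ x))
    fun T' i j a b z ha hb => by
      obtain ⟨h₁, h₂, h₃⟩ := hφ i a z ha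
      obtain ⟨h₁', h₂', h₃'⟩ := hφ j b z hb
      rw [h₁, h₁', L.tr_comp_act_eq hf h₂ h₂' h₃ h₃']
  refine ⟨B, ?_⟩
  intro T' q _ _ _ rfl rfl rfl i u hu m hm
  -- The point q ≫ y lies in `D.U i`, so `q` factors through the open subset on which the `i`-th
  -- piece is defined.
  have hq : Set.range q ⊆ Set.range (y ⁻¹ᵁ D.U i).ι := by
    rintro _ ⟨t, rfl⟩
    have h₁ : (u ≫ (D.U i).ι) t ∈ Set.range (D.U i).ι := ⟨u t, by rw [← Scheme.Hom.comp_apply]⟩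
    rw [hu] at h₁
    rw [Scheme.Opens.range_ι] at h₁ ⊢
    exact h₁
  have ha := IsOpenImmersion.lift_fac (y ⁻¹ᵁ D.U i).ι q hq
  obtain ⟨h₁, h₂, h₃⟩ := hφ i _ q ha
  rw [L.tr_comp_act_eq hf hu h₂ hm h₃, ← h₁, ← hB i]
  refine (tr_tr B (y ⁻¹ᵁ D.U i).ι rfl rfl _ ?_ ?_ ha).symm <;> rw [← Category.assoc, ha]

end LocalComparison

/-- A sheaf of modules `N` on the objects of `𝒴` whose inverse images along generalized objects `y` are
compared with the inverse images of an equivariant vector bundle on `𝒳` along the lifts of `y`. -/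
structure Comparison (f : GroupoidHom 𝒳 𝒴) (W : EquivariantVB 𝒳) (N : 𝒴.obj.left.Modules) where
  β : ∀ {T : Scheme.{u}} (x : T ⟶ 𝒳.obj.left) (_ : T ⟶ 𝒴.mor.left) (y : T ⟶ 𝒴.obj.left),
    (Scheme.Modules.pullback y).obj N ⟶ (Scheme.Modules.pullback x).obj W.V
  isIso : ∀ {T : Scheme.{u}} {x : T ⟶ 𝒳.obj.left} {c : T ⟶ 𝒴.mor.left} {y : T ⟶ 𝒴.obj.left},
    f.IsLift x c y → IsIso (β x c y)
  pre : ∀ {T T' : Scheme.{u}} {x : T ⟶ 𝒳.obj.left} {c : T ⟶ 𝒴.mor.left} {y : T ⟶ 𝒴.obj.left}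
    (_ : f.IsLift x c y) (q : T' ⟶ T) {x' : T' ⟶ 𝒳.obj.left} {c' : T' ⟶ 𝒴.mor.left}
    {y' : T' ⟶ 𝒴.obj.left} (_ : q ≫ x = x') (_ : q ≫ c = c') (_ : q ≫ y = y'),
    tr (β x c y) q y' x' = β x' c' y'
  comp_act : ∀ {T : Scheme.{u}} {x x' : T ⟶ 𝒳.obj.left} {c c' : T ⟶ 𝒴.mor.left} {y : T ⟶ 𝒴.obj.left}
    {h : T ⟶ 𝒳.mor.left}, f.IsLift x c y → f.IsLift x' c' y → f.IsLink x c x' c' h →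
      β x c y ≫ W.act h x x' = β x' c' y

-- Comparisons exist for all lifts and are unique; the value zero for triples that are not lifts
-- only makes the choice total. Compatibility with base change and with links then follows from
-- uniqueness.
open Classical in
theorem LocalComparison.nonempty_comparison {D : f.LocalLifts} {W : EquivariantVB 𝒳}
    {N : 𝒴.obj.left.Modules} (L : LocalComparison D W N) (hf : f.FullyFaithful) :
    Nonempty (Comparison f W N) := by
  have H {T : Scheme.{u}} (x : T ⟶ 𝒳.obj.left) (c : T ⟶ 𝒴.mor.left) (y : T ⟶ 𝒴.obj.left) :
      ∃ B, f.IsLift x c y → L.IsComparison x c y B := by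
    by_cases h : f.IsLift x c y
    · exact (L.exists_isComparison hf h).imp fun _ h _ => h
    · exact ⟨0, fun h' => absurd h' h⟩
  choose β hβ using @H
  refine ⟨⟨β, fun h => (hβ _ _ _ h).isIso hf h, fun {T T' x c y} h q {x' c' y'} hx hc hy => ?_,
    fun h h' hh => ((hβ _ _ _ h).comp_act hf h hh).unique hf h' (hβ _ _ _ h')⟩⟩
  have h' : f.IsLift x' c' y' := by
    subst hx hc hy
    exact h.pre q
  exact ((hβ _ _ _ h).pre q hx hc hy).unique hf h' (hβ _ _ _ h')

end GroupoidHom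

end EssSurj

/-! ### Local freeness is local on the base -/

section LocallyFree

theorem nonempty_pullback_free_iso {X Y : Scheme.{u}} (f : X ⟶ Y) (n : ℕ) :
    Nonempty ((Scheme.Modules.pullback f).obj
      (SheafOfModules.free (R := Y.ringCatSheaf) (ULift.{u} (Fin n)) : Y.Modules) ≅
        (SheafOfModules.free (R := X.ringCatSheaf) (ULift.{u} (Fin n)) : X.Modules)) := by
  -- The inverse image functor on open subsets is final because the whole space maps to the whole
  -- space, so any two structured arrows are joined through ⊤. This is what lets inverse images
  -- preserve free modules.
  have : (TopologicalSpace.Opens.map f.base).Final := by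
    constructor
    intro V
    have : Nonempty (StructuredArrow V (TopologicalSpace.Opens.map f.base)) :=
      ⟨StructuredArrow.mk (Y := ⊤) (homOfLE le_top)⟩
    refine zigzag_isConnected fun A B => ?_
    let T : StructuredArrow V (TopologicalSpace.Opens.map f.base) :=
      StructuredArrow.mk (Y := ⊤) (homOfLE le_top)
    exact (Zigzag.of_hom (StructuredArrow.homMk (homOfLE le_top) : A ⟶ T)).trans
      (Zigzag.of_inv (StructuredArrow.homMk (homOfLE le_top) : B ⟶ T))
  have : (SheafOfModules.pushforward.{u} f.toRingCatSheafHom).IsRightAdjoint :=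
    inferInstanceAs (Scheme.Modules.pushforward f).IsRightAdjoint
  exact ⟨SheafOfModules.pullbackObjFreeIso f.toRingCatSheafHom (ULift.{u} (Fin n))⟩

theorem IsVectorBundle.of_iso {X : Scheme.{u}} {M N : X.Modules} (e : M ≅ N) (hM : IsVectorBundle M) :
    IsVectorBundle N := by
  intro x
  obtain ⟨U, hU, n, ⟨e'⟩⟩ := hM x
  exact ⟨U, hU, n, ⟨(Scheme.Modules.restrictFunctor U.ι).mapIso e.symm ≪≫ e'⟩⟩

theorem IsVectorBundle.of_pullback {Y : Scheme.{u}} {N : Y.Modules} {I : Type*} {U : I → Y.Opens}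
    (hU : ⨆ i, U i = ⊤) (h : ∀ i, IsVectorBundle ((Scheme.Modules.pullback (U i).ι).obj N)) :
    IsVectorBundle N := by
  intro y
  have hy : y ∈ ⨆ i, U i := by rw [hU]; trivial
  obtain ⟨i, hi⟩ := TopologicalSpace.Opens.mem_iSup.mp hy
  obtain ⟨V, hV, n, ⟨e⟩⟩ := h i ⟨y, hi⟩
  -- The trivializing open subset of `U i` is regarded as an open subset of `Y`; `g` compares the
  -- two resulting open subschemes.
  have hr : Set.range ((U i).ι ''ᵁ V).ι ⊆ Set.range (V.ι ≫ (U i).ι) := by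
    rw [Scheme.Opens.range_ι]
    rintro _ ⟨v, hv, rfl⟩
    exact ⟨⟨v, hv⟩, rfl⟩
  let g := IsOpenImmersion.lift (V.ι ≫ (U i).ι) ((U i).ι ''ᵁ V).ι hr
  have hg : g ≫ V.ι ≫ (U i).ι = ((U i).ι ''ᵁ V).ι := IsOpenImmersion.lift_fac _ _ _
  obtain ⟨e'⟩ := nonempty_pullback_free_iso g n
  exact ⟨(U i).ι ''ᵁ V, ⟨⟨y, hi⟩, hV, rfl⟩, n,
    ⟨(Scheme.Modules.restrictFunctorIsoPullback ((U i).ι ''ᵁ V).ι).app N ≪≫ compIso hg N ≪≫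
      (Scheme.Modules.pullback g).mapIso (compIso rfl N ≪≫
        ((Scheme.Modules.restrictFunctorIsoPullback V.ι).app _).symm ≪≫ e) ≪≫ e'⟩⟩

end LocallyFree

/-! ### Descent of equivariant vector bundles: constructing the action -/

section EssSurj

variable {S : Scheme.{u}} {T T' : Scheme.{u}} {𝒳 𝒴 : GroupoidObj (Over S)} {f : GroupoidHom 𝒳 𝒴}

/-- A morphism of equivariant vector bundles is an isomorphism if the underlying morphism is. -/
noncomputable def EquivariantVB.isoOfIsIso {A B : EquivariantVB 𝒳} (a : A.V ⟶ B.V) [IsIso a]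
    (h : A.φ ≫ (Scheme.Modules.pullback 𝒳.t.left).map a =
      (Scheme.Modules.pullback 𝒳.s.left).map a ≫ B.φ) : A ≅ B where
  hom := ⟨a, h⟩
  inv := ⟨inv a, by
    rw [Functor.map_inv, Functor.map_inv, IsIso.comp_inv_eq, Category.assoc, h,
      IsIso.inv_hom_id_assoc]⟩
  hom_inv_id := EquivariantVB.hom_ext _ _ (IsIso.hom_inv_id a)
  inv_hom_id := EquivariantVB.hom_ext _ _ (IsIso.inv_hom_id a)

/-- An identification of the inverse image along the identity with `V`, coherent with composites. It
is found by full faithfulness of this functor, and its other inverse images are then computed from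
the associativity of the canonical isomorphisms. -/
theorem exists_map_eq_compIso_inv {X : Scheme.{u}} (V : X.Modules) :
    ∃ κ : (Scheme.Modules.pullback (𝟙 X)).obj V ⟶ V, IsIso κ ∧ ∀ {T : Scheme.{u}} (t : T ⟶ X)
      (ht : t ≫ 𝟙 X = t), (Scheme.Modules.pullback t).map κ = (compIso ht V).inv := by
  have h₁ : 𝟙 X ≫ 𝟙 X = 𝟙 X := Category.comp_id _
  obtain ⟨κ, hκ⟩ := (Scheme.Modules.pullback (𝟙 X)).map_surjective (compIso h₁ V).inv
  refine ⟨κ, ?_, fun {T} t ht => ?_⟩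
  · have : IsIso ((Scheme.Modules.pullback (𝟙 X)).map κ) := by rw [hκ]; infer_instance
    exact isIso_of_fully_faithful (Scheme.Modules.pullback (𝟙 X)) κ
  · have h₂ := compIso_naturality ht κ
    have h₃ := compIso_assoc h₁ ht ht ht V
    rw [hκ] at h₂
    rw [Iso.cancel_iso_hom_left] at h₃
    rw [h₃, ← Functor.map_comp, Iso.hom_inv_id, CategoryTheory.Functor.map_id] at h₂
    rw [← cancel_mono (compIso ht V).hom, h₂, Iso.inv_hom_id]

namespace GroupoidHom.Comparison

variable {W : EquivariantVB 𝒳} {N : 𝒴.obj.left.Modules} (C : Comparison f W N)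

/-- For g : y → z and a lift (x, c) of y, the pair (x, g ∘ c) is a lift of z; the action of g has to
be the comparison at `c` followed by the inverse of the comparison at g ∘ c. This prescribes it
locally for the universal morphism, and the prescriptions glue. -/
theorem exists_action (D : f.LocalLifts) (hf : f.FullyFaithful) :
    ∃ φ : (Scheme.Modules.pullback 𝒴.s.left).obj N ⟶ (Scheme.Modules.pullback 𝒴.t.left).obj N,
      ∀ {T : Scheme.{u}} {x : T ⟶ 𝒳.obj.left} {c g l : T ⟶ 𝒴.mor.left} {y z : T ⟶ 𝒴.obj.left},
        g ≫ 𝒴.s.left = y → g ≫ 𝒴.t.left = z → f.IsLift x c y → 𝒴.IsComp g c l →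
          tr φ g y z ≫ C.β x l z = C.β x c y := by
  choose x c hxc using D.exists_isLift 𝒴.s.left
  choose l hl using fun i => GroupoidObj.exists_isComp (𝒴.s.left ⁻¹ᵁ D.U i).ι (c i) (hxc i).t.symm
  have hx i : f.IsLift (x i) (l i) ((𝒴.s.left ⁻¹ᵁ D.U i).ι ≫ 𝒴.t.left) := (hxc i).postcomp (hl i)
  have hφ i : ∃ φ, φ ≫ C.β (x i) (l i) ((𝒴.s.left ⁻¹ᵁ D.U i).ι ≫ 𝒴.t.left) =
      C.β (x i) (c i) ((𝒴.s.left ⁻¹ᵁ D.U i).ι ≫ 𝒴.s.left) := by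
    have := C.isIso (hx i)
    exact ⟨_, (Category.assoc _ _ _).trans ((congr_arg _ (IsIso.inv_hom_id _)).trans
      (Category.comp_id _))⟩
  choose φ hφ using hφ
  -- The local action satisfies the required formula for every lift, not only the chosen one: a link
  -- between two lifts of the source is also a link between the lifts of the target obtained by
  -- composing with `g`.
  have key {T : Scheme.{u}} {x' : T ⟶ 𝒳.obj.left} {c' g l' : T ⟶ 𝒴.mor.left} {y z : T ⟶ 𝒴.obj.left}
      (i : D.I) (a : T ⟶ (𝒴.s.left ⁻¹ᵁ D.U i).toScheme) (ha : a ≫ (𝒴.s.left ⁻¹ᵁ D.U i).ι = g)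
      (hy : g ≫ 𝒴.s.left = y) (hz : g ≫ 𝒴.t.left = z) (hl₁ : f.IsLift x' c' y)
      (hl₂ : 𝒴.IsComp g c' l') : tr (φ i) a y z ≫ C.β x' l' z = C.β x' c' y := by
    have e₁ : a ≫ (𝒴.s.left ⁻¹ᵁ D.U i).ι ≫ 𝒴.s.left = y := by rw [← hy, ← ha, Category.assoc]
    have e₂ : a ≫ (𝒴.s.left ⁻¹ᵁ D.U i).ι ≫ 𝒴.t.left = z := by rw [← hz, ← ha, Category.assoc]
    have h₁ := (hxc i).pre a
    have h₂ := (hx i).pre a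
    have h₃ := (hl i).pre a
    rw [e₁] at h₁
    rw [e₂] at h₂
    rw [ha] at h₃
    obtain ⟨h, hh⟩ := hf.exists_isLink h₁ hl₁
    have h₄ := hl₁.postcomp hl₂
    rw [hz] at h₄
    rw [← C.comp_act h₂ h₄ (hh.postcomp h₃ hl₂), ← C.comp_act h₁ hl₁ hh, ← Category.assoc,
      ← C.pre (hx i) a rfl rfl e₂, ← tr_comp _ a _ e₁ e₂ rfl, hφ, C.pre (hxc i) a rfl rfl e₁]
  -- On overlaps both local actions satisfy the formula for the same lift, whose comparison at the
  -- target is an isomorphism and can be cancelled.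
  obtain ⟨ψ, hψ⟩ := exists_tr (x := 𝒴.s.left) (y := 𝒴.t.left) (iSup_preimage D.iSup_eq_top 𝒴.s.left) φ
    fun T i j a b z ha hb => by
      have h₁ := (hxc i).pre a
      rw [← Category.assoc, ha] at h₁
      obtain ⟨m, hm⟩ := GroupoidObj.exists_isComp z (a ≫ c i) h₁.t.symm
      have := C.isIso (h₁.postcomp hm)
      rw [← cancel_mono (C.β (a ≫ x i) m (z ≫ 𝒴.t.left)), key i a ha rfl rfl h₁ hm,
        key j b hb rfl rfl h₁ hm]
  refine ⟨ψ, ?_⟩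
  rintro T x' c' g l' _ _ rfl rfl h₁ h₂
  -- The formula for a general point `g` is checked over the open subsets where its source lies in
  -- some `D.U i`.
  refine tr_ext (iSup_preimage (iSup_preimage D.iSup_eq_top 𝒴.s.left) g) fun i => ?_
  have e := morphismRestrict_ι g (𝒴.s.left ⁻¹ᵁ D.U i)
  have e₁ := (Category.assoc (g ⁻¹ᵁ 𝒴.s.left ⁻¹ᵁ D.U i).ι g 𝒴.s.left)
  have e₂ := (Category.assoc (g ⁻¹ᵁ 𝒴.s.left ⁻¹ᵁ D.U i).ι g 𝒴.t.left)
  have h₃ := key i _ e e₁ e₂ (h₁.pre _) (h₂.pre _)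
  rw [← hψ, tr_tr _ _ rfl rfl _ (by rw [← e₁, ← e, Category.assoc]) (by rw [← e₂, ← e, Category.assoc]) e] at h₃
  rw [tr_comp _ _ _ rfl rfl rfl, C.pre h₁ _ rfl rfl rfl, tr_tr _ _ rfl rfl _ rfl rfl rfl,
    C.pre (h₁.postcomp h₂) _ rfl rfl rfl, h₃]

end GroupoidHom.Comparison

end EssSurj

/-! ### The pullback functor is an equivalence -/

section Equivalence

variable {S : Scheme.{u}} {T T' : Scheme.{u}} {𝒳 𝒴 : GroupoidObj (Over S)} {f : GroupoidHom 𝒳 𝒴}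

namespace GroupoidHom.Comparison

variable {W : EquivariantVB 𝒳} {N : 𝒴.obj.left.Modules} (C : Comparison f W N)

/-- `φ` is the action on `N` compatible with the comparison. -/
def IsAction
    (φ : (Scheme.Modules.pullback 𝒴.s.left).obj N ⟶ (Scheme.Modules.pullback 𝒴.t.left).obj N) : Prop :=
  ∀ ⦃T : Scheme.{u}⦄ ⦃x : T ⟶ 𝒳.obj.left⦄ ⦃c g l : T ⟶ 𝒴.mor.left⦄ ⦃y z : T ⟶ 𝒴.obj.left⦄,
    g ≫ 𝒴.s.left = y → g ≫ 𝒴.t.left = z → f.IsLift x c y → 𝒴.IsComp g c l →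
      tr φ g y z ≫ C.β x l z = C.β x c y

variable {C} {φ : (Scheme.Modules.pullback 𝒴.s.left).obj N ⟶ (Scheme.Modules.pullback 𝒴.t.left).obj N}

/-- Locally the action is expressed by two comparisons, both isomorphisms. -/
theorem IsAction.isIso (H : C.IsAction φ) (D : f.LocalLifts) : IsIso φ := by
  refine isIso_of_tr (iSup_preimage D.iSup_eq_top 𝒴.s.left) fun i => ?_
  obtain ⟨x, c, hx⟩ := D.exists_isLift 𝒴.s.left i
  obtain ⟨l, hl⟩ := GroupoidObj.exists_isComp (𝒴.s.left ⁻¹ᵁ D.U i).ι c hx.t.symm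
  have h := H rfl rfl hx hl
  have h₁ := C.isIso hx
  have h₂ := C.isIso (hx.postcomp hl)
  rw [← h] at h₁
  exact IsIso.of_isIso_comp_right _ (C.β x l ((𝒴.s.left ⁻¹ᵁ D.U i).ι ≫ 𝒴.t.left))

/-- Starting from a local lift c of the source, the lifts h ∘ c and g ∘ (h ∘ c) follow the two
steps. Both sides of the cocycle identity, followed by the comparison at the last lift, give the
comparison at c, and that last comparison is an isomorphism. -/
theorem IsAction.isCocycle (H : C.IsAction φ) (D : f.LocalLifts) : IsCocycle 𝒴 φ := by
  refine isCocycle_of_tr ?_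
  rintro T g h l hl x y z rfl rfl rfl
  refine tr_ext (iSup_preimage D.iSup_eq_top (h ≫ 𝒴.s.left)) fun i => ?_
  obtain ⟨x, c, hx⟩ := D.exists_isLift (h ≫ 𝒴.s.left) i
  set j := ((h ≫ 𝒴.s.left) ⁻¹ᵁ D.U i).ι
  have hl' := hl.pre j
  rw [tr_comp _ _ _ rfl rfl rfl, tr_tr φ l hl.s hl.t j rfl rfl rfl, tr_tr φ h rfl rfl j rfl rfl rfl,
    tr_tr φ g hl.w rfl j rfl rfl rfl]
  have hx' : f.IsLift x c ((j ≫ h) ≫ 𝒴.s.left) := by rwa [Category.assoc]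
  obtain ⟨m, hm⟩ := GroupoidObj.exists_isComp (j ≫ h) c hx'.t.symm
  obtain ⟨n, hn⟩ := GroupoidObj.exists_isComp (j ≫ g) m (by rw [hm.t, hl'.w])
  have hxm := hx'.postcomp hm
  rw [Category.assoc] at hxm
  have hxn := hxm.postcomp hn
  rw [Category.assoc] at hxn
  have := C.isIso hxn
  rw [← cancel_mono (C.β x n (j ≫ g ≫ 𝒴.t.left)), Category.assoc,
    H (by rw [Category.assoc, hl.w]) (Category.assoc _ _ _) hxm hn,
    H (Category.assoc _ _ _) (Category.assoc _ _ _) hx hm,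
    H (by rw [Category.assoc, hl.s]) (by rw [Category.assoc, hl.t]) hx (hl'.assoc' hm hn)]

theorem IsAction.exists_iso (H : C.IsAction φ) :
    ∃ e : (Scheme.Modules.pullback f.f₀.left).obj N ⟶ W.V, IsIso e ∧
      pullbackφ f φ ≫ (Scheme.Modules.pullback 𝒳.t.left).map e =
        (Scheme.Modules.pullback 𝒳.s.left).map e ≫ W.φ := by
  -- The tautological lift of f₀ has first component the identity, so its comparison lands in the
  -- inverse image of `W.V` along the identity; κ identifies this with `W.V`.
  obtain ⟨κ, hκ, hκ'⟩ := exists_map_eq_compIso_inv W.V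
  have hlift : f.IsLift (𝟙 _) (f.f₀.left ≫ 𝒴.e.left) f.f₀.left :=
    ⟨by rw [Category.assoc, GroupoidObj.e_s_left, Category.comp_id, Category.id_comp],
      by rw [Category.assoc, GroupoidObj.e_t_left, Category.comp_id]⟩
  have hβ := C.isIso hlift
  refine ⟨C.β (𝟙 _) (f.f₀.left ≫ 𝒴.e.left) f.f₀.left ≫ κ, inferInstance, ?_⟩
  have htr {T : Scheme.{u}} (t : T ⟶ 𝒳.obj.left) :
      C.β t (t ≫ f.f₀.left ≫ 𝒴.e.left) (t ≫ f.f₀.left) = (compIso rfl N).hom ≫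
        (Scheme.Modules.pullback t).map (C.β (𝟙 _) (f.f₀.left ≫ 𝒴.e.left) f.f₀.left ≫ κ) := by
    rw [← C.pre hlift t (Category.comp_id t) rfl rfl, tr_eq _ _ rfl (Category.comp_id t), baseChange,
      Functor.map_comp, hκ' t (Category.comp_id t)]
  have h₀ : f.IsLift 𝒳.s.left (𝒳.s.left ≫ f.f₀.left ≫ 𝒴.e.left) (𝒳.s.left ≫ f.f₀.left) := by
    have h := hlift.pre 𝒳.s.left
    rwa [Category.comp_id] at h
  have h₀' : 𝒴.IsComp f.f₁.left (𝒳.s.left ≫ f.f₀.left ≫ 𝒴.e.left) f.f₁.left := by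
    have h := GroupoidObj.isComp_id f.f₁.left
    rwa [← Category.assoc, f.w_s_left, Category.assoc] at h
  -- The action of f₁ carries the tautological lift of its source to the lift given by f₁ itself.
  have h₁ := H f.w_s_left f.w_t_left h₀ h₀'
  have h₂ : f.IsLift 𝒳.s.left f.f₁.left (𝒳.t.left ≫ f.f₀.left) := ⟨f.w_s_left, f.w_t_left⟩
  have h₃ : f.IsLift 𝒳.t.left (𝒳.t.left ≫ f.f₀.left ≫ 𝒴.e.left) (𝒳.t.left ≫ f.f₀.left) := by
    have h := hlift.pre 𝒳.t.left
    rwa [Category.comp_id] at h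
  -- The universal morphism of 𝒳, that is, the identity point of its morphism scheme, links this
  -- lift to the tautological lift of the target. Its action on `W` is `W.φ`, so the two relations
  -- together express equivariance.
  have h₄ : f.IsLink 𝒳.s.left f.f₁.left 𝒳.t.left (𝒳.t.left ≫ f.f₀.left ≫ 𝒴.e.left) (𝟙 _) := by
    refine ⟨Category.id_comp _, Category.id_comp _, ?_⟩
    have h := GroupoidObj.id_isComp f.f₁.left
    rwa [← Category.assoc, f.w_t_left, Category.assoc, ← Category.id_comp f.f₁.left] at h
  have h₅ := C.comp_act h₂ h₃ h₄
  rw [EquivariantVB.act, tr_one] at h₅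
  rw [pullbackφ, unComp, Category.assoc, Category.assoc, Iso.inv_comp_eq, ← tr_eq, ← htr,
    ← Category.assoc (compIso rfl N).hom, ← htr, ← h₁, ← h₅, Category.assoc]

end GroupoidHom.Comparison

theorem GroupoidHom.LocalLifts.exists_iso (D : f.LocalLifts) (hf : f.FullyFaithful)
    (W : EquivariantVB 𝒳) : ∃ A : EquivariantVB 𝒴, Nonempty ((pullbackVB f).obj A ≅ W) := by
  obtain ⟨N, ⟨L⟩⟩ := D.exists_localComparison hf W
  obtain ⟨C⟩ := L.nonempty_comparison hf
  obtain ⟨φ, hφ⟩ := C.exists_action D hf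
  have H : C.IsAction φ := fun T x c g l y z => hφ
  obtain ⟨e, he, he'⟩ := H.exists_iso
  have hN : IsVectorBundle N := IsVectorBundle.of_pullback D.iSup_eq_top fun i =>
    have := L.isIso i
    (W.isVectorBundle.pullback (D.x i)).of_iso (asIso (L.β i)).symm
  exact ⟨⟨N, hN, φ, H.isIso D, H.isCocycle D⟩, ⟨@EquivariantVB.isoOfIsIso _ _ ((pullbackVB f).obj ⟨N, hN, φ, H.isIso D, H.isCocycle D⟩) W e he he'⟩⟩

theorem GroupoidHom.LocalLifts.isEquivalence_pullbackVB (D : f.LocalLifts) (hf : f.FullyFaithful) :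
    (pullbackVB f).IsEquivalence where
  faithful := ⟨fun h => D.pullback_map_eq (congr_arg EquivariantVB.Hom.f h)⟩
  full := ⟨fun b => D.exists_map_eq hf b⟩
  essSurj := ⟨fun W => D.exists_iso hf W⟩

end Equivalence

/-! ### Zariski-local criteria for cartesian squares and essential surjectivity -/

section LocalCriteria

variable {S : Scheme.{u}}

/-- Joint injectivity of `p` and `q` on points makes locally constructed lifts agree on overlaps, so
they glue. -/
theorem isPullback_of_local {P X Y Z : Over S} {p : P ⟶ X} {q : P ⟶ Y} {f : X ⟶ Z} {g : Y ⟶ Z}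
    (w : p ≫ f = q ≫ g)
    (mono : ∀ {T : Over S} (z z' : T ⟶ P), z ≫ p = z' ≫ p → z ≫ q = z' ≫ q → z = z')
    (loc : ∀ {T : Over S} (a : T ⟶ X) (b : T ⟶ Y), a ≫ f = b ≫ g → ∀ x : T.left,
      ∃ V : T.left.Opens, x ∈ V ∧ ∃ z : openOver T V ⟶ P,
        z ≫ p = openι T V ≫ a ∧ z ≫ q = openι T V ≫ b) : IsPullback p q f g := by
  have key : ∀ {T : Over S} (a : T ⟶ X) (b : T ⟶ Y), a ≫ f = b ≫ g →
      ∃ z : T ⟶ P, z ≫ p = a ∧ z ≫ q = b := by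
    intro T a b h
    obtain ⟨m, hm, -⟩ := existsUnique_glue (T := T) (W := P)
      (fun j z => z ≫ p = j ≫ a ∧ z ≫ q = j ≫ b)
      (by rintro T' T'' j i z ⟨h₁, h₂⟩
          exact ⟨by rw [Category.assoc, Category.assoc, h₁],
            by rw [Category.assoc, Category.assoc, h₂]⟩)
      (by rintro T' j z z' ⟨h₁, h₂⟩ ⟨h₁', h₂'⟩
          exact mono z z' (h₁.trans h₁'.symm) (h₂.trans h₂'.symm))
      (loc a b h)
    refine ⟨m, over_hom_ext_of_open _ _ fun x => ?_, over_hom_ext_of_open _ _ fun x => ?_⟩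
    all_goals
      obtain ⟨V, hV, z, h₁, h₂⟩ := loc a b h x
      refine ⟨V, hV, ?_⟩
      rw [← Category.assoc, hm _ z ⟨h₁, h₂⟩]
      assumption
  refine ⟨⟨w⟩, ⟨PullbackCone.IsLimit.mk w (fun s => (key s.fst s.snd s.condition).choose)
    (fun s => (key s.fst s.snd s.condition).choose_spec.1)
    (fun s => (key s.fst s.snd s.condition).choose_spec.2)
    (fun s m h₁ h₂ => mono _ _ ?_ ?_)⟩⟩
  · rw [h₁, (key s.fst s.snd s.condition).choose_spec.1]
  · rw [h₂, (key s.fst s.snd s.condition).choose_spec.2]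

theorem exists_open_trans {T : Over S} {V : T.left.Opens} (W : (openOver T V).left.Opens)
    {y : T.left} (hV : y ∈ V) (hW : (⟨y, hV⟩ : V) ∈ W) : ∃ V' : T.left.Opens, y ∈ V' ∧
      ∃ j : openOver T V' ⟶ openOver (openOver T V) W,
        (j ≫ openι (openOver T V) W) ≫ openι T V = openι T V' := by
  let V' : T.left.Opens := V.ι ''ᵁ W
  have hy : y ∈ V' := ⟨⟨y, hV⟩, hW, rfl⟩
  obtain ⟨a, ha⟩ := openι_lift V (openι T V') (eq_top_iff.mpr (by
    rintro ⟨_, w, hw, rfl⟩ -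
    exact w.2))
  obtain ⟨b, hb⟩ := openι_lift W a (eq_top_iff.mpr (by
    rintro z -
    obtain ⟨w, hw, e⟩ : z.1 ∈ V' := z.2
    have e' : V.ι (a.left z) = V'.ι z :=
      congr_arg (fun m : openOver T V' ⟶ T => m.left z) ha
    have e'' : a.left z = w := V.ι.injective (e'.trans e.symm)
    change a.left z ∈ W
    rw [e'']
    exact hw))
  exact ⟨V', hy, b, by rw [hb, ha]⟩

/-- Over a neighbourhood of every point of the target, the objects of the target are isomorphic to
objects of the source. -/
def GroupoidHom.HasLocalLifts {𝒳 𝒴 : GroupoidObj (Over S)} (f : GroupoidHom 𝒳 𝒴) : Prop :=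
  ∀ y : 𝒴.obj.left, ∃ V : 𝒴.obj.left.Opens, y ∈ V ∧
    ∃ (x : openOver 𝒴.obj V ⟶ 𝒳.obj) (c : openOver 𝒴.obj V ⟶ 𝒴.mor),
      c ≫ 𝒴.s = x ≫ f.f₀ ∧ c ≫ 𝒴.t = openι 𝒴.obj V

namespace GroupoidHom.HasLocalLifts

variable {𝒳 𝒴 : GroupoidObj (Over S)} {f : GroupoidHom 𝒳 𝒴}

theorem nonempty_localLifts (H : f.HasLocalLifts) : Nonempty f.LocalLifts := by
  choose V hV x c hs ht using H
  exact ⟨{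
    I := 𝒴.obj.left
    U := V
    iSup_eq_top := eq_top_iff.mpr fun y _ => TopologicalSpace.Opens.mem_iSup.mpr ⟨y, hV y⟩
    x := fun y => (x y).left
    c := fun y => (c y).left
    isLift := fun y => ⟨congr_arg CommaMorphism.left (hs y), congr_arg CommaMorphism.left (ht y)⟩ }⟩

/-- The open subsets carrying lifts form a Zariski covering, which is an fpqc covering, and each
lift is a section over its member. -/
theorem locallyEssSurj (H : f.HasLocalLifts) : f.LocallyEssSurj := by
  choose V hV x c hs ht using H
  let 𝒰 := 𝒴.obj.left.openCoverOfIsOpenCover V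
    (eq_top_iff.mpr fun y _ => TopologicalSpace.Opens.mem_iSup.mpr ⟨y, hV y⟩)
  refine ⟨Presieve.ofArrows 𝒰.X 𝒰.f,
    Scheme.zariskiPrecoverage_le_fpqcPrecoverage _ 𝒰.mem₀, ?_⟩
  rintro _ _ ⟨y⟩
  refine ⟨(pullback.lift (x y) (c y) (hs y).symm).left, ?_⟩
  have h : pullback.lift (x y) (c y) (hs y).symm ≫ f.essMap = openι 𝒴.obj (V y) := by
    rw [essMap, pullback.lift_snd_assoc]
    exact ht y
  exact congr_arg CommaMorphism.left h

end GroupoidHom.HasLocalLifts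

end LocalCriteria

/-! ### Matrix computations: full faithfulness and local lifts for Ψ -/

section Psi

open Matrix

variable {k : Type u} [Field k] {T : Over (Spec (CommRingCat.of k))}

theorem cross_of_lift_pt_eq {u u' w w' : Fin 2 → O T} {hu : Unimodular u} {hu' : Unimodular u'}
    {hw : Unimodular w} {hw' : Unimodular w'}
    (h : lift (pt u hu) (pt w hw) = lift (pt u' hu') (pt w' hw')) :
    u 0 * u' 1 = u 1 * u' 0 ∧ w 0 * w' 1 = w 1 * w' 0 := by
  have h₁ := congr_arg (· ≫ fst (P1 k) (P1 k)) h
  have h₂ := congr_arg (· ≫ snd (P1 k) (P1 k)) h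
  simp only [lift_fst, lift_snd] at h₁ h₂
  exact ⟨cross_of_pt_eq _ _ h₁ 0 1, cross_of_pt_eq _ _ h₂ 0 1⟩

theorem pgl_smul_lift_pt (a : Matrix (Fin 2) (Fin 2) (O T)) (ha : IsUnit a.det) (u w : Fin 2 → O T)
    (hu : Unimodular u) (hw : Unimodular w) :
    pgl a ha • (lift (pt u hu) (pt w hw) : T ⟶ P1 k ⊗ P1 k) =
      lift (pt (a *ᵥ u) (unimodular_mulVec ha hu)) (pt (a *ᵥ w) (unimodular_mulVec ha hw)) := by
  rw [← pgl_smul_pt, ← pgl_smul_pt]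
  exact diag_smul_lift (PGL2 k) (P1 k) (P1 k) _ _ _

theorem psiX_injective {x x' : O T} (h : (psiX x : T ⟶ P1 k ⊗ P1 k) = psiX x') : x = x' := by
  simpa using (cross_of_lift_pt_eq h).1

/-- Both matrices have upper left entry 1, so equality in PGL₂ forces equality of the lower rows. By
γ x + δ = 1 the value of the lower row at (x, 1) is t⁻¹, which recovers t, then δ and γ. -/
theorem psiG_injective {t t' δ δ' : (O T)ˣ} {c c' x : O T} (h : c * x + δ.val = 1)
    (h' : c' * x + δ'.val = 1) (e : (psiG t δ c : T ⟶ PGL2 k) = psiG t' δ' c') :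
    t = t' ∧ δ = δ' ∧ c = c' := by
  have e₁ := cross_of_pgl_eq e 0 0 1 0
  have e₂ := cross_of_pgl_eq e 0 0 1 1
  simp [psiMat] at e₁ e₂
  have et : t'⁻¹.val = t⁻¹.val := by
    linear_combination x * e₁ + e₂ + t⁻¹.val * h - t'⁻¹.val * h'
  have et' : t = t' := inv_injective (Units.ext et.symm)
  subst et'
  exact ⟨rfl, Units.ext (t⁻¹.isUnit.mul_left_cancel e₂).symm,
    (t⁻¹.isUnit.mul_left_cancel e₁).symm⟩

/-- Fixing [0 : 1] kills the upper right entry; normalizing by the value s of the lower row at (x,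
1) produces t, γ and δ. -/
theorem exists_psiG (a : Matrix (Fin 2) (Fin 2) (O T)) (ha : IsUnit a.det) {x x' : O T}
    (h : pgl a ha • (psiX x : T ⟶ P1 k ⊗ P1 k) = psiX x') :
    ∃ (t δ : (O T)ˣ) (c : O T), c * x + δ.val = 1 ∧ t.val * x = x' ∧ pgl a ha = psiG t δ c := by
  rw [psiX, pgl_smul_lift_pt] at h
  obtain ⟨h₁, h₂⟩ := cross_of_lift_pt_eq h
  simp [Matrix.mulVec, dotProduct, Fin.sum_univ_two] at h₁ h₂
  have hdet := ha
  rw [Matrix.det_fin_two, h₂, zero_mul, sub_zero] at hdet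
  obtain ⟨p, hp⟩ := isUnit_of_mul_isUnit_left hdet
  obtain ⟨q, hq⟩ := isUnit_of_mul_isUnit_right hdet
  rw [h₂, add_zero] at h₁
  -- The image vector (a₀₀ x, s) is unimodular and its first entry equals s x', so s generates the
  -- unit ideal.
  have hs : IsUnit (a 1 0 * x + a 1 1) := by
    obtain ⟨d, hd⟩ := unimodular_mulVec ha (unimodular_x_one x)
    simp [Matrix.mulVec, dotProduct, Fin.sum_univ_two, h₂] at hd
    refine IsUnit.of_mul_eq_one (d 0 * x' + d 1) ?_
    linear_combination hd - d 0 * h₁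
  obtain ⟨s, hs⟩ := hs
  refine ⟨p * s⁻¹, q * s⁻¹, a 1 0 * s⁻¹.val, ?_, ?_, ?_⟩
  · rw [Units.val_mul, hq]
    linear_combination s⁻¹.val * (-hs) + s.inv_mul
  · rw [Units.val_mul, hp]
    rw [← hs] at h₁
    linear_combination s⁻¹.val * h₁ + x' * s.inv_mul
  · refine pgl_eq_of_cross _ _ ?_
    -- In the lower row the factor s cancels, so the matrix of Ψ is `a` divided by its upper left
    -- entry.
    have e : psiMat (p * s⁻¹) (q * s⁻¹) (a 1 0 * s⁻¹.val) = p⁻¹.val • a := by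
      ext i j
      fin_cases i <;> fin_cases j <;> simp [psiMat, h₂, ← hp, ← hq]
      · linear_combination p⁻¹.val * a 1 0 * s.inv_mul
      · linear_combination p⁻¹.val * q.val * s.inv_mul
    intro i j l m
    rw [e]
    simp only [Matrix.smul_apply, smul_eq_mul]
    ring

theorem psi_fullyFaithful (k : Type u) [Field k] : (psi k).FullyFaithful := by
  have hw : psi₁ k ≫ lift (snd (PGL2 k) (P1 k ⊗ P1 k))
      (fst (PGL2 k) (P1 k ⊗ P1 k) • snd (PGL2 k) (P1 k ⊗ P1 k)) =
      lift (snd (Gm k) (N1 k) ≫ n1Proj k) ((fst (Gm k) (N1 k) • snd (Gm k) (N1 k)) ≫ n1Proj k) ≫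
        (psi₀ k ⊗ₘ psi₀ k) := by
    rw [comp_lift, lift_map, psi_w_s, psi_w_t]
  have H : IsPullback (psi₁ k)
      (lift (snd (Gm k) (N1 k) ≫ n1Proj k) ((fst (Gm k) (N1 k) • snd (Gm k) (N1 k)) ≫ n1Proj k))
      (lift (snd (PGL2 k) (P1 k ⊗ P1 k))
        (fst (PGL2 k) (P1 k ⊗ P1 k) • snd (PGL2 k) (P1 k ⊗ P1 k)))
      (psi₀ k ⊗ₘ psi₀ k) := by
    refine isPullback_of_local hw ?_ ?_
    · intro T z z' h _
      rw [comp_psi₁, comp_psi₁] at h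
      have h₁ := congr_arg (· ≫ fst _ _) h
      have h₂ := congr_arg (· ≫ snd _ _) h
      simp only [lift_fst, lift_snd] at h₁ h₂
      have hx := psiX_injective h₂
      obtain ⟨ht, hd, hc⟩ := psiG_injective (N1.rel _) (by rw [hx]; exact N1.rel _) h₁
      exact CartesianMonoidalCategory.hom_ext _ _ (Gm.ext ht) (N1.ext hc hd hx)
    · intro T a b h y
      -- A point of PGL₂ is represented by an invertible matrix only locally; this is why a local
      -- criterion is used.
      obtain ⟨V, hV, m, hm⟩ := (pglPres k).loc (a ≫ fst _ _) y
      refine ⟨V, hV, ?_⟩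
      have h' : openι T V ≫ a ≫ _ = openι T V ≫ b ≫ _ := congr_arg (openι T V ≫ ·) h
      rw [← Category.assoc, ← Category.assoc] at h'
      have hm' : (openι T V ≫ a) ≫ fst _ _ = pgl m.1 m.2 := (Category.assoc _ _ _).trans hm
      generalize openι T V ≫ a = a at h' hm' ⊢
      generalize openι T V ≫ b = b at h' ⊢
      have h₁ := congr_arg (· ≫ fst _ _) h'
      have h₂ := congr_arg (· ≫ snd _ _) h'
      simp only [Category.assoc, lift_fst, lift_snd, tensorHom_fst, tensorHom_snd] at h₁ h₂
      rw [← Category.assoc, comp_psi₀] at h₁ h₂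
      rw [ModObj.comp_smul, h₁, hm'] at h₂
      obtain ⟨t, δ, c, e₁, e₂, e₃⟩ := exists_psiG _ _ h₂
      refine ⟨lift (Gm.mk t) (N1.mk c δ _ e₁), ?_, ?_⟩
      · rw [comp_psi₁]
        simp only [lift_fst, lift_snd, Gm.t_mk, N1.del_mk, N1.gam_mk, N1.x_mk]
        rw [← e₃, ← h₁, ← hm']
        exact CartesianMonoidalCategory.hom_ext _ _ (by rw [lift_fst]) (by rw [lift_snd])
      · rw [comp_lift]
        refine CartesianMonoidalCategory.hom_ext _ _ ?_ ?_
        · rw [lift_fst, lift_snd_assoc]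
          exact A1.ext (by rw [A1.x_n1Proj, N1.x_mk])
        · rw [lift_snd, ← Category.assoc, ModObj.comp_smul, lift_fst, lift_snd]
          exact A1.ext (by rw [A1.x_n1Proj, N1.x_smul, N1.x_mk, Gm.t_mk, e₂])
  exact H

/-- The matrix with columns w, v sends [0 : 1] to [v]. Writing a × b = a₀ b₁ - a₁ b₀, the identity w
(u × v) + v (w × u) = u (w × v) shows that it sends [x : 1] to [u] for x = (u × v)/(w × u). -/
theorem exists_psi_lift {u v w : Fin 2 → O T} (hu : Unimodular u) (hv : Unimodular v)
    (hwu : IsUnit (w 0 * u 1 - w 1 * u 0)) (hwv : IsUnit (w 0 * v 1 - w 1 * v 0)) :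
    ∃ (x : T ⟶ A1 k) (c : T ⟶ PGL2 k ⊗ (P1 k ⊗ P1 k)), c ≫ snd _ _ = x ≫ psi₀ k ∧
      c ≫ (fst (PGL2 k) (P1 k ⊗ P1 k) • snd (PGL2 k) (P1 k ⊗ P1 k)) = lift (pt u hu) (pt v hv) := by
  obtain ⟨p, hp⟩ := hwu
  have ha : IsUnit (!![w 0, v 0; w 1, v 1] : Matrix (Fin 2) (Fin 2) (O T)).det := by
    rw [Matrix.det_fin_two_of, mul_comm (v 0)]
    exact hwv
  refine ⟨A1.mk (p⁻¹.val * (u 0 * v 1 - u 1 * v 0)),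
    lift (pgl _ ha) (psiX (p⁻¹.val * (u 0 * v 1 - u 1 * v 0))), ?_, ?_⟩
  · rw [lift_snd, comp_psi₀, A1.x_mk]
  · rw [ModObj.comp_smul, lift_fst, lift_snd, psiX, pgl_smul_lift_pt]
    congr 1
    · apply pt_eq_of_cross
      have key : (w 0 * (p⁻¹.val * (u 0 * v 1 - u 1 * v 0)) + v 0) * u 1 =
          (w 1 * (p⁻¹.val * (u 0 * v 1 - u 1 * v 0)) + v 1) * u 0 := by
        linear_combination -(p⁻¹.val * (u 0 * v 1 - u 1 * v 0)) * hp +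
          (u 0 * v 1 - u 1 * v 0) * p.inv_mul
      intro i j
      fin_cases i <;> fin_cases j <;>
        simp [Matrix.mulVec, dotProduct, Fin.sum_univ_two, key]
    · apply pt_eq_of_cross
      intro i j
      fin_cases i <;> fin_cases j <;>
        simp [Matrix.mulVec, dotProduct, Fin.sum_univ_two, mul_comm]

/-- Of the three points [1 : 0], [0 : 1], [1 : 1] at least one differs from both [u] and [v] in the
residue field at `y`, whatever that field is; being distinct is an open condition. -/
theorem exists_open_cross (u v : Fin 2 → O T) (hu : Unimodular u) (hv : Unimodular v)
    (y : T.left) : ∃ (V : T.left.Opens) (w : Fin 2 → O T), y ∈ V ∧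
      IsUnit (res (openι T V) (w 0 * u 1 - w 1 * u 0)) ∧
      IsUnit (res (openι T V) (w 0 * v 1 - w 1 * v 0)) := by
  suffices h : ∃ w : Fin 2 → O T, y ∈ T.left.basicOpen (w 0 * u 1 - w 1 * u 0) ∧
      y ∈ T.left.basicOpen (w 0 * v 1 - w 1 * v 0) by
    obtain ⟨w, h₁, h₂⟩ := h
    exact ⟨T.left.basicOpen (w 0 * u 1 - w 1 * u 0) ⊓ T.left.basicOpen (w 0 * v 1 - w 1 * v 0), w, ⟨h₁, h₂⟩, isUnit_res_openι _ _ inf_le_left, isUnit_res_openι _ _ inf_le_right⟩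
  let e := (T.left.evaluation ⊤ y (TopologicalSpace.Opens.mem_top y)).hom
  have he : ∀ a : O T, y ∈ T.left.basicOpen a ↔ e a ≠ 0 := fun a =>
    (T.left.evaluation_ne_zero_iff_mem_basicOpen y (TopologicalSpace.Opens.mem_top y) a).symm
  have hne : ∀ u : Fin 2 → O T, Unimodular u → ¬ (e (u 0) = 0 ∧ e (u 1) = 0) := by
    rintro u ⟨c, hc⟩ ⟨h₀, h₁⟩
    have := congr_arg e hc
    rw [Fin.sum_univ_two, map_add, map_mul, map_mul, h₀, h₁, map_one] at this
    simp at this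
  have hu' := hne u hu
  have hv' := hne v hv
  -- Otherwise each of the three constant vectors is proportional at `y` to `u` or to `v`, although
  -- two points of the projective line cannot account for three.
  by_contra! H
  simp only [he, ne_eq, not_not] at H
  have H₁ := H ![1, 0]
  have H₂ := H ![0, 1]
  have H₃ := H ![1, 1]
  simp at H₁ H₂ H₃
  rw [sub_eq_zero, sub_eq_zero] at H₃
  by_cases a₁ : e (u 1) = 0 <;> by_cases a₂ : e (u 0) = 0 <;> simp_all

theorem psi_hasLocalLifts (k : Type u) [Field k] : (psi k).HasLocalLifts := by
  intro y
  -- The universal pair of points, given by the identity of ℙ¹ × ℙ¹, acquires homogeneous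
  -- coordinates near `y`; a further shrinking provides `w`.
  obtain ⟨V, hV, ⟨⟨u, hu⟩, ⟨v, hv⟩⟩, e⟩ :=
    ((prPres k (Fin 2)).prod (prPres k (Fin 2))).loc (𝟙 (P1 k ⊗ P1 k)) y
  obtain ⟨W, w, hW, h₁, h₂⟩ := exists_open_cross u v hu hv ⟨y, hV⟩
  obtain ⟨V', hV', j, hj⟩ := exists_open_trans W hV hW
  obtain ⟨x, c, hs, ht⟩ := exists_psi_lift (hu.map (res (openι _ W))) (hv.map (res (openι _ W)))
    (w := fun i => res (openι _ W) (w i)) (by simpa using h₁) (by simpa using h₂)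
  refine ⟨V', hV', j ≫ x, j ≫ c, ?_, ?_⟩
  · exact (Category.assoc _ _ _).trans ((congr_arg (j ≫ ·) hs).trans (Category.assoc _ _ _).symm)
  · have e' : openι _ V = lift (pt u hu) (pt v hv) := (Category.comp_id _).symm.trans e
    refine (Category.assoc _ _ _).trans ((congr_arg (j ≫ ·) ht).trans (Eq.trans ?_ hj))
    rw [e', Category.assoc, ← pt_nat _ hu, ← pt_nat _ hv, ← comp_lift]

end Psi

end GrpdSch

theorem mainTheorem6 (k : Type u) [Field k] :
    (GrpdSch.psi k).IsFpqcEquivalence ∧ (GrpdSch.pullbackVB (GrpdSch.psi k)).IsEquivalence := by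
  obtain ⟨D⟩ := (GrpdSch.psi_hasLocalLifts k).nonempty_localLifts
  exact ⟨⟨GrpdSch.psi_fullyFaithful k, (GrpdSch.psi_hasLocalLifts k).locallyEssSurj⟩,
    D.isEquivalence_pullbackVB (GrpdSch.psi_fullyFaithful k)⟩
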